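/- **Setting.** Let $n\ge 1$, let $\varepsilon_i$, $i\in\mathbb Z$, be i.i.d. random vectors in $\mathbb R^{\tilde d}$ on a probability space, and for each $k$ let $\varepsilon_k^*$ be an independent copy of $\varepsilon_k$, independent of $(\varepsilon_i)_{i\in\mathbb Z}$. Let $X_i=J_{i,n}(\varepsilon_i,\varepsilon_{i-1},\dots)\in\mathbb R^d$ with measurable $J_{i,n}$, let $Z_i=(X_i,X_{i-1},\dots)$, and let $X_i^{*(i-k)}$ be $X_i$ with $\varepsilon_{i-k}$ replaced by $\varepsilon_{i-k}^*$. Put $\|W\|_r=\mathbb E[|W|^r]^{1/r}$ ($\|\cdot\|_\infty$ the essential supremum) and $\delta_r^X(k)=\sup_{i\le n}\max_{j\le d}\|X_{ij}-X_{ij}^{*(i-k)}\|_r$. Let $\mathcal F$ be a class of measurable functions $f:(\mathbb R^d)^{\mathbb N_0}\times[0,1]\to\mathbb R$, each written as $f(z,u)=D_{f,n}(u)\bar f(z,u)$, and let $M>0$ be such that $|f(z,u)|\le M$ for all $f\in\mathcal F$ and all $z,u$. Put $$\mathbb G_n(f)=\frac1{\sqrt n}\sum_{i=1}^n\{f(Z_i,\tfrac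 in)-\mathbb E f(Z_i,\tfrac in)\},\qquad \|f\|_{2,n}=\Big(\frac1n\sum_{i=1}^n\|f(Z_i,\tfrac in)\|_2^2\Big)^{1/2}.$$ **Assumption 1.** Let $(\Delta(k))_{k\ge0}$ be a decreasing, nonnegative, summable sequence and $\mathbb D_n\ge 0$. There are $s\in(0,1]$, a summable sequence $L_j\ge0$, constants $C_R,C_{\bar f},C_X>0$, a function $R:(\mathbb R^d)^{\mathbb N_0}\times[0,1]\to[0,\infty)$, measurable in $z$, and $\nu\ge2$, $p\in(1,\infty]$ such that for all $f\in\mathcal F$, all $u\in[0,1]$ and all $z,z'$ with $\sum_jL_j|z_j-z_j'|_\infty^s<\infty$, $$|\bar f(z,u)-\bar f(z',u)|\le\sum_{j\ge0}L_j|z_j-z'_j|_\infty^s\,[R(z,u)+R(z',u)],\quad |\bar f(0,u)|\le C_{\bar f},\quad |R(0,u)|\le C_R;$$ $\|R(Z_i,u)\|_{\nu p}\le C_R$ for $1\le i\le n$, $u\in[0,1]$; $\|X_{ij}\|_{\nu sp/(p-1)}\le C_X$ for $i\le n$, $1\le j\le d$ (where $p/(p-1)=1$ if $p=\infty$); and $$2dC_R\sum_{j=0}^kL_j\big(\delta^X_{\nu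 sp/(p-1)}(k-j)\big)^s\le\Delta(k)\quad(k\ge0),\qquad \sup_{f\in\mathcal F}\Big(\frac1n\sum_{i=1}^nD_{f,n}(\tfrac in)^2\Big)^{1/2}\le\mathbb D_n.$$ Let $\mathbb D_n^\infty\ge0$ satisfy $\big(\frac1n\sum_{i=1}^n\sup_{f\in\mathcal F}|D_{f,n}(\frac in)|^2\big)^{1/2}\le\mathbb D_n^\infty$. **Quantities.** For $q\ge1$ put $\omega(q)=q^{1/\nu}\log(eq)^{3/2}$, $\mathcal L(q)=\log\log(e^eq)$, $\Phi(q)=q\mathcal L(q)$, $$\tilde\beta(q)=\sum_{j\ge q}\Delta(j)\omega(j)\mathcal L(j)\in[0,\infty],\qquad \tilde V(f)=\|f\|_{2,n}+\sum_{j\ge1}\min\{\|f\|_{2,n},\mathbb D_n\Delta(j)\omega(j)\}\mathcal L(j)\in[0,\infty].$$ **Theorem (Bernstein-type large deviation inequality).** There are universal constants $c_0,c_1>0$ such that in every such situation (under Assumption 1) there are events $B_n(q)$, $q\in\mathbb N$, which do not depend on $f\in\mathcal F$, with the following properties. (i) For every $q\in\{1,\dots,n\}$, every $f\in\mathcal F$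 and every $x>0$, $$\mathbb P\big(|\mathbb G_n(f)|>x,\;B_n(q)\big)\le c_0\exp\Big(-\frac1{c_1}\frac{x^2}{\tilde V(f)^2+\frac{M\Phi(q)}{\sqrt n}x}\Big),\qquad \mathbb P(B_n(q)^c)\le4\Big(\frac{\mathbb D_n^\infty\tilde\beta(q)\sqrt n}{M\Phi(q)}\Big)^2,$$ where the exponent is read as $0$ if $\tilde V(f)=\infty$, and $0\cdot\infty=0$. (ii) Suppose $\tilde\beta(1)<\infty$ and $\mathbb D_n^\infty>0$, and let $\tilde q^*(z)=\min\{q\ge1:\tilde\beta(q)\le\Phi(q)z\}$ for $z>0$. Then for every $y>0$, with $\tilde q^*=\tilde q^*\big(\frac{M}{\sqrt n\,\mathbb D_n^\infty y}\big)$, and for every $f\in\mathcal F$ and $x>0$, $$\mathbb P\big(|\mathbb G_n(f)|>x,\;B_n(\tilde q^*)\big)\le c_0\exp\Big(-\frac1{c_1}\frac{x^2}{\tilde V(f)^2+\Phi(\tilde q^*)\frac{Mx}{\sqrt n}}\Big),\qquad \mathbb P(B_n(\tilde q^*)^c)\le\frac4{y^2}.$$ -/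

import Mathlib

open MeasureTheory ProbabilityTheory
open scoped ENNReal

noncomputable section

namespace FunctionalDependence

/-! ### Bernoulli shift processes and the functional dependence measure -/

/-- `ε i`, `i ∈ ℤ`, are i.i.d. random vectors, and every `ε' k` is an independent copy of `ε k`
which is independent of the whole sequence `ε`. -/
structure IsInnovation {Ω : Type*} [MeasurableSpace Ω] (μ : Measure Ω) {e : ℕ}
    (ε ε' : ℤ → Ω → (Fin e → ℝ)) : Prop where
  measurable : ∀ i, Measurable (ε i)
  measurable_copy : ∀ i, Measurable (ε' i)
  indep : iIndepFun ε μ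
  identDistrib : ∀ i, IdentDistrib (ε i) (ε 0) μ μ
  copy_identDistrib : ∀ k, IdentDistrib (ε' k) (ε k) μ μ
  copy_indep : ∀ k, IndepFun (ε' k) (fun ω (i : ℤ) => ε i ω) μ

/-- `X_i = J_i(ε_i, ε_{i-1}, …)`. -/
def shiftSeq {Ω : Type*} {e d : ℕ} (J : ℤ → (ℕ → (Fin e → ℝ)) → (Fin d → ℝ))
    (ε : ℤ → Ω → (Fin e → ℝ)) (i : ℤ) (ω : Ω) : Fin d → ℝ :=
  J i (fun m : ℕ => ε (i - m) ω)

/-- `X_i^{*(i-k)} = J_i(ε_i, …, ε_{i-k+1}, ε'_{i-k}, ε_{i-k-1}, …)`. -/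
def coupledShift {Ω : Type*} {e d : ℕ} (J : ℤ → (ℕ → (Fin e → ℝ)) → (Fin d → ℝ))
    (ε ε' : ℤ → Ω → (Fin e → ℝ)) (i : ℤ) (k : ℕ) (ω : Ω) : Fin d → ℝ :=
  J i (fun m : ℕ => if m = k then ε' (i - m) ω else ε (i - m) ω)

/-- `Z_i = (X_i, X_{i-1}, X_{i-2}, …)`. -/
def past {Ω : Type*} {d : ℕ} (X : ℤ → Ω → (Fin d → ℝ)) (i : ℤ) (ω : Ω) : ℕ → (Fin d → ℝ) :=
  fun m : ℕ => X (i - m) ω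

/-- The uniform functional dependence measure `δ_r^X(k)`. The supremum runs over all time
points `i ≤ n` which enter `Z_1, …, Z_n`. -/
def depMeasure {Ω : Type*} [MeasurableSpace Ω] (μ : Measure Ω) {e d : ℕ} (n : ℕ)
    (J : ℤ → (ℕ → (Fin e → ℝ)) → (Fin d → ℝ)) (ε ε' : ℤ → Ω → (Fin e → ℝ))
    (r : ℝ≥0∞) (k : ℕ) : ℝ≥0∞ :=
  ⨆ (i : ℤ) (_ : i ≤ (n : ℤ)) (j : Fin d),
    eLpNorm (fun ω => shiftSeq J ε i ω j - coupledShift J ε ε' i k ω j) r μ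

/-- The point `i / n` of `[0,1]`; the projection onto `[0,1]` is the identity for `i ≤ n`. -/
def gridPoint (n i : ℕ) : unitInterval :=
  Set.projIcc (0 : ℝ) 1 zero_le_one ((i : ℝ) / (n : ℝ))

/-! ### Function classes -/

/-- Functions `f(z, u)` of `z ∈ (ℝ^d)^{ℕ₀}` and `u ∈ [0,1]`. -/
abbrev PathFun (d : ℕ) : Type := (ℕ → (Fin d → ℝ)) → unitInterval → ℝ

/-- `|z|_{χ,s} = (∑_i χ_i |z_i|_∞^s)^{1/s}`, possibly infinite. -/
def weightedNorm {d : ℕ} (χ : ℕ → ℝ) (s : ℝ) (z : ℕ → (Fin d → ℝ)) : ℝ≥0∞ :=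
  (∑' i, ENNReal.ofReal (χ i) * ‖z i‖ₑ ^ s) ^ (1 / s)

/-- `(L, s, R, C)`-classes, `C = (CR, Cf)`. The smoothness condition is void for `z, z'` at
infinite distance. -/
structure IsSmoothClass {d : ℕ} (Fbar : Set (PathFun d)) (L : ℕ → ℝ) (s : ℝ) (R : PathFun d)
    (CR Cf : ℝ) : Prop where
  L_nonneg : ∀ i, 0 ≤ L i
  L_summable : Summable L
  s_pos : 0 < s
  s_le_one : s ≤ 1
  R_nonneg : ∀ z u, 0 ≤ R z u
  R_measurable : ∀ u, Measurable (fun z => R z u)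
  CR_pos : 0 < CR
  Cf_pos : 0 < Cf
  smooth : ∀ g ∈ Fbar, ∀ u z z', weightedNorm L s (z - z') ≠ ∞ →
    |g z u - g z' u| ≤ (weightedNorm L s (z - z')).toReal ^ s * (R z u + R z' u)
  bound_zero : ∀ g ∈ Fbar, ∀ u, |g 0 u| ≤ Cf
  R_zero : ∀ u, |R 0 u| ≤ CR

/-- The compatibility condition on the class `F`, whose members factor as
`f(z,u) = D_f(u) · f̄(z,u)`. The exponents are `ν p` and `ν s p / (p - 1)`. -/
structure CompatibilityCondition {Ω : Type*} [MeasurableSpace Ω] (μ : Measure Ω) {e d : ℕ}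
    (n : ℕ) (J : ℤ → (ℕ → (Fin e → ℝ)) → (Fin d → ℝ)) (ε ε' : ℤ → Ω → (Fin e → ℝ))
    (F : Set (PathFun d)) (D : PathFun d → unitInterval → ℝ) (fbar : PathFun d → PathFun d)
    (L : ℕ → ℝ) (s : ℝ) (R : PathFun d) (CR Cf CX ν : ℝ) (p : ℝ≥0∞) (Δ : ℕ → ℝ) (Dn : ℝ) :
    Prop where
  factor : ∀ f ∈ F, ∀ z u, f z u = D f u * fbar f z u
  smoothClass : IsSmoothClass (fbar '' F) L s R CR Cf
  two_le_ν : 2 ≤ ν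
  one_lt_p : 1 < p
  CX_pos : 0 < CX
  moment_R : ∀ i ∈ Finset.Icc 1 n, ∀ u,
    eLpNorm (fun ω => R (past (shiftSeq J ε) (i : ℤ) ω) u) (ENNReal.ofReal ν * p) μ
      ≤ ENNReal.ofReal CR
  moment_X : ∀ i : ℤ, i ≤ (n : ℤ) → ∀ j,
    eLpNorm (fun ω => shiftSeq J ε i ω j) (ENNReal.ofReal (ν * s) * ENNReal.conjExponent p) μ
      ≤ ENNReal.ofReal CX
  dep : ∀ k : ℕ,
    2 * (d : ℝ≥0∞) * ENNReal.ofReal CR *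
        ∑ j ∈ Finset.range (k + 1), ENNReal.ofReal (L j) *
          depMeasure μ n J ε ε' (ENNReal.ofReal (ν * s) * ENNReal.conjExponent p) (k - j) ^ s
      ≤ ENNReal.ofReal (Δ k)
  D_bound : ∀ f ∈ F,
    Real.sqrt ((1 / (n : ℝ)) * ∑ i ∈ Finset.Icc 1 n, |D f (gridPoint n i)| ^ 2) ≤ Dn

/-- `((1/n) ∑_{i=1}^n D_n^∞(i/n)²)^{1/2}`, where `D_n^∞(u) = sup_{f ∈ F} |D_f(u)|`. -/
def envelopeNorm {d : ℕ} (n : ℕ) (F : Set (PathFun d)) (D : PathFun d → unitInterval → ℝ) :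
    ℝ≥0∞ :=
  ((n : ℝ≥0∞)⁻¹ * ∑ i ∈ Finset.Icc 1 n, (⨆ f ∈ F, ‖D f (gridPoint n i)‖ₑ) ^ 2) ^ (1 / 2 : ℝ)

/-! ### The empirical process and the quantities in the deviation bound -/

/-- `𝔾_n(f) = n^{-1/2} ∑_{i=1}^n {f(Z_i, i/n) - 𝔼 f(Z_i, i/n)}`. -/
def empProc {Ω : Type*} [MeasurableSpace Ω] (μ : Measure Ω) {e d : ℕ} (n : ℕ)
    (J : ℤ → (ℕ → (Fin e → ℝ)) → (Fin d → ℝ)) (ε : ℤ → Ω → (Fin e → ℝ)) (f : PathFun d)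
    (ω : Ω) : ℝ :=
  (1 / Real.sqrt n) * ∑ i ∈ Finset.Icc 1 n,
    (f (past (shiftSeq J ε) (i : ℤ) ω) (gridPoint n i)
      - ∫ ω', f (past (shiftSeq J ε) (i : ℤ) ω') (gridPoint n i) ∂μ)

/-- `‖f‖_{2,n} = ((1/n) ∑_{i=1}^n ‖f(Z_i, i/n)‖_2²)^{1/2}`. -/
def norm2n {Ω : Type*} [MeasurableSpace Ω] (μ : Measure Ω) {e d : ℕ} (n : ℕ)
    (J : ℤ → (ℕ → (Fin e → ℝ)) → (Fin d → ℝ)) (ε : ℤ → Ω → (Fin e → ℝ)) (f : PathFun d) :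
    ℝ≥0∞ :=
  ((n : ℝ≥0∞)⁻¹ * ∑ i ∈ Finset.Icc 1 n,
    eLpNorm (fun ω => f (past (shiftSeq J ε) (i : ℤ) ω) (gridPoint n i)) 2 μ ^ 2) ^ (1 / 2 : ℝ)

/-- `ω(q) = q^{1/ν} log(e q)^{3/2}`. -/
def omegaWeight (ν : ℝ) (q : ℕ) : ℝ :=
  (q : ℝ) ^ (1 / ν) * Real.log (Real.exp 1 * q) ^ (3 / 2 : ℝ)

/-- `𝓛(q) = log log(e^e q)`. -/
def iterLog (q : ℕ) : ℝ := Real.log (Real.log (Real.exp (Real.exp 1) * q))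

/-- `Φ(q) = q 𝓛(q)`. -/
def Phi (q : ℕ) : ℝ := q * iterLog q

/-- `β̃(q) = ∑_{j ≥ q} Δ(j) ω(j) 𝓛(j)`, possibly infinite. -/
def tildeBeta (ν : ℝ) (Δ : ℕ → ℝ) (q : ℕ) : ℝ≥0∞ :=
  ∑' j : ℕ, ENNReal.ofReal (Δ (q + j) * omegaWeight ν (q + j) * iterLog (q + j))

/-- `Ṽ(f) = ‖f‖_{2,n} + ∑_{j ≥ 1} min{‖f‖_{2,n}, 𝔻_n Δ(j) ω(j)} 𝓛(j)`, possibly infinite. -/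
def tildeV {Ω : Type*} [MeasurableSpace Ω] (μ : Measure Ω) {e d : ℕ} (n : ℕ)
    (J : ℤ → (ℕ → (Fin e → ℝ)) → (Fin d → ℝ)) (ε : ℤ → Ω → (Fin e → ℝ)) (ν : ℝ) (Δ : ℕ → ℝ)
    (Dn : ℝ) (f : PathFun d) : ℝ≥0∞ :=
  norm2n μ n J ε f + ∑' j : ℕ,
    min (norm2n μ n J ε f) (ENNReal.ofReal (Dn * Δ (j + 1) * omegaWeight ν (j + 1)))
      * ENNReal.ofReal (iterLog (j + 1))

/-- `q̃*(z) = min {q ∈ ℕ, q ≥ 1 : β̃(q) ≤ Φ(q) z}`. -/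
def tildeQStar (ν : ℝ) (Δ : ℕ → ℝ) (z : ℝ) : ℕ :=
  sInf {q : ℕ | 1 ≤ q ∧ tildeBeta ν Δ q ≤ ENNReal.ofReal (Phi q * z)}

/-- `c₀ exp(-(1/c₁) x² / (V² + b x))`; the quotient is `0` for `V = ∞`. -/
def bernsteinBound (c₀ c₁ : ℝ) (V : ℝ≥0∞) (b x : ℝ) : ℝ≥0∞ :=
  ENNReal.ofReal
    (c₀ * Real.exp (-(1 / c₁) * (ENNReal.ofReal (x ^ 2) / (V ^ 2 + ENNReal.ofReal (b * x))).toReal))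

theorem one_le_iterLog {q : ℕ} (hq : 1 ≤ q) : 1 ≤ iterLog q := by
  have hq' : (1 : ℝ) ≤ q := by exact_mod_cast hq
  have h1 : Real.exp 1 ≤ Real.log (Real.exp (Real.exp 1) * q) := by
    rw [Real.le_log_iff_exp_le (by positivity)]
    exact le_mul_of_one_le_right (Real.exp_pos _).le hq'
  unfold iterLog
  rw [Real.le_log_iff_exp_le (lt_of_lt_of_le (Real.exp_pos _) h1)]
  exact h1

/-- The minimum in the definition of `q̃*(z)` is attained when `β̃(1)` is finite and `z > 0`. -/
theorem tildeQStar_isLeast {ν : ℝ} {Δ : ℕ → ℝ} (h : tildeBeta ν Δ 1 ≠ ∞) {z : ℝ} (hz : 0 < z) :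
    IsLeast {q : ℕ | 1 ≤ q ∧ tildeBeta ν Δ q ≤ ENNReal.ofReal (Phi q * z)}
      (tildeQStar ν Δ z) := by
  have hne : {q : ℕ | 1 ≤ q ∧ tildeBeta ν Δ q ≤ ENNReal.ofReal (Phi q * z)}.Nonempty := by
    obtain ⟨m, hm⟩ := exists_nat_ge ((tildeBeta ν Δ 1).toReal / z)
    refine ⟨m + 1, Nat.le_add_left 1 m, ?_⟩
    have hanti : tildeBeta ν Δ (m + 1) ≤ tildeBeta ν Δ 1 := by
      have := ENNReal.tsum_comp_le_tsum_of_injective (f := fun j : ℕ => m + j)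
        (fun a b hab => by simpa using hab)
        (fun j : ℕ => ENNReal.ofReal (Δ (1 + j) * omegaWeight ν (1 + j) * iterLog (1 + j)))
      refine le_trans (le_of_eq ?_) this
      unfold tildeBeta
      refine tsum_congr fun j => ?_
      have : m + 1 + j = 1 + (m + j) := by ring
      rw [this]
    refine hanti.trans ?_
    rw [← ENNReal.ofReal_toReal h]
    refine ENNReal.ofReal_le_ofReal ?_
    have h1 : (tildeBeta ν Δ 1).toReal ≤ m * z := (div_le_iff₀ hz).1 hm
    have h2 : ((m + 1 : ℕ) : ℝ) ≤ Phi (m + 1) :=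
      le_mul_of_one_le_right (Nat.cast_nonneg _) (one_le_iterLog (Nat.le_add_left 1 m))
    have h3 : (m : ℝ) ≤ ((m + 1 : ℕ) : ℝ) := by exact_mod_cast Nat.le_succ m
    exact h1.trans (mul_le_mul_of_nonneg_right (h3.trans h2) hz.le)
  exact ⟨Nat.sInf_mem hne, fun q hq => Nat.sInf_le hq⟩

end FunctionalDependence

end

/-!
The innovations are revealed from the future to the past. For `W = f(Z_i, i/n)`, the centred
variable `W - 𝔼 W` is the almost sure limit of the sums over `j ≥ 0` of its projections onto the
innovation at time `i - j` (`projAt`, `tendsto_sum_projAt`). Such a projection is the conditional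
expectation of the change of `W` when this innovation is resampled
(`IsInnovation.condExp_resample`), so that it is bounded by `|D_f(i/n)|` times the conditional
expectation of a variable `couplingBound` which does not involve `f` and has `ν`-th moment norm at
most `Δ j` (`CompatibilityCondition.abs_projAt_le`,
`CompatibilityCondition.eLpNorm_couplingBound_le`). For a fixed distance `j`, the projections form
a sequence of reverse martingale differences in `i`. The sum is split at the distance `q`.

*Short memory, `j < q`.* For each `i` the sum depends on `q` innovations only. Sums over blocks of
length `q` are bounded by `2 M q`, and those over the even blocks are independent, as are those
over the odd ones. Bernstein's inequality applies (`measureReal_shortMemory_le`); the variance is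
bounded by the orthogonality of the projections at a fixed distance and the Cauchy-Schwarz
inequality over the distances, which gives the square of
`∑ j, min (2 ‖f‖_{2,n}) (𝔻_n Δ j) ≤ 2 Ṽ(f)`.

*Long memory, `j ≥ q`.* No almost sure bound of the right size is available. From
`exp (x - x²) ≤ 1 + x + x²`, valid for every real `x`, one obtains an exponential supermartingale
compensated by the quadratic variation and the conditional quadratic variation
(`integral_exp_compensated_le_one`). The event `goodEvent` demands, for every `m`, that the
quadratic variation of the bound on the projections at distance `j = q + m`, taken with the
envelope of the class, is at most the square of a scale proportional to
`M Φ(q) / ((m + 1) log(e (m + 1))^{3/2})`. On it, each distance has an exponential moment at its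
scale, and Jensen's inequality with weights proportional to the scales, which are summable,
combines them without a union bound (`lintegral_exp_abs_sum_sum_projAt_le`). This produces the term
linear in `x`.

*Probability of the exceptional event.* Markov's inequality of order `ν / 2` for the quadratic
variation at each distance, the monotonicity of `Δ`, and the weights `j^{1/ν} log(e j)^{3/2}` in
`β̃(q)` make the union bound over the distances summable (`sum_div_scaleWeight_rpow_le`,
`measure_compl_goodEvent_le`).

None of this needs `q ≤ n`, so that the second part is the first one at `q = q̃^*(z)`, where
`β̃(q) ≤ Φ(q) z`. -/

namespace FunctionalDependence

variable {Ω : Type*} {m0 : MeasurableSpace Ω} {μ : Measure Ω}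

/-! ### Conditional expectations and independence -/

/-- Integrals over a π-system generating `m₁ ⊔ m₂` determine the conditional expectation. -/
theorem ae_eq_condExp_sup_of_setIntegral_inter [IsFiniteMeasure μ] {m₁ m₂ : MeasurableSpace Ω}
    (h₁ : m₁ ≤ m0) (h₂ : m₂ ≤ m0) {f g : Ω → ℝ} (hf : Integrable f μ) (hg : Integrable g μ)
    (hgm : StronglyMeasurable[m₁ ⊔ m₂] g)
    (h : ∀ s t, MeasurableSet[m₁] s → MeasurableSet[m₂] t →
      ∫ ω in s ∩ t, f ω ∂μ = ∫ ω in s ∩ t, g ω ∂μ) :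
    μ[f|m₁ ⊔ m₂] =ᵐ[μ] g := by
  have hle : m₁ ⊔ m₂ ≤ m0 := sup_le h₁ h₂
  refine (ae_eq_condExp_of_forall_setIntegral_eq hle hf (fun s _ _ => hg.integrableOn) ?_
    hgm.aestronglyMeasurable).symm
  intro A hA _
  let C : Set (Set Ω) := {A | ∃ s t, MeasurableSet[m₁] s ∧ MeasurableSet[m₂] t ∧ A = s ∩ t}
  have hgen : m₁ ⊔ m₂ = MeasurableSpace.generateFrom C := by
    apply le_antisymm
    · refine sup_le (fun s hs => ?_) (fun t ht => ?_)
      · exact MeasurableSpace.measurableSet_generateFrom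
          ⟨s, Set.univ, hs, MeasurableSet.univ, (Set.inter_univ s).symm⟩
      · exact MeasurableSpace.measurableSet_generateFrom
          ⟨Set.univ, t, MeasurableSet.univ, ht, (Set.univ_inter t).symm⟩
    · refine MeasurableSpace.generateFrom_le ?_
      rintro _ ⟨s, t, hs, ht, rfl⟩
      exact MeasurableSet.inter (le_sup_left (b := m₂) s hs) (le_sup_right (a := m₁) t ht)
  have hpi : IsPiSystem C := by
    rintro _ ⟨s, t, hs, ht, rfl⟩ _ ⟨s', t', hs', ht', rfl⟩ _
    exact ⟨s ∩ s', t ∩ t', hs.inter hs', ht.inter ht', Set.inter_inter_inter_comm s t s' t'⟩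
  have huniv : ∫ ω, f ω ∂μ = ∫ ω, g ω ∂μ := by
    simpa using h Set.univ Set.univ MeasurableSet.univ MeasurableSet.univ
  refine MeasurableSpace.induction_on_inter (m := m₁ ⊔ m₂)
    (C := fun A _ => ∫ ω in A, g ω ∂μ = ∫ ω in A, f ω ∂μ) hgen hpi (by simp) ?_ ?_ ?_ A hA
  · rintro _ ⟨s, t, hs, ht, rfl⟩
    exact (h s t hs ht).symm
  · intro t ht hc
    have e1 := integral_add_compl (hle t ht) hf
    have e2 := integral_add_compl (hle t ht) hg
    linarith
  · intro F hd hm hF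
    rw [integral_iUnion (fun i => hle _ (hm i)) hd hg.integrableOn,
      integral_iUnion (fun i => hle _ (hm i)) hd hf.integrableOn]
    exact tsum_congr hF

theorem setIntegral_eq_of_indep [IsProbabilityMeasure μ] {m₁ m₂ : MeasurableSpace Ω}
    (h₁ : m₁ ≤ m0) (h₂ : m₂ ≤ m0) (hind : Indep m₁ m₂ μ) {f : Ω → ℝ} (hf : Integrable f μ)
    (hfm : StronglyMeasurable[m₁] f) {t : Set Ω} (ht : MeasurableSet[m₂] t) :
    ∫ ω in t, f ω ∂μ = μ.real t * ∫ ω, f ω ∂μ := by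
  have h := condExp_indep_eq h₁ h₂ hfm hind
  rw [← setIntegral_condExp h₂ hf ht, setIntegral_congr_ae (h₂ t ht) (g := fun _ => ∫ ω, f ω ∂μ)
    (h.mono fun ω hω _ => hω), setIntegral_const, smul_eq_mul]

/-- Let `f` and `m₁` be measurable for `m'`, which is independent of `m₂`, and let `f₀` have the
same integrals as `f` over the sets of `m₁`. Then `m₂` gives no information on `f` beyond `m₁`, and
`f` may be replaced by `f₀`. In the application `f` involves a resampled innovation, `f₀` the
original one. -/
theorem condExp_sup_of_indep_of_setIntegral [IsProbabilityMeasure μ]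
    {m₁ m₂ m' : MeasurableSpace Ω} (h₁ : m₁ ≤ m') (h' : m' ≤ m0) (h₂ : m₂ ≤ m0)
    (hind : Indep m' m₂ μ) {f f₀ : Ω → ℝ} (hf : Integrable f μ) (hf₀ : Integrable f₀ μ)
    (hfm : StronglyMeasurable[m'] f)
    (heq : ∀ s, MeasurableSet[m₁] s → ∫ ω in s, f ω ∂μ = ∫ ω in s, f₀ ω ∂μ) :
    μ[f|m₁ ⊔ m₂] =ᵐ[μ] μ[f₀|m₁] := by
  refine ae_eq_condExp_sup_of_setIntegral_inter (h₁.trans h') h₂ hf integrable_condExp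
    (stronglyMeasurable_condExp.mono le_sup_left) ?_
  intro s t hs ht
  have hs0 : MeasurableSet[m0] s := h' _ (h₁ _ hs)
  have key : ∀ g : Ω → ℝ, Integrable g μ → StronglyMeasurable[m'] g →
      ∫ ω in s ∩ t, g ω ∂μ = μ.real t * ∫ ω in s, g ω ∂μ := by
    intro g hg hgm
    rw [Set.inter_comm, ← setIntegral_indicator hs0,
      setIntegral_eq_of_indep h' h₂ hind (hg.indicator hs0) (hgm.indicator (h₁ _ hs)) ht,
      integral_indicator hs0]
  rw [key f hf hfm, key _ integrable_condExp (stronglyMeasurable_condExp.mono h₁),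
    setIntegral_condExp (h₁.trans h') hf₀ hs, heq s hs]

theorem condExp_sup_of_indep [IsProbabilityMeasure μ] {m₁ m₂ m' : MeasurableSpace Ω}
    (h₁ : m₁ ≤ m') (h' : m' ≤ m0) (h₂ : m₂ ≤ m0) (hind : Indep m' m₂ μ) {f : Ω → ℝ}
    (hf : Integrable f μ) (hfm : StronglyMeasurable[m'] f) :
    μ[f|m₁ ⊔ m₂] =ᵐ[μ] μ[f|m₁] :=
  condExp_sup_of_indep_of_setIntegral h₁ h' h₂ hind hf hf hfm fun _ _ => rfl

theorem indep_sup_of_indep_sup [IsProbabilityMeasure μ] {m₁ m₂ m₃ : MeasurableSpace Ω}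
    (h₁ : m₁ ≤ m0) (h₂ : m₂ ≤ m0) (h₃ : m₃ ≤ m0) (h23 : Indep m₂ m₃ μ)
    (h123 : Indep m₁ (m₂ ⊔ m₃) μ) : Indep (m₁ ⊔ m₂) m₃ μ := by
  rw [Indep_iff]
  intro A t hA ht
  have ht0 := h₃ t ht
  have hE : Integrable (t.indicator fun _ => (1 : ℝ)) μ :=
    (integrable_const _).indicator ht0
  have hc : μ[t.indicator fun _ => (1 : ℝ)|m₁ ⊔ m₂] =ᵐ[μ] fun _ => μ.real t := by
    refine ae_eq_condExp_sup_of_setIntegral_inter h₁ h₂ hE (integrable_const _)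
      stronglyMeasurable_const ?_
    intro s s' hs hs'
    rw [setIntegral_indicator ht0, setIntegral_const, setIntegral_const, smul_eq_mul, smul_eq_mul,
      mul_one, Set.inter_assoc, measureReal_def,
      (Indep_iff _ _ _).1 h123 s (s' ∩ t) hs
        ((le_sup_left (a := m₂) (b := m₃) _ hs').inter (le_sup_right (a := m₂) _ ht)),
      (Indep_iff _ _ _).1 h23 s' t hs' ht, measureReal_def,
      (Indep_iff _ _ _).1 h123 s s' hs (le_sup_left (a := m₂) (b := m₃) _ hs')]
    simp only [ENNReal.toReal_mul, measureReal_def]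
    ring
  have hle : m₁ ⊔ m₂ ≤ m0 := sup_le h₁ h₂
  have h := setIntegral_condExp hle hE hA
  rw [setIntegral_congr_ae (hle A hA) (hc.mono fun ω hω _ => hω), setIntegral_indicator ht0,
    setIntegral_const, setIntegral_const, smul_eq_mul, smul_eq_mul, mul_one] at h
  rw [← ENNReal.toReal_eq_toReal_iff' (measure_ne_top _ _)
    (ENNReal.mul_ne_top (measure_ne_top _ _) (measure_ne_top _ _)), ENNReal.toReal_mul]
  exact h.symm

/-! ### Exponential inequalities -/

/-- The left-hand side is bounded in `x`, and the bound holds for all real `x`: this is what allows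
exponential moments of unbounded martingale differences. -/
theorem exp_sub_sq_le (x : ℝ) : Real.exp (x - x ^ 2) ≤ 1 + x + x ^ 2 := by
  have h1 : 1 - x + x ^ 2 ≤ Real.exp (-(x - x ^ 2)) := by
    have := Real.add_one_le_exp (-(x - x ^ 2)); linarith
  have h2 : 0 < 1 - x + x ^ 2 := by nlinarith [sq_nonneg (x - 1 / 2)]
  rw [Real.exp_neg] at h1
  have h3 : Real.exp (x - x ^ 2) ≤ (1 - x + x ^ 2)⁻¹ :=
    (le_inv_comm₀ h2 (Real.exp_pos _)).1 h1
  refine h3.trans ?_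
  rw [inv_le_iff_one_le_mul₀ h2]
  nlinarith [sq_nonneg x, sq_nonneg (x ^ 2)]

/-- The exponential supermartingale of a martingale difference sequence `y`, compensated by its
quadratic variation and its conditional quadratic variation. The compensator makes the
conditional moment generating function bounded without any bound on the size of `y`. -/
theorem integral_exp_compensated_le_one [IsProbabilityMeasure μ] {𝒢 : ℕ → MeasurableSpace Ω}
    (hmono : Monotone 𝒢) (hle : ∀ r, 𝒢 r ≤ m0) {y : ℕ → Ω → ℝ} {C : ℝ} (n : ℕ)
    (hy : ∀ r < n, StronglyMeasurable[𝒢 (r + 1)] (y r))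
    (hb : ∀ r < n, ∀ᵐ ω ∂μ, |y r ω| ≤ C) (hmean : ∀ r < n, μ[y r|𝒢 r] =ᵐ[μ] 0) :
    Integrable (fun ω => Real.exp (∑ r ∈ Finset.range n,
      (y r ω - y r ω ^ 2 - (μ[fun ω => y r ω ^ 2|𝒢 r]) ω))) μ ∧
    ∫ ω, Real.exp (∑ r ∈ Finset.range n,
      (y r ω - y r ω ^ 2 - (μ[fun ω => y r ω ^ 2|𝒢 r]) ω)) ∂μ ≤ 1 := by
  have hv0 : ∀ r, 0 ≤ᵐ[μ] μ[fun ω => y r ω ^ 2|𝒢 r] := fun r =>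
    condExp_nonneg (Filter.Eventually.of_forall fun ω => sq_nonneg _)
  have hmeas : ∀ k ≤ n, StronglyMeasurable[𝒢 k] (fun ω => Real.exp (∑ r ∈ Finset.range k,
      (y r ω - y r ω ^ 2 - (μ[fun ω => y r ω ^ 2|𝒢 r]) ω))) := by
    intro k hk
    refine Real.continuous_exp.comp_stronglyMeasurable ?_
    refine Finset.stronglyMeasurable_fun_sum _ fun r hr => ?_
    have hr' := Finset.mem_range.1 hr
    have h1 : StronglyMeasurable[𝒢 k] (y r) := (hy r (by omega)).mono (hmono (by omega))
    exact (h1.sub (h1.pow 2)).sub (stronglyMeasurable_condExp.mono (hmono (by omega)))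
  have hbdd : ∀ k, ∀ᵐ ω ∂μ, Real.exp (∑ r ∈ Finset.range k,
      (y r ω - y r ω ^ 2 - (μ[fun ω => y r ω ^ 2|𝒢 r]) ω)) ≤ Real.exp (k * (1 / 4)) := by
    intro k
    filter_upwards [ae_all_iff.2 hv0] with ω hω
    refine Real.exp_le_exp.2 ?_
    have : ∀ r ∈ Finset.range k,
        y r ω - y r ω ^ 2 - (μ[fun ω => y r ω ^ 2|𝒢 r]) ω ≤ 1 / 4 := by
      intro r _
      have : (0 : ℝ) ≤ (μ[fun ω => y r ω ^ 2|𝒢 r]) ω := hω r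
      nlinarith [sq_nonneg (y r ω - 1 / 2)]
    simpa using Finset.sum_le_card_nsmul _ _ _ this
  have hint : ∀ k ≤ n, Integrable (fun ω => Real.exp (∑ r ∈ Finset.range k,
      (y r ω - y r ω ^ 2 - (μ[fun ω => y r ω ^ 2|𝒢 r]) ω))) μ := by
    intro k hk
    refine Integrable.of_bound ((hmeas k hk).mono (hle k)).aestronglyMeasurable
      (Real.exp (k * (1 / 4))) ?_
    filter_upwards [hbdd k] with ω hω
    rwa [Real.norm_eq_abs, abs_of_pos (Real.exp_pos _)]
  refine ⟨hint n le_rfl, ?_⟩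
  suffices H : ∀ k ≤ n, ∫ ω, Real.exp (∑ r ∈ Finset.range k,
      (y r ω - y r ω ^ 2 - (μ[fun ω => y r ω ^ 2|𝒢 r]) ω)) ∂μ ≤ 1 from H n le_rfl
  intro k
  induction k with
  | zero => intro _; simp
  | succ k ih =>
    intro hk
    have hkn : k < n := by omega
    set U : Ω → ℝ := fun ω => Real.exp (∑ r ∈ Finset.range k,
      (y r ω - y r ω ^ 2 - (μ[fun ω => y r ω ^ 2|𝒢 r]) ω)) with hU
    set v : Ω → ℝ := μ[fun ω => y k ω ^ 2|𝒢 k] with hv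
    set g : Ω → ℝ := fun ω => U ω * Real.exp (-v ω) with hg
    have hgm : StronglyMeasurable[𝒢 k] g :=
      (hmeas k hkn.le).mul (Real.continuous_exp.comp_stronglyMeasurable
        stronglyMeasurable_condExp.neg)
    have hgb : ∀ᵐ ω ∂μ, ‖g ω‖ ≤ Real.exp (k * (1 / 4)) := by
      filter_upwards [hbdd k, hv0 k] with ω hω hvω
      rw [Real.norm_eq_abs, abs_of_pos (by positivity)]
      refine (mul_le_of_le_one_right (Real.exp_pos _).le ?_).trans hω
      rw [Real.exp_le_one_iff]
      simpa using hvω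
    have hym : AEStronglyMeasurable (y k) μ :=
      ((hy k hkn).mono (hle _)).aestronglyMeasurable
    have hyi : Integrable (y k) μ := Integrable.of_bound hym C (hb k hkn)
    have hy2i : Integrable (fun ω => y k ω ^ 2) μ := by
      refine Integrable.of_bound (hym.pow 2) (C ^ 2) ?_
      filter_upwards [hb k hkn] with ω hω
      rw [Real.norm_eq_abs, abs_of_nonneg (sq_nonneg _), ← sq_abs]
      exact pow_le_pow_left₀ (abs_nonneg _) hω 2
    have hgi : Integrable g μ :=
      Integrable.of_bound (hgm.mono (hle k)).aestronglyMeasurable _ hgb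
    have hgy : Integrable (fun ω => g ω * y k ω) μ :=
      hyi.bdd_mul (hgm.mono (hle k)).aestronglyMeasurable hgb
    have hgy2 : Integrable (fun ω => g ω * y k ω ^ 2) μ :=
      hy2i.bdd_mul (hgm.mono (hle k)).aestronglyMeasurable hgb
    have e1 : ∫ ω, g ω * y k ω ∂μ = 0 := by
      have h := (condExp_mul_of_stronglyMeasurable_left hgm hgy hyi).trans
        ((hmean k hkn).mono fun ω hω => show g ω * (μ[y k|𝒢 k]) ω = (0 : Ω → ℝ) ω by simp [hω])
      calc ∫ ω, g ω * y k ω ∂μ = ∫ ω, (μ[g * y k|𝒢 k]) ω ∂μ := (integral_condExp (hle k)).symm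
        _ = 0 := by rw [integral_congr_ae h]; simp
    have e2 : ∫ ω, g ω * y k ω ^ 2 ∂μ = ∫ ω, g ω * v ω ∂μ := by
      rw [← integral_condExp (hle k)]
      exact integral_congr_ae (condExp_mul_of_stronglyMeasurable_left hgm hgy2 hy2i)
    have hgv : Integrable (fun ω => g ω * v ω) μ :=
      integrable_condExp.bdd_mul (hgm.mono (hle k)).aestronglyMeasurable hgb
    refine le_trans ?_ (ih hkn.le)
    calc ∫ ω, Real.exp (∑ r ∈ Finset.range (k + 1),
          (y r ω - y r ω ^ 2 - (μ[fun ω => y r ω ^ 2|𝒢 r]) ω)) ∂μ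
        ≤ ∫ ω, (g ω + g ω * y k ω + g ω * y k ω ^ 2) ∂μ := by
          refine integral_mono (hint _ hk) ((hgi.add hgy).add hgy2) fun ω => ?_
          have : Real.exp (∑ r ∈ Finset.range (k + 1),
              (y r ω - y r ω ^ 2 - (μ[fun ω => y r ω ^ 2|𝒢 r]) ω))
              = g ω * Real.exp (y k ω - y k ω ^ 2) := by
            simp only [hg, hU]
            rw [Finset.sum_range_succ, ← Real.exp_add, ← Real.exp_add]
            congr 1
            ring
          simp only [this]
          have h1 := exp_sub_sq_le (y k ω)
          have h2 : 0 ≤ g ω := by positivity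
          nlinarith
      _ = ∫ ω, (g ω + g ω * v ω) ∂μ := by
          have h1 := integral_add (hgi.add hgy) hgy2
          simp only [Pi.add_apply] at h1
          rw [h1, integral_add hgi hgy, integral_add hgi hgv, e1, e2, add_zero]
      _ ≤ ∫ ω, U ω ∂μ := by
          refine integral_mono (hgi.add hgv) (hint k hkn.le) fun ω => ?_
          have h1 := Real.add_one_le_exp (v ω)
          have h2 : 0 < U ω := Real.exp_pos _
          have h3 : U ω = g ω * Real.exp (v ω) := by
            simp only [hg]
            rw [mul_assoc, ← Real.exp_add, neg_add_cancel, Real.exp_zero, mul_one]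
          change g ω + g ω * v ω ≤ U ω
          have h4 : 0 ≤ g ω := by positivity
          rw [h3]
          nlinarith

/-- The moment generating function of a bounded centred variable, in the range of `t` which leads
to Bernstein's inequality. -/
theorem integral_exp_mul_le_of_abs_le [IsProbabilityMeasure μ] {S : Ω → ℝ} {c t : ℝ}
    (hS : AEStronglyMeasurable S μ) (hb : ∀ᵐ ω ∂μ, |S ω| ≤ c) (h0 : ∫ ω, S ω ∂μ = 0)
    (ht : |t| * c ≤ 1) :
    ∫ ω, Real.exp (t * S ω) ∂μ ≤ Real.exp (t ^ 2 * ∫ ω, S ω ^ 2 ∂μ) := by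
  have hSi : Integrable S μ := Integrable.of_bound hS c hb
  have hS2 : Integrable (fun ω => S ω ^ 2) μ := by
    refine Integrable.of_bound (hS.pow 2) (c ^ 2) ?_
    filter_upwards [hb] with ω hω
    rw [Real.norm_eq_abs, abs_of_nonneg (sq_nonneg _), ← sq_abs]
    exact pow_le_pow_left₀ (abs_nonneg _) hω 2
  have hb' : ∀ᵐ ω ∂μ, |t * S ω| ≤ 1 := by
    filter_upwards [hb] with ω hω
    rw [abs_mul]
    exact (mul_le_mul_of_nonneg_left hω (abs_nonneg _)).trans ht
  have hei : Integrable (fun ω => Real.exp (t * S ω)) μ := by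
    refine Integrable.of_bound
      (Real.continuous_exp.comp_aestronglyMeasurable (hS.const_mul t)) (Real.exp 1) ?_
    filter_upwards [hb'] with ω hω
    rw [Real.norm_eq_abs, abs_of_pos (Real.exp_pos _), Real.exp_le_exp]
    exact (le_abs_self _).trans hω
  have hp : Integrable (fun ω => 1 + t * S ω) μ := (integrable_const _).add (hSi.const_mul t)
  calc ∫ ω, Real.exp (t * S ω) ∂μ ≤ ∫ ω, (1 + t * S ω + t ^ 2 * S ω ^ 2) ∂μ := by
        refine integral_mono_ae hei (hp.add (hS2.const_mul _)) ?_
        filter_upwards [hb'] with ω hω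
        have := (abs_le.1 (Real.abs_exp_sub_one_sub_id_le hω)).2
        nlinarith
    _ = 1 + t ^ 2 * ∫ ω, S ω ^ 2 ∂μ := by
        rw [integral_add hp (hS2.const_mul _), integral_add (integrable_const _) (hSi.const_mul t),
          integral_const_mul, integral_const_mul, h0]
        simp
    _ ≤ _ := by
        have := Real.add_one_le_exp (t ^ 2 * ∫ ω, S ω ^ 2 ∂μ); linarith

/-- Jensen's inequality for `exp` with weights of total mass at most one; the missing mass is put
at the point `0`. -/
theorem exp_sum_mul_le {ι : Type*} (s : Finset ι) {p y : ι → ℝ} (hp : ∀ i ∈ s, 0 ≤ p i)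
    (hp1 : ∑ i ∈ s, p i ≤ 1) :
    Real.exp (∑ i ∈ s, p i * y i) ≤ 1 + ∑ i ∈ s, p i * Real.exp (y i) := by
  have h := convexOn_exp.map_add_sum_le (t := s) (v := 1 - ∑ i ∈ s, p i) (q := 0) (w := p) (p := y)
    hp (by ring) (by simp) (by linarith) (Set.mem_univ _)
  simp only [smul_eq_mul, mul_zero, zero_add, Real.exp_zero, mul_one] at h
  have h2 : 0 ≤ ∑ i ∈ s, p i := Finset.sum_nonneg hp
  linarith

end FunctionalDependence

namespace FunctionalDependence

/-! ### The σ-algebras generated by the innovations -/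

variable {Ω : Type*} {m0 : MeasurableSpace Ω} {μ : Measure Ω} {e d : ℕ}
  {ε ε' : ℤ → Ω → (Fin e → ℝ)}

/-- `σ(ε_m : m ∈ S)`. -/
@[reducible] def sigmaOn (ε : ℤ → Ω → (Fin e → ℝ)) (S : Set ℤ) : MeasurableSpace Ω :=
  ⨆ m ∈ S, MeasurableSpace.comap (ε m) inferInstance

theorem sigmaOn_le (h : ∀ i, Measurable (ε i)) (S : Set ℤ) : sigmaOn ε S ≤ m0 :=
  iSup₂_le fun i _ => (h i).comap_le

theorem sigmaOn_mono {S T : Set ℤ} (h : S ⊆ T) : sigmaOn ε S ≤ sigmaOn ε T :=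
  biSup_mono h

theorem measurable_sigmaOn {S : Set ℤ} {i : ℤ} (hi : i ∈ S) : Measurable[sigmaOn ε S] (ε i) :=
  measurable_iff_comap_le.2 (le_iSup₂_of_le i hi le_rfl)

theorem sigmaOn_union (S T : Set ℤ) : sigmaOn ε (S ∪ T) = sigmaOn ε S ⊔ sigmaOn ε T :=
  iSup_union

theorem indep_sigmaOn (hm : ∀ i, Measurable (ε i)) (h : iIndepFun ε μ) {S T : Set ℤ}
    (hST : Disjoint S T) : Indep (sigmaOn ε S) (sigmaOn ε T) μ :=
  indep_iSup_of_disjoint (fun i => (hm i).comap_le) h hST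

/-- For a function of the innovations up to time `i`, conditioning on all innovations from time
`k` on is the same as conditioning on those between `k` and `i`. -/
theorem condExp_sigmaOn_Ici [IsProbabilityMeasure μ] (hm : ∀ i, Measurable (ε i))
    (h : iIndepFun ε μ) {W : Ω → ℝ} {i k : ℤ} (hki : k ≤ i + 1) (hW : Integrable W μ)
    (hWm : StronglyMeasurable[sigmaOn ε (Set.Iic i)] W) :
    μ[W|sigmaOn ε (Set.Ici k)] =ᵐ[μ] μ[W|sigmaOn ε (Set.Icc k i)] := by
  have hS : Set.Ici k = Set.Icc k i ∪ Set.Ioi i := by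
    ext x; simp only [Set.mem_Ici, Set.mem_union, Set.mem_Icc, Set.mem_Ioi]; omega
  rw [hS, sigmaOn_union]
  refine condExp_sup_of_indep (sigmaOn_mono Set.Icc_subset_Iic_self) (sigmaOn_le hm _)
    (sigmaOn_le hm _) (indep_sigmaOn hm h ?_) hW hWm
  exact Set.disjoint_left.2 fun x hx hx' => not_lt.2 (Set.mem_Iic.1 hx) (Set.mem_Ioi.1 hx')

/-! ### Resampling one innovation -/

/-- The innovation sequence with `ε_k` replaced by the copy `ε'_k`. -/
def resample (ε ε' : ℤ → Ω → (Fin e → ℝ)) (k : ℤ) (ω : Ω) : ℤ → (Fin e → ℝ) :=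
  Function.update (fun t => ε t ω) k (ε' k ω)

/-- The innovation sequence without its `k`-th entry, which is set to `0`. -/
def deleteAt (ε : ℤ → Ω → (Fin e → ℝ)) (k : ℤ) (ω : Ω) : ℤ → (Fin e → ℝ) :=
  Function.update (fun t => ε t ω) k 0

/-- Inserting a `k`-th entry into a sequence. -/
def insertAt (k : ℤ) (p : (Fin e → ℝ) × (ℤ → (Fin e → ℝ))) : ℤ → (Fin e → ℝ) :=
  Function.update p.2 k p.1

theorem measurable_insertAt (k : ℤ) : Measurable (insertAt (e := e) k) := by
  refine measurable_pi_iff.2 fun t => ?_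
  by_cases h : t = k
  · subst h; simpa [insertAt] using measurable_fst
  · simp only [insertAt, Function.update_of_ne h]
    exact (measurable_pi_apply t).comp measurable_snd

theorem insertAt_deleteAt_copy (k : ℤ) (ω : Ω) :
    insertAt k (ε' k ω, deleteAt ε k ω) = resample ε ε' k ω := by
  simp [insertAt, deleteAt, resample]

theorem insertAt_deleteAt_self (k : ℤ) (ω : Ω) :
    insertAt k (ε k ω, deleteAt ε k ω) = fun t => ε t ω := by
  simp [insertAt, deleteAt]

theorem measurable_deleteAt_sigmaOn (k : ℤ) :
    Measurable[sigmaOn ε {k}ᶜ] (deleteAt ε k) := by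
  refine @measurable_pi_iff _ _ _ (sigmaOn ε {k}ᶜ) _ _ |>.2 fun t => ?_
  by_cases h : t = k
  · subst h
    simp only [deleteAt, Function.update_self]
    exact @measurable_const _ _ _ (sigmaOn ε {t}ᶜ) _
  · simp only [deleteAt, Function.update_of_ne h]
    exact measurable_sigmaOn (ε := ε) (S := {k}ᶜ) (i := t) h

theorem sigmaOn_compl_le_comap_deleteAt (k : ℤ) :
    sigmaOn ε {k}ᶜ ≤ MeasurableSpace.comap (deleteAt ε k) inferInstance := by
  refine iSup₂_le fun t ht => ?_
  have h : ε t = (fun x : ℤ → (Fin e → ℝ) => x t) ∘ deleteAt ε k := by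
    funext ω; simp [deleteAt, Function.update_of_ne (show t ≠ k from ht)]
  rw [h, ← MeasurableSpace.comap_comp]
  exact MeasurableSpace.comap_mono (measurable_pi_apply t).comap_le

namespace IsInnovation

theorem measurable_deleteAt (hε : IsInnovation μ ε ε') (k : ℤ) : Measurable (deleteAt ε k) :=
  (measurable_deleteAt_sigmaOn k).mono (sigmaOn_le hε.measurable _) le_rfl

theorem measurable_resample (hε : IsInnovation μ ε ε') (k : ℤ) :
    Measurable (resample ε ε' k) := by
  have : resample ε ε' k = insertAt k ∘ fun ω => (ε' k ω, deleteAt ε k ω) :=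
    funext fun ω => (insertAt_deleteAt_copy k ω).symm
  rw [this]
  exact (measurable_insertAt k).comp
    ((hε.measurable_copy k).prodMk (hε.measurable_deleteAt k))

theorem identDistrib_pair [IsProbabilityMeasure μ] (hε : IsInnovation μ ε ε') (k : ℤ) :
    IdentDistrib (fun ω => (ε' k ω, deleteAt ε k ω)) (fun ω => (ε k ω, deleteAt ε k ω)) μ μ := by
  refine (hε.copy_identDistrib k).prodMk
    (IdentDistrib.refl (hε.measurable_deleteAt k).aemeasurable) ?_ ?_
  · have hm : Measurable fun x : ℤ → (Fin e → ℝ) => Function.update x k 0 := by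
      have := (measurable_insertAt (e := e) k).comp
        ((measurable_const (a := (0 : Fin e → ℝ))).prodMk (measurable_id (α := ℤ → (Fin e → ℝ))))
      simpa [insertAt, Function.comp_def] using this
    exact (hε.copy_indep k).comp measurable_id hm
  · rw [IndepFun_iff_Indep]
    refine indep_of_indep_of_le_left (indep_of_indep_of_le_right
      (indep_sigmaOn hε.measurable hε.indep (S := {k}) (T := {k}ᶜ) disjoint_compl_right)
      (measurable_deleteAt_sigmaOn k).comap_le) ?_
    exact (measurable_sigmaOn (ε := ε) (S := {k}) rfl).comap_le

theorem identDistrib_resample [IsProbabilityMeasure μ] (hε : IsInnovation μ ε ε') (k : ℤ) :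
    IdentDistrib (resample ε ε' k) (fun ω t => ε t ω) μ μ := by
  have h := (hε.identDistrib_pair k).comp (measurable_insertAt k)
  convert h using 1 <;> funext ω
  · exact (insertAt_deleteAt_copy k ω).symm
  · exact (insertAt_deleteAt_self k ω).symm

/-- Resampling `ε_k` and conditioning on the innovations from time `k` on is averaging over the
innovations up to time `k`: the original `ε_k` carries no information on the resampled
functional. -/
theorem condExp_resample [IsProbabilityMeasure μ] (hε : IsInnovation μ ε ε') (k : ℤ)
    {φ : (ℤ → (Fin e → ℝ)) → ℝ} (hφ : Measurable φ) (hi : Integrable (fun ω => φ (ε · ω)) μ) :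
    μ[fun ω => φ (resample ε ε' k ω)|sigmaOn ε (Set.Ici k)]
      =ᵐ[μ] μ[fun ω => φ (ε · ω)|sigmaOn ε (Set.Ioi k)] := by
  have hS : Set.Ici k = Set.Ioi k ∪ {k} := by
    ext x; simp only [Set.mem_Ici, Set.mem_union, Set.mem_Ioi, Set.mem_singleton_iff]; omega
  rw [hS, sigmaOn_union]
  have hsub : Set.Ioi k ⊆ {k}ᶜ := fun x hx => (Set.mem_Ioi.1 hx).ne'
  have hc : MeasurableSpace.comap (ε' k) inferInstance ≤ m0 := (hε.measurable_copy k).comap_le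
  refine condExp_sup_of_indep_of_setIntegral
    (m' := MeasurableSpace.comap (ε' k) inferInstance ⊔ sigmaOn ε {k}ᶜ)
    ((sigmaOn_mono hsub).trans le_sup_right) (sup_le hc (sigmaOn_le hε.measurable _))
    (sigmaOn_le hε.measurable _) ?_ ?_ hi ?_ ?_
  · refine indep_sup_of_indep_sup hc (sigmaOn_le hε.measurable _) (sigmaOn_le hε.measurable _)
      (indep_sigmaOn hε.measurable hε.indep disjoint_compl_left) ?_
    refine indep_of_indep_of_le_right ((IndepFun_iff_Indep _ _ _).1 (hε.copy_indep k)) ?_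
    rw [← sigmaOn_union]
    refine iSup₂_le fun t _ => ?_
    have h : ε t = (fun x : ℤ → (Fin e → ℝ) => x t) ∘ fun ω i => ε i ω := rfl
    conv_lhs => rw [h, ← MeasurableSpace.comap_comp]
    exact MeasurableSpace.comap_mono (measurable_pi_apply t).comap_le
  · exact ((hε.identDistrib_resample k).comp hφ).integrable_iff.2 hi
  · suffices h : Measurable[MeasurableSpace.comap (ε' k) inferInstance ⊔ sigmaOn ε {k}ᶜ]
        (fun ω => φ (resample ε ε' k ω)) from h.stronglyMeasurable
    have : (fun ω => φ (resample ε ε' k ω))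
        = (φ ∘ insertAt k) ∘ fun ω => (ε' k ω, deleteAt ε k ω) :=
      funext fun ω => by simp only [Function.comp_apply, insertAt_deleteAt_copy]
    rw [this]
    refine (hφ.comp (measurable_insertAt k)).comp (Measurable.prodMk ?_ ?_)
    · exact measurable_iff_comap_le.2 le_sup_left
    · exact (measurable_deleteAt_sigmaOn k).mono le_sup_right le_rfl
  · intro s hs
    have hs0 := sigmaOn_le hε.measurable _ _ hs
    obtain ⟨C, hC, rfl⟩ := sigmaOn_compl_le_comap_deleteAt k s (sigmaOn_mono hsub s hs)
    have hψ : Measurable fun p : (Fin e → ℝ) × (ℤ → (Fin e → ℝ)) =>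
        (Prod.snd ⁻¹' C).indicator (fun p => φ (insertAt k p)) p :=
      (hφ.comp (measurable_insertAt k)).indicator (measurable_snd hC)
    have h := ((hε.identDistrib_pair k).comp hψ).integral_eq
    rw [← integral_indicator hs0, ← integral_indicator hs0]
    convert h using 2 <;> funext ω
    · by_cases hω : deleteAt ε k ω ∈ C <;>
        simp [Set.indicator, hω, insertAt_deleteAt_copy]
    · by_cases hω : deleteAt ε k ω ∈ C <;>
        simp [Set.indicator, hω, insertAt_deleteAt_self]

end IsInnovation

/-! ### Functionals of the past -/

/-- The path `(X_i, X_{i-1}, …)` as a function of the innovation sequence. -/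
def pathFrom (J : ℤ → (ℕ → (Fin e → ℝ)) → (Fin d → ℝ)) (i : ℤ) (x : ℤ → (Fin e → ℝ)) :
    ℕ → (Fin d → ℝ) :=
  fun l => J (i - l) (fun m : ℕ => x (i - l - m))

variable {J : ℤ → (ℕ → (Fin e → ℝ)) → (Fin d → ℝ)}

theorem measurable_pathFrom (hJ : ∀ i, Measurable (J i)) (i : ℤ) : Measurable (pathFrom J i) :=
  measurable_pi_iff.2 fun _ => (hJ _).comp (measurable_pi_iff.2 fun _ => measurable_pi_apply _)

theorem measurable_past_sigmaOn (hJ : ∀ i, Measurable (J i)) (i : ℤ) :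
    Measurable[sigmaOn ε (Set.Iic i)] (past (shiftSeq J ε) i) := by
  refine @measurable_pi_iff _ _ _ (sigmaOn ε (Set.Iic i)) _ _ |>.2 fun _ => (hJ _).comp ?_
  refine @measurable_pi_iff _ _ _ (sigmaOn ε (Set.Iic i)) _ _ |>.2 fun m => ?_
  exact measurable_sigmaOn (by simp only [Set.mem_Iic]; omega)

/-- After resampling at time `i - j`, the path has the coupled values at the times
`i, …, i - j` and is unchanged before. -/
theorem pathFrom_resample (i : ℤ) (j l : ℕ) (ω : Ω) :
    pathFrom J i (resample ε ε' (i - j) ω) l =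
      if l ≤ j then coupledShift J ε ε' (i - l) (j - l) ω else shiftSeq J ε (i - l) ω := by
  unfold pathFrom coupledShift shiftSeq resample
  split_ifs with h
  · congr 1
    funext m
    by_cases hm : m = j - l
    · have h2 : i - (l : ℤ) - m = i - j := by omega
      rw [if_pos hm, h2, Function.update_self]
    · rw [if_neg hm, Function.update_of_ne (by omega)]
  · congr 1
    funext m
    rw [Function.update_of_ne (by omega)]

end FunctionalDependence

namespace FunctionalDependence

/-! ### The coupling bound for the projections -/

variable {Ω : Type*} {m0 : MeasurableSpace Ω} {μ : Measure Ω} {e d : ℕ}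
  {ε ε' : ℤ → Ω → (Fin e → ℝ)}

/-- The projection of `W` onto the innovation at time `k`, when the innovations are revealed
from the future to the past. -/
noncomputable def projAt (μ : Measure Ω) (ε : ℤ → Ω → (Fin e → ℝ)) (W : Ω → ℝ) (k : ℤ)
    (ω : Ω) : ℝ :=
  (μ[W|sigmaOn ε (Set.Ici k)]) ω - (μ[W|sigmaOn ε (Set.Ioi k)]) ω

/-- The bound `∑_{l ≤ j} L_l |X_{i-l} - X_{i-l}^{*(i-j)}|_∞^s (R(Z_i, u) + R(Z_i^{*(i-j)}, u))` on
the effect of resampling `ε_{i-j}`. It does not involve the function `f`. -/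
noncomputable def couplingBound (J : ℤ → (ℕ → (Fin e → ℝ)) → (Fin d → ℝ))
    (ε ε' : ℤ → Ω → (Fin e → ℝ)) (L : ℕ → ℝ) (s : ℝ) (R : PathFun d) (i : ℤ) (j : ℕ)
    (u : unitInterval) (ω : Ω) : ℝ :=
  (∑ l ∈ Finset.range (j + 1),
      L l * ‖shiftSeq J ε (i - l) ω - coupledShift J ε ε' (i - l) (j - l) ω‖ ^ s) *
    (R (past (shiftSeq J ε) i ω) u + R (pathFrom J i (resample ε ε' (i - j) ω)) u)

variable {J : ℤ → (ℕ → (Fin e → ℝ)) → (Fin d → ℝ)} {L : ℕ → ℝ} {s : ℝ} {R : PathFun d}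
  {CR Cf : ℝ}

/-- Only finitely many coordinates differ after resampling, so that the smoothness condition is
never void for the pair of paths to which it is applied. -/
theorem weightedNorm_rpow_of_support {z : ℕ → (Fin d → ℝ)} (hL : ∀ l, 0 ≤ L l) (hs : 0 < s)
    {j : ℕ} (hz : ∀ l, j < l → z l = 0) :
    weightedNorm L s z ≠ ∞ ∧
      (weightedNorm L s z).toReal ^ s = ∑ l ∈ Finset.range (j + 1), L l * ‖z l‖ ^ s := by
  have h0 : ∀ l, ENNReal.ofReal (L l) * ‖z l‖ₑ ^ s = ENNReal.ofReal (L l * ‖z l‖ ^ s) := by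
    intro l
    rw [ENNReal.ofReal_mul (hL l), ← ENNReal.ofReal_rpow_of_nonneg (norm_nonneg _) hs.le,
      ofReal_norm]
  have hnn : 0 ≤ ∑ l ∈ Finset.range (j + 1), L l * ‖z l‖ ^ s :=
    Finset.sum_nonneg fun l _ => mul_nonneg (hL l) (by positivity)
  have h1 : ∑' l, ENNReal.ofReal (L l) * ‖z l‖ₑ ^ s
      = ENNReal.ofReal (∑ l ∈ Finset.range (j + 1), L l * ‖z l‖ ^ s) := by
    rw [ENNReal.ofReal_sum_of_nonneg fun l _ => mul_nonneg (hL l) (by positivity),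
      tsum_eq_sum (s := Finset.range (j + 1))]
    · exact Finset.sum_congr rfl fun l _ => h0 l
    · intro l hl
      rw [hz l (by simpa using hl), enorm_zero, ENNReal.zero_rpow_of_pos hs, mul_zero]
  unfold weightedNorm
  rw [h1]
  refine ⟨ENNReal.rpow_ne_top_of_nonneg (by positivity) ENNReal.ofReal_ne_top, ?_⟩
  rw [ENNReal.toReal_rpow, ← ENNReal.rpow_mul, one_div, inv_mul_cancel₀ hs.ne', ENNReal.rpow_one,
    ENNReal.toReal_ofReal hnn]

/-- The smoothness condition, applied to the path and its resampled version. -/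
theorem abs_sub_resample_le {Fbar : Set (PathFun d)} (h : IsSmoothClass Fbar L s R CR Cf)
    {g : PathFun d} (hg : g ∈ Fbar) (i : ℤ) (j : ℕ) (u : unitInterval) (ω : Ω) :
    |g (past (shiftSeq J ε) i ω) u - g (pathFrom J i (resample ε ε' (i - j) ω)) u|
      ≤ couplingBound J ε ε' L s R i j u ω := by
  have hz : ∀ l : ℕ, (past (shiftSeq J ε) i ω - pathFrom J i (resample ε ε' (i - j) ω)) l
      = if l ≤ j then shiftSeq J ε (i - l) ω - coupledShift J ε ε' (i - l) (j - l) ω else 0 := by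
    intro l
    rw [Pi.sub_apply, pathFrom_resample]
    split_ifs
    · rfl
    · exact sub_self _
  obtain ⟨h1, h2⟩ := weightedNorm_rpow_of_support h.L_nonneg h.s_pos
    (z := past (shiftSeq J ε) i ω - pathFrom J i (resample ε ε' (i - j) ω)) (j := j)
    (fun l hl => by rw [hz l, if_neg (by omega)])
  have h3 := h.smooth g hg u _ _ h1
  rw [h2] at h3
  refine h3.trans (le_of_eq ?_)
  unfold couplingBound
  congr 1
  refine Finset.sum_congr rfl fun l hl => ?_
  rw [hz l, if_pos (by simpa [Nat.lt_succ_iff] using hl)]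

theorem measurable_shiftSeq (hJ : ∀ i, Measurable (J i)) (hm : ∀ i, Measurable (ε i)) (i : ℤ) :
    Measurable (shiftSeq J ε i) :=
  (hJ i).comp (measurable_pi_iff.2 fun _ => hm _)

theorem measurable_coupledShift (hJ : ∀ i, Measurable (J i)) (hm : ∀ i, Measurable (ε i))
    (hm' : ∀ i, Measurable (ε' i)) (i : ℤ) (k : ℕ) : Measurable (coupledShift J ε ε' i k) := by
  refine (hJ i).comp (measurable_pi_iff.2 fun m => ?_)
  by_cases h : m = k
  · simpa [h] using hm' _
  · simpa [h] using hm _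

theorem measurable_couplingBound (hε : IsInnovation μ ε ε') (hJ : ∀ i, Measurable (J i))
    (hR : ∀ u, Measurable fun z => R z u) (i : ℤ) (j : ℕ) (u : unitInterval) :
    Measurable (couplingBound J ε ε' L s R i j u) := by
  refine Measurable.mul (Finset.measurable_fun_sum _ fun l _ => ?_) (Measurable.add ?_ ?_)
  · exact measurable_const.mul ((((measurable_shiftSeq hJ hε.measurable _).sub
      (measurable_coupledShift hJ hε.measurable hε.measurable_copy _ _)).norm).pow_const s)
  · exact (hR u).comp ((measurable_past_sigmaOn hJ i).mono (sigmaOn_le hε.measurable _) le_rfl)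
  · exact (hR u).comp ((measurable_pathFrom hJ i).comp (hε.measurable_resample _))

theorem couplingBound_nonneg (hL : ∀ l, 0 ≤ L l) (hR : ∀ z u, 0 ≤ R z u) (i : ℤ) (j : ℕ)
    (u : unitInterval) (ω : Ω) : 0 ≤ couplingBound J ε ε' L s R i j u ω :=
  mul_nonneg (Finset.sum_nonneg fun l _ => mul_nonneg (hL l) (by positivity))
    (add_nonneg (hR _ _) (hR _ _))

/-- The factor `d` comes from bounding the maximum over the coordinates by their sum. -/
theorem eLpNorm_norm_rpow_le_of_coord {V : Ω → Fin d → ℝ} (hV : Measurable V) {q δ : ℝ≥0∞}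
    (hq : 1 ≤ q) (hs : 0 < s) (h : ∀ a, eLpNorm (fun ω => V ω a) (q * ENNReal.ofReal s) μ ≤ δ) :
    eLpNorm (fun ω => ‖V ω‖ ^ s) q μ ≤ d * δ ^ s := by
  have hm : ∀ a, Measurable fun ω => V ω a := fun a => (measurable_pi_apply a).comp hV
  calc eLpNorm (fun ω => ‖V ω‖ ^ s) q μ
      ≤ eLpNorm (∑ a, fun ω => ‖V ω a‖ ^ s) q μ := by
        refine eLpNorm_mono_real fun ω => ?_
        rw [Real.norm_of_nonneg (by positivity), Finset.sum_apply]
        rcases isEmpty_or_nonempty (Fin d) with hd | hd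
        · have : ‖V ω‖ = 0 := by simp [Subsingleton.elim (V ω) 0]
          rw [this, Real.zero_rpow hs.ne']
          exact Finset.sum_nonneg fun a _ => by positivity
        · obtain ⟨a, ha⟩ : ∃ a, ‖V ω‖ = ‖V ω a‖ := by
            obtain ⟨a, -, ha⟩ := Finset.exists_max_image Finset.univ (fun a => ‖V ω a‖)
              Finset.univ_nonempty
            exact ⟨a, le_antisymm ((pi_norm_le_iff_of_nonneg (norm_nonneg _)).2
              fun b => ha b (Finset.mem_univ b)) (norm_le_pi_norm _ a)⟩
          rw [ha]
          exact Finset.single_le_sum (f := fun a => ‖V ω a‖ ^ s) (fun a _ => by positivity)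
            (Finset.mem_univ a)
    _ ≤ ∑ a : Fin d, eLpNorm (fun ω => ‖V ω a‖ ^ s) q μ :=
        eLpNorm_sum_le (fun a _ => ((hm a).norm.pow_const s).aestronglyMeasurable) hq
    _ ≤ ∑ _a : Fin d, δ ^ s := by
        refine Finset.sum_le_sum fun a _ => ?_
        rw [eLpNorm_norm_rpow _ hs]
        exact ENNReal.rpow_le_rpow (h a) hs.le
    _ = d * δ ^ s := by simp

theorem eLpNorm_sum_coupling_le (hJ : ∀ i, Measurable (J i)) (hm : ∀ i, Measurable (ε i))
    (hm' : ∀ i, Measurable (ε' i)) (hL : ∀ l, 0 ≤ L l) (hs : 0 < s) {n : ℕ} {q r : ℝ≥0∞}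
    (hq : 1 ≤ q) (hr : q * ENNReal.ofReal s = r) {i : ℤ} (hi : i ≤ n) (j : ℕ) :
    eLpNorm (fun ω => ∑ l ∈ Finset.range (j + 1),
      L l * ‖shiftSeq J ε (i - l) ω - coupledShift J ε ε' (i - l) (j - l) ω‖ ^ s) q μ
      ≤ d * ∑ l ∈ Finset.range (j + 1),
        ENNReal.ofReal (L l) * depMeasure μ n J ε ε' r (j - l) ^ s := by
  have hV : ∀ l : ℕ, Measurable fun ω =>
      shiftSeq J ε (i - l) ω - coupledShift J ε ε' (i - l) (j - l) ω := fun l =>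
    (measurable_shiftSeq hJ hm _).sub (measurable_coupledShift hJ hm hm' _ _)
  have hVs : ∀ l : ℕ, Measurable fun ω =>
      L l * ‖shiftSeq J ε (i - l) ω - coupledShift J ε ε' (i - l) (j - l) ω‖ ^ s := fun l =>
    measurable_const.mul ((hV l).norm.pow_const s)
  have h0 := eLpNorm_sum_le (μ := μ) (s := Finset.range (j + 1)) (p := q)
    (fun l _ => (hVs l).aestronglyMeasurable) hq
  have hfun : (∑ l ∈ Finset.range (j + 1), fun ω =>
      L l * ‖shiftSeq J ε (i - l) ω - coupledShift J ε ε' (i - l) (j - l) ω‖ ^ s)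
      = fun ω => ∑ l ∈ Finset.range (j + 1),
      L l * ‖shiftSeq J ε (i - l) ω - coupledShift J ε ε' (i - l) (j - l) ω‖ ^ s := by
    funext ω; rw [Finset.sum_apply]
  rw [hfun] at h0
  refine h0.trans ?_
  rw [Finset.mul_sum]
  refine Finset.sum_le_sum fun l _ => ?_
  have h2 : eLpNorm (fun ω =>
      ‖shiftSeq J ε (i - l) ω - coupledShift J ε ε' (i - l) (j - l) ω‖ ^ s) q μ
      ≤ d * depMeasure μ n J ε ε' r (j - l) ^ s := by
    refine eLpNorm_norm_rpow_le_of_coord (hV l) hq hs fun a => ?_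
    rw [hr]
    exact le_iSup₂_of_le (i - l) (by omega) (le_iSup_of_le a le_rfl)
  have h1 := eLpNorm_const_smul (L l) (fun ω =>
    ‖shiftSeq J ε (i - l) ω - coupledShift J ε ε' (i - l) (j - l) ω‖ ^ s) q μ
  rw [Real.enorm_of_nonneg (hL l)] at h1
  refine (h1.le.trans (mul_le_mul_right h2 _)).trans (le_of_eq ?_)
  ring

/-- Hölder's inequality with the exponents `ν p / (p - 1)` and `ν p` turns the moment conditions
into a bound on the `ν`-th moment of the effect of resampling. -/
theorem CompatibilityCondition.eLpNorm_couplingBound_le [IsProbabilityMeasure μ] {n : ℕ}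
    {F : Set (PathFun d)} {D : PathFun d → unitInterval → ℝ} {fbar : PathFun d → PathFun d}
    {CX ν : ℝ} {p : ℝ≥0∞} {Δ : ℕ → ℝ} {Dn : ℝ}
    (h : CompatibilityCondition μ n J ε ε' F D fbar L s R CR Cf CX ν p Δ Dn)
    (hε : IsInnovation μ ε ε') (hJ : ∀ i, Measurable (J i)) {i : ℕ} (hi : i ∈ Finset.Icc 1 n)
    (j : ℕ) (u : unitInterval) :
    eLpNorm (couplingBound J ε ε' L s R i j u) (ENNReal.ofReal ν) μ ≤ ENNReal.ofReal (Δ j) := by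
  have hin : (i : ℤ) ≤ n := by exact_mod_cast (Finset.mem_Icc.1 hi).2
  have hν0 : 0 < ν := by linarith [h.two_le_ν]
  have hs := h.smoothClass.s_pos
  set q : ℝ≥0∞ := ENNReal.conjExponent p with hq
  have hpq : p.HolderConjugate q := ENNReal.HolderConjugate.conjExponent h.one_lt_p.le
  have hq1 : 1 ≤ q := by rw [hq, ENNReal.conjExponent]; exact le_self_add
  have hν1 : 1 ≤ ENNReal.ofReal ν := by
    rw [← ENNReal.ofReal_one]; exact ENNReal.ofReal_le_ofReal (by linarith [h.two_le_ν])
  have hνne : ENNReal.ofReal ν ≠ 0 := (zero_lt_one.trans_le hν1).ne'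
  have hνq : 1 ≤ ENNReal.ofReal ν * q := one_le_mul hν1 hq1
  have hνp : 1 ≤ ENNReal.ofReal ν * p := one_le_mul hν1 h.one_lt_p.le
  have : ENNReal.HolderTriple (ENNReal.ofReal ν * q) (ENNReal.ofReal ν * p)
      (ENNReal.ofReal ν) := by
    constructor
    rw [ENNReal.mul_inv (Or.inl hνne) (Or.inl ENNReal.ofReal_ne_top),
      ENNReal.mul_inv (Or.inl hνne) (Or.inl ENNReal.ofReal_ne_top), ← mul_add, add_comm,
      ENNReal.HolderTriple.inv_add_inv_eq_inv p q 1, inv_one, mul_one]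
  have hRm := h.smoothClass.R_measurable u
  have hR1 : Measurable fun ω => R (past (shiftSeq J ε) i ω) u :=
    hRm.comp ((measurable_past_sigmaOn hJ i).mono (sigmaOn_le hε.measurable _) le_rfl)
  have hR2 : Measurable fun ω => R (pathFrom J i (resample ε ε' (i - j) ω)) u :=
    hRm.comp ((measurable_pathFrom hJ i).comp (hε.measurable_resample _))
  have hS : Measurable fun ω => ∑ l ∈ Finset.range (j + 1),
      L l * ‖shiftSeq J ε (i - l) ω - coupledShift J ε ε' (i - l) (j - l) ω‖ ^ s :=
    Finset.measurable_fun_sum _ fun l _ => measurable_const.mul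
      ((((measurable_shiftSeq hJ hε.measurable _).sub
        (measurable_coupledShift hJ hε.measurable hε.measurable_copy _ _)).norm).pow_const s)
  have hRR : eLpNorm (fun ω => R (past (shiftSeq J ε) i ω) u
      + R (pathFrom J i (resample ε ε' (i - j) ω)) u) (ENNReal.ofReal ν * p) μ
      ≤ 2 * ENNReal.ofReal CR := by
    refine (eLpNorm_add_le hR1.aestronglyMeasurable hR2.aestronglyMeasurable hνp).trans ?_
    have hid : eLpNorm (fun ω => R (pathFrom J i (resample ε ε' (i - j) ω)) u)
        (ENNReal.ofReal ν * p) μ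
        = eLpNorm (fun ω => R (past (shiftSeq J ε) i ω) u) (ENNReal.ofReal ν * p) μ :=
      ((hε.identDistrib_resample (i - j)).comp
        (hRm.comp (measurable_pathFrom hJ i))).eLpNorm_eq _
    rw [hid, two_mul]
    exact add_le_add (h.moment_R i hi u) (h.moment_R i hi u)
  have hSS := eLpNorm_sum_coupling_le (μ := μ) hJ hε.measurable hε.measurable_copy
    h.smoothClass.L_nonneg hs hνq
    (show ENNReal.ofReal ν * q * ENNReal.ofReal s = ENNReal.ofReal (ν * s) * q by
      rw [ENNReal.ofReal_mul hν0.le]; ring) hin j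
  refine (eLpNorm_smul_le_mul_eLpNorm (p := ENNReal.ofReal ν * q) (q := ENNReal.ofReal ν * p)
    (hR1.add hR2).aestronglyMeasurable hS.aestronglyMeasurable).trans ?_
  refine (mul_le_mul' hSS hRR).trans (le_trans (le_of_eq ?_) (h.dep j))
  ring

/-- The projection of `f(Z_i, u)` onto the innovation at time `i - j` is the conditional
expectation of the effect of resampling this innovation. -/
theorem CompatibilityCondition.abs_projAt_le [IsProbabilityMeasure μ] {n : ℕ}
    {F : Set (PathFun d)} {D : PathFun d → unitInterval → ℝ} {fbar : PathFun d → PathFun d}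
    {CX ν : ℝ} {p : ℝ≥0∞} {Δ : ℕ → ℝ} {Dn M : ℝ}
    (h : CompatibilityCondition μ n J ε ε' F D fbar L s R CR Cf CX ν p Δ Dn)
    (hε : IsInnovation μ ε ε') (hJ : ∀ i, Measurable (J i)) {f : PathFun d} (hf : f ∈ F)
    (hfm : Measurable (Function.uncurry f)) (hfM : ∀ z u, |f z u| ≤ M) {i : ℕ}
    (hi : i ∈ Finset.Icc 1 n) (j : ℕ) (u : unitInterval) :
    ∀ᵐ ω ∂μ, |projAt μ ε (fun ω => f (past (shiftSeq J ε) i ω) u) (i - j) ω|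
      ≤ |D f u| * (μ[couplingBound J ε ε' L s R i j u|sigmaOn ε (Set.Ici (i - j : ℤ))]) ω := by
  have hφ : Measurable fun x : ℤ → (Fin e → ℝ) => f (pathFrom J i x) u :=
    hfm.comp ((measurable_pathFrom hJ i).prodMk measurable_const)
  have hWi : Integrable (fun ω => f (past (shiftSeq J ε) i ω) u) μ :=
    Integrable.of_bound (hφ.comp (measurable_pi_iff.2 hε.measurable)).aestronglyMeasurable M
      (Filter.Eventually.of_forall fun ω => hfM _ _)
  have hWi' : Integrable (fun ω => f (pathFrom J i (resample ε ε' (i - j) ω)) u) μ :=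
    Integrable.of_bound (hφ.comp (hε.measurable_resample _)).aestronglyMeasurable M
      (Filter.Eventually.of_forall fun ω => hfM _ _)
  have hξ : Integrable (couplingBound J ε ε' L s R i j u) μ := by
    have hν1 : 1 ≤ ENNReal.ofReal ν := by
      rw [← ENNReal.ofReal_one]; exact ENNReal.ofReal_le_ofReal (by linarith [h.two_le_ν])
    exact MemLp.integrable hν1 ⟨(measurable_couplingBound hε hJ
      h.smoothClass.R_measurable i j u).aestronglyMeasurable,
      (h.eLpNorm_couplingBound_le hε hJ hi j u).trans_lt ENNReal.ofReal_lt_top⟩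
  have h1 := hε.condExp_resample (i - j) hφ hWi
  have h2 := condExp_sub hWi hWi' (sigmaOn ε (Set.Ici (i - j : ℤ)))
  have h3 : ∀ ω, |((fun ω => f (past (shiftSeq J ε) i ω) u)
      - fun ω => f (pathFrom J i (resample ε ε' (i - j) ω)) u) ω|
      ≤ |D f u| * couplingBound J ε ε' L s R i j u ω := by
    intro ω
    simp only [Pi.sub_apply]
    rw [h.factor f hf, h.factor f hf, ← mul_sub, abs_mul]
    exact mul_le_mul_of_nonneg_left
      (abs_sub_resample_le h.smoothClass (Set.mem_image_of_mem _ hf) i j u ω) (abs_nonneg _)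
  have h4 := abs_condExp_ae_le_condExp_abs (μ := μ) (m := sigmaOn ε (Set.Ici (i - j : ℤ)))
    ((fun ω => f (past (shiftSeq J ε) i ω) u)
      - fun ω => f (pathFrom J i (resample ε ε' (i - j) ω)) u)
  have h5 := condExp_mono (m := sigmaOn ε (Set.Ici (i - j : ℤ))) (hWi.sub hWi').abs
    (hξ.const_mul |D f u|) (Filter.Eventually.of_forall h3)
  have h6 := condExp_smul (μ := μ) |D f u| (couplingBound J ε ε' L s R i j u)
    (sigmaOn ε (Set.Ici (i - j : ℤ)))
  filter_upwards [h1, h2, h4, h5, h6] with ω w1 w2 w4 w5 w6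
  rw [Pi.sub_apply, w1] at w2
  have w7 : projAt μ ε (fun ω => f (past (shiftSeq J ε) i ω) u) (i - j) ω
      = (μ[(fun ω => f (past (shiftSeq J ε) i ω) u)
        - fun ω => f (pathFrom J i (resample ε ε' (i - j) ω)) u|
          sigmaOn ε (Set.Ici (i - j : ℤ))]) ω := by
    rw [w2]; rfl
  rw [w7]
  exact w4.trans (w5.trans w6.le)

end FunctionalDependence

namespace FunctionalDependence

/-! ### Projections as reverse martingale differences -/

variable {Ω : Type*} {m0 : MeasurableSpace Ω} {μ : Measure Ω} {e : ℕ}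
  {ε : ℤ → Ω → (Fin e → ℝ)}

theorem ofReal_integral_sq [IsFiniteMeasure μ] {f : Ω → ℝ} (hf : MemLp f 2 μ) :
    ENNReal.ofReal (∫ ω, f ω ^ 2 ∂μ) = eLpNorm f 2 μ ^ 2 := by
  rw [ofReal_integral_eq_lintegral_ofReal hf.integrable_sq
    (Filter.Eventually.of_forall fun ω => sq_nonneg _)]
  have h := eLpNorm_nnreal_pow_eq_lintegral (f := f) (μ := μ) (p := 2) two_ne_zero
  have h2 : eLpNorm f 2 μ ^ 2 = ∫⁻ ω, ‖f ω‖ₑ ^ 2 ∂μ := by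
    simpa using h
  rw [h2]
  refine lintegral_congr fun ω => ?_
  rw [← sq_abs, ENNReal.ofReal_pow (abs_nonneg _), Real.enorm_eq_ofReal_abs]

theorem integral_sq_le_of_eLpNorm_le [IsFiniteMeasure μ] {f : Ω → ℝ} (hf : MemLp f 2 μ) {a : ℝ}
    (ha : 0 ≤ a) (h : eLpNorm f 2 μ ≤ ENNReal.ofReal a) : ∫ ω, f ω ^ 2 ∂μ ≤ a ^ 2 := by
  rw [← ENNReal.ofReal_le_ofReal_iff (sq_nonneg a), ofReal_integral_sq hf, ENNReal.ofReal_pow ha]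
  exact pow_le_pow_left' h 2

theorem integral_condExp_sq_le [IsProbabilityMeasure μ] (m : MeasurableSpace Ω) {f : Ω → ℝ}
    (hf : MemLp f 2 μ) : ∫ ω, (μ[f|m]) ω ^ 2 ∂μ ≤ ∫ ω, f ω ^ 2 ∂μ := by
  rw [← ENNReal.ofReal_le_ofReal_iff (integral_nonneg fun ω => sq_nonneg _),
    ofReal_integral_sq hf, ofReal_integral_sq (hf.condExp one_le_two)]
  exact pow_le_pow_left' (eLpNorm_condExp_le_eLpNorm f one_le_two) 2

theorem stronglyMeasurable_projAt (W : Ω → ℝ) (k : ℤ) :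
    StronglyMeasurable[sigmaOn ε (Set.Ici k)] (projAt μ ε W k) :=
  stronglyMeasurable_condExp.sub
    (stronglyMeasurable_condExp.mono (sigmaOn_mono Set.Ioi_subset_Ici_self))

theorem integrable_projAt (W : Ω → ℝ) (k : ℤ) : Integrable (projAt μ ε W k) μ :=
  integrable_condExp.sub integrable_condExp

theorem condExp_projAt [IsProbabilityMeasure μ] (hm : ∀ i, Measurable (ε i)) (W : Ω → ℝ) (k : ℤ) :
    μ[projAt μ ε W k|sigmaOn ε (Set.Ioi k)] =ᵐ[μ] 0 := by
  have h1 := condExp_sub (μ := μ) (integrable_condExp (f := W) (m := sigmaOn ε (Set.Ici k)))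
    (integrable_condExp (f := W) (m := sigmaOn ε (Set.Ioi k))) (sigmaOn ε (Set.Ioi k))
  have h2 := condExp_condExp_of_le (μ := μ) (f := W)
    (sigmaOn_mono (ε := ε) (Set.Ioi_subset_Ici_self (a := k))) (sigmaOn_le hm _)
  have h3 := condExp_of_stronglyMeasurable (μ := μ) (sigmaOn_le hm (Set.Ioi k))
    (stronglyMeasurable_condExp (f := W) (μ := μ) (m := sigmaOn ε (Set.Ioi k))) integrable_condExp
  rw [h3] at h1
  filter_upwards [h1, h2] with ω w1 w2
  refine Eq.trans w1 ?_
  rw [Pi.sub_apply, w2, sub_self, Pi.zero_apply]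

theorem abs_condExp_le_const {W : Ω → ℝ} {M : ℝ} (hb : ∀ ω, |W ω| ≤ M) (m : MeasurableSpace Ω) :
    ∀ᵐ ω ∂μ, |(μ[W|m]) ω| ≤ M :=
  ae_bdd_abs_condExp_of_ae_bdd_abs (Filter.Eventually.of_forall hb)

theorem abs_projAt_le_two_mul {W : Ω → ℝ} {M : ℝ} (hb : ∀ ω, |W ω| ≤ M) (k : ℤ) :
    ∀ᵐ ω ∂μ, |projAt μ ε W k ω| ≤ 2 * M := by
  filter_upwards [abs_condExp_le_const (μ := μ) hb (sigmaOn ε (Set.Ici k)),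
    abs_condExp_le_const (μ := μ) hb (sigmaOn ε (Set.Ioi k))] with ω h1 h2
  refine (abs_sub _ _).trans ?_
  linarith

theorem memLp_projAt [IsProbabilityMeasure μ] {W : Ω → ℝ} {M : ℝ} (hb : ∀ ω, |W ω| ≤ M) (k : ℤ) :
    MemLp (projAt μ ε W k) 2 μ :=
  MemLp.of_bound (integrable_projAt W k).aestronglyMeasurable (2 * M) (abs_projAt_le_two_mul hb k)

theorem integral_projAt_sq_le [IsProbabilityMeasure μ] {W : Ω → ℝ} {M : ℝ}
    (hWm : AEStronglyMeasurable W μ) (hb : ∀ ω, |W ω| ≤ M) (k : ℤ) :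
    ∫ ω, projAt μ ε W k ω ^ 2 ∂μ ≤ 4 * ∫ ω, W ω ^ 2 ∂μ := by
  have hW : MemLp W 2 μ := MemLp.of_bound hWm M (Filter.Eventually.of_forall hb)
  have h1 := integral_condExp_sq_le (sigmaOn ε (Set.Ici k)) hW
  have h2 := integral_condExp_sq_le (sigmaOn ε (Set.Ioi k)) hW
  have i1 := ((hW.condExp (m := sigmaOn ε (Set.Ici k)) one_le_two).integrable_sq).const_mul 2
  have i2 := ((hW.condExp (m := sigmaOn ε (Set.Ioi k)) one_le_two).integrable_sq).const_mul 2
  calc ∫ ω, projAt μ ε W k ω ^ 2 ∂μ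
      ≤ ∫ ω, (2 * (μ[W|sigmaOn ε (Set.Ici k)]) ω ^ 2
          + 2 * (μ[W|sigmaOn ε (Set.Ioi k)]) ω ^ 2) ∂μ := by
        refine integral_mono (memLp_projAt hb k).integrable_sq (i1.add i2) fun ω => ?_
        simp only [projAt]
        nlinarith [sq_nonneg ((μ[W|sigmaOn ε (Set.Ici k)]) ω + (μ[W|sigmaOn ε (Set.Ioi k)]) ω)]
    _ ≤ _ := by
        rw [integral_add i1 i2, integral_const_mul, integral_const_mul]
        linarith

theorem integral_projAt_mul_projAt [IsProbabilityMeasure μ] (hm : ∀ i, Measurable (ε i))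
    {W W' : Ω → ℝ} {M : ℝ} (hb : ∀ ω, |W ω| ≤ M) (hb' : ∀ ω, |W' ω| ≤ M) {k k' : ℤ}
    (hk : k < k') : ∫ ω, projAt μ ε W k ω * projAt μ ε W' k' ω ∂μ = 0 := by
  have hi := (memLp_projAt (μ := μ) (ε := ε) hb k).integrable_mul
    (memLp_projAt (μ := μ) (ε := ε) hb' k')
  have hsub : Set.Ici k' ⊆ Set.Ioi k := fun x hx => lt_of_lt_of_le hk hx
  have h := condExp_mul_of_stronglyMeasurable_right (μ := μ) (m := sigmaOn ε (Set.Ioi k))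
    ((stronglyMeasurable_projAt (μ := μ) W' k').mono (sigmaOn_mono (ε := ε) hsub)) hi
    (integrable_projAt W k)
  have h0 := integral_condExp (μ := μ) (f := projAt μ ε W k * projAt μ ε W' k')
    (sigmaOn_le hm (Set.Ioi k))
  have : ∫ ω, (projAt μ ε W k * projAt μ ε W' k') ω ∂μ = 0 := by
    rw [← h0, integral_congr_ae (h.trans ((condExp_projAt hm W k).mono fun ω hω => by
      simp only [Pi.mul_apply]; rw [hω, Pi.zero_apply, zero_mul] : _ =ᵐ[μ] fun _ => (0 : ℝ)))]
    simp
  exact this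

/-- Projections onto the innovations at a fixed distance `j` are orthogonal, because they form a
sequence of reverse martingale differences. -/
theorem integral_sum_projAt_sq [IsProbabilityMeasure μ] (hm : ∀ i, Measurable (ε i))
    {W : ℕ → Ω → ℝ} {M : ℝ} (hb : ∀ i ω, |W i ω| ≤ M) (A : Finset ℕ) (j : ℕ) :
    ∫ ω, (∑ i ∈ A, projAt μ ε (W i) (i - j) ω) ^ 2 ∂μ
      = ∑ i ∈ A, ∫ ω, projAt μ ε (W i) (i - j) ω ^ 2 ∂μ := by
  have hint : ∀ i i', Integrable (fun ω => projAt μ ε (W i) ((i : ℕ) - j) ω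
      * projAt μ ε (W i') ((i' : ℕ) - j) ω) μ := fun i i' =>
    (memLp_projAt (hb i) _).integrable_mul (memLp_projAt (hb i') _)
  simp_rw [sq, Finset.sum_mul_sum]
  rw [integral_finsetSum _ fun i _ => integrable_finsetSum _ fun i' _ => hint i i']
  refine Finset.sum_congr rfl fun i hi => ?_
  rw [integral_finsetSum _ fun i' _ => hint i i', Finset.sum_eq_single_of_mem i hi]
  intro i' _ hne
  rcases lt_or_gt_of_ne hne with h | h
  · simp_rw [mul_comm (projAt μ ε (W i) _ _)]
    exact integral_projAt_mul_projAt hm (hb i') (hb i) (by omega)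
  · exact integral_projAt_mul_projAt hm (hb i) (hb i') (by omega)

/-- The projections onto the innovations at times `i, …, i - q + 1` add up to the centred
conditional expectation given these innovations. -/
theorem sum_projAt_ae_eq [IsProbabilityMeasure μ] (hm : ∀ i, Measurable (ε i))
    (h : iIndepFun ε μ) {W : Ω → ℝ} {i : ℤ}
    (hWm : StronglyMeasurable[sigmaOn ε (Set.Iic i)] W) (q : ℕ) :
    (fun ω => ∑ j ∈ Finset.range q, projAt μ ε W (i - j) ω)
      =ᵐ[μ] fun ω => (μ[W|sigmaOn ε (Set.Ioi (i - q))]) ω - ∫ ω, W ω ∂μ := by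
  have h0 : μ[W|sigmaOn ε (Set.Ioi i)] =ᵐ[μ] fun _ => ∫ ω, W ω ∂μ :=
    condExp_indep_eq (sigmaOn_le hm _) (sigmaOn_le hm _) hWm (indep_sigmaOn hm h
      (Set.disjoint_left.2 fun x hx hx' => not_lt.2 (Set.mem_Iic.1 hx) (Set.mem_Ioi.1 hx')))
  filter_upwards [h0] with ω hω
  induction q with
  | zero => simp [hω]
  | succ q ih =>
    have hS : Set.Ici (i - q : ℤ) = Set.Ioi (i - (q + 1 : ℕ)) := by
      ext x; simp only [Set.mem_Ici, Set.mem_Ioi]; omega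
    rw [Finset.sum_range_succ, ih, projAt, hS]
    ring

/-- Lévy's upward theorem along the filtration which reveals the past step by step. -/
theorem tendsto_sum_projAt [IsProbabilityMeasure μ] (hm : ∀ i, Measurable (ε i))
    (h : iIndepFun ε μ) {W : Ω → ℝ} {i : ℤ} (hW : Integrable W μ)
    (hWm : StronglyMeasurable[sigmaOn ε (Set.Iic i)] W) :
    ∀ᵐ ω ∂μ, Filter.Tendsto (fun q => ∑ j ∈ Finset.range q, projAt μ ε W (i - j) ω)
      Filter.atTop (nhds (W ω - ∫ ω, W ω ∂μ)) := by
  let ℱ : Filtration ℕ m0 :=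
    { seq := fun q => sigmaOn ε (Set.Ioi (i - q))
      mono' := fun q q' hq => sigmaOn_mono (Set.Ioi_subset_Ioi (by omega))
      le' := fun q => sigmaOn_le hm _ }
  have hle : sigmaOn ε (Set.Iic i) ≤ ⨆ q, ℱ q := by
    refine iSup₂_le fun t _ => ?_
    refine le_trans ?_ (le_iSup (fun q => ℱ q) (i - t + 1).toNat)
    exact (measurable_sigmaOn (ε := ε) (S := Set.Ioi (i - (i - t + 1).toNat))
      (by simp only [Set.mem_Ioi]; omega)).comap_le
  have hlim := hW.tendsto_ae_condExp (ℱ := ℱ) (hWm.mono hle)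
  have hsum := ae_all_iff.2 fun q => sum_projAt_ae_eq hm h hWm q
  filter_upwards [hlim, hsum] with ω h1 h2
  refine (h1.sub_const (∫ ω, W ω ∂μ)).congr fun q => ?_
  exact (h2 q).symm

end FunctionalDependence

namespace FunctionalDependence

/-! ### Bernstein's inequality for the part with short memory -/

variable {Ω : Type*} {m0 : MeasurableSpace Ω} {μ : Measure Ω} {e : ℕ}
  {ε : ℤ → Ω → (Fin e → ℝ)}

/-- Chernoff's bound with `t = a / (2 V + c a)`: the sub-gamma form of Bernstein's inequality. -/
theorem measureReal_lt_abs_le_of_mgf [IsProbabilityMeasure μ] {T : Ω → ℝ} {c V C : ℝ}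
    (hT : AEStronglyMeasurable T μ) (hb : ∀ᵐ ω ∂μ, |T ω| ≤ C) (hc : 0 ≤ c) (hV : 0 ≤ V)
    (h : ∀ t : ℝ, |t| * c ≤ 1 → ∫ ω, Real.exp (t * T ω) ∂μ ≤ Real.exp (t ^ 2 * V)) {a : ℝ}
    (ha : 0 < a) :
    μ.real {ω | a < |T ω|} ≤ 2 * Real.exp (-(a ^ 2 / (4 * V + 2 * c * a))) := by
  rcases eq_or_lt_of_le (show 0 ≤ 2 * V + c * a by positivity) with h0 | h0
  · have : 4 * V + 2 * c * a = 0 := by linarith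
    rw [this, div_zero, neg_zero, Real.exp_zero]
    linarith [measureReal_le_one (μ := μ) (s := {ω | a < |T ω|})]
  set t : ℝ := a / (2 * V + c * a) with ht
  have ht0 : 0 ≤ t := by positivity
  have htc : |t| * c ≤ 1 := by
    rw [abs_of_nonneg ht0, ht, div_mul_eq_mul_div, div_le_one h0]
    nlinarith
  have htc' : |-t| * c ≤ 1 := by rwa [abs_neg]
  have hint : ∀ t : ℝ, Integrable (fun ω => Real.exp (t * T ω)) μ := by
    intro t
    refine Integrable.of_bound
      (Real.continuous_exp.comp_aestronglyMeasurable (hT.const_mul t)) (Real.exp (|t| * C)) ?_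
    filter_upwards [hb] with ω hω
    rw [Real.norm_eq_abs, abs_of_pos (Real.exp_pos _), Real.exp_le_exp]
    refine (le_abs_self _).trans ?_
    rw [abs_mul]
    exact mul_le_mul_of_nonneg_left hω (abs_nonneg _)
  have hexp : -t * a + t ^ 2 * V ≤ -(a ^ 2 / (4 * V + 2 * c * a)) := by
    have h1 : t ^ 2 * V ≤ t * a / 2 := by
      have : t * V ≤ a / 2 := by
        rw [ht, div_mul_eq_mul_div, div_le_div_iff₀ h0 two_pos]
        nlinarith [mul_nonneg hc ha.le]
      nlinarith
    have h2 : a ^ 2 / (4 * V + 2 * c * a) = t * a / 2 := by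
      rw [ht]
      have : 4 * V + 2 * c * a = 2 * (2 * V + c * a) := by ring
      rw [this]
      field_simp
    linarith
  have e1 : μ.real {ω | a ≤ T ω} ≤ Real.exp (-(a ^ 2 / (4 * V + 2 * c * a))) := by
    refine (measure_ge_le_exp_mul_mgf a ht0 (hint t)).trans ?_
    refine (mul_le_mul_of_nonneg_left (h t htc) (Real.exp_pos _).le).trans ?_
    rw [← Real.exp_add]
    exact Real.exp_le_exp.2 hexp
  have e2 : μ.real {ω | T ω ≤ -a} ≤ Real.exp (-(a ^ 2 / (4 * V + 2 * c * a))) := by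
    refine (measure_le_le_exp_mul_mgf (-a) (neg_nonpos.2 ht0) (hint (-t))).trans ?_
    refine (mul_le_mul_of_nonneg_left (h (-t) htc') (Real.exp_pos _).le).trans ?_
    rw [← Real.exp_add]
    refine Real.exp_le_exp.2 (le_trans (le_of_eq ?_) hexp)
    ring
  have hsub : {ω | a < |T ω|} ⊆ {ω | a ≤ T ω} ∪ {ω | T ω ≤ -a} := by
    intro ω hω
    rcases lt_abs.1 (Set.mem_ofPred_eq ▸ hω) with h | h
    · exact Or.inl h.le
    · exact Or.inr (by simp only [Set.mem_ofPred_eq]; linarith)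
  linarith [measureReal_mono (μ := μ) hsub,
    measureReal_union_le (μ := μ) {ω | a ≤ T ω} {ω | T ω ≤ -a}]

theorem integral_exp_sum_le_of_indep [IsProbabilityMeasure μ] {S : ℕ → Ω → ℝ} {c t : ℝ}
    (hS : ∀ k, Measurable (S k)) (hb : ∀ k, ∀ᵐ ω ∂μ, |S k ω| ≤ c) (h0 : ∀ k, ∫ ω, S k ω ∂μ = 0)
    (hind : ∀ K, IndepFun (fun ω => ∑ k ∈ Finset.range K, S k ω) (S K) μ) (ht : |t| * c ≤ 1)
    (K : ℕ) :
    ∫ ω, Real.exp (t * ∑ k ∈ Finset.range K, S k ω) ∂μ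
      ≤ Real.exp (t ^ 2 * ∑ k ∈ Finset.range K, ∫ ω, S k ω ^ 2 ∂μ) := by
  induction K with
  | zero => simp
  | succ K ih =>
    have hexp : Measurable fun x : ℝ => Real.exp (t * x) := by fun_prop
    have hi := ((hind K).comp hexp hexp).integral_fun_mul_eq_mul_integral
      (hexp.comp (Finset.measurable_fun_sum _ fun k _ => hS k)).aestronglyMeasurable
      (hexp.comp (hS K)).aestronglyMeasurable
    simp only [Function.comp_apply] at hi
    simp_rw [Finset.sum_range_succ, mul_add, Real.exp_add]
    rw [hi]
    exact mul_le_mul ih (integral_exp_mul_le_of_abs_le (hS K).aestronglyMeasurable (hb K) (h0 K) ht)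
      (integral_nonneg fun ω => (Real.exp_pos _).le) (Real.exp_pos _).le

/-- The centred conditional expectation of `W_i` given the `q` most recent innovations. -/
noncomputable def shortMemory (μ : Measure Ω) (ε : ℤ → Ω → (Fin e → ℝ)) (W : ℕ → Ω → ℝ) (q i : ℕ)
    (ω : Ω) : ℝ :=
  (μ[W i|sigmaOn ε (Set.Icc (i - q + 1 : ℤ) i)]) ω - ∫ ω, W i ω ∂μ

/-- The indices `1 ≤ i ≤ n` in the `b`-th block `(b q, (b + 1) q]` of length `q`. -/
def block (n q b : ℕ) : Finset ℕ := {i ∈ Finset.Icc 1 n | (i - 1) / q = b}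

theorem mem_block {n q b i : ℕ} (hq : 1 ≤ q) (hi : i ∈ block n q b) :
    b * q + 1 ≤ i ∧ i ≤ (b + 1) * q := by
  simp only [block, Finset.mem_filter, Finset.mem_Icc] at hi
  obtain ⟨⟨h1, -⟩, rfl⟩ := hi
  have h2 := Nat.div_mul_le_self (i - 1) q
  have h3 := Nat.lt_div_mul_add (a := i - 1) hq
  rw [add_mul, one_mul]
  omega

theorem card_block_le {n q b : ℕ} (hq : 1 ≤ q) : (block n q b).card ≤ q := by
  have : block n q b ⊆ Finset.Icc (b * q + 1) ((b + 1) * q) := fun i hi =>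
    Finset.mem_Icc.2 (mem_block hq hi)
  refine (Finset.card_le_card this).trans ?_
  rw [Nat.card_Icc, add_mul, one_mul]
  omega

theorem sum_block {n q : ℕ} (f : ℕ → ℝ) :
    ∑ b ∈ Finset.range (2 * n), ∑ i ∈ block n q b, f i = ∑ i ∈ Finset.Icc 1 n, f i := by
  refine Finset.sum_fiberwise_of_maps_to (fun i hi => ?_) f
  have h := Finset.mem_Icc.1 hi
  have := Nat.div_le_self (i - 1) q
  exact Finset.mem_range.2 (by omega)

theorem sum_range_two_mul (f : ℕ → ℝ) (n : ℕ) :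
    ∑ b ∈ Finset.range (2 * n), f b
      = ∑ k ∈ Finset.range n, f (2 * k) + ∑ k ∈ Finset.range n, f (2 * k + 1) := by
  induction n with
  | zero => simp
  | succ n ih =>
    rw [show 2 * (n + 1) = 2 * n + 1 + 1 by ring, Finset.sum_range_succ, Finset.sum_range_succ, ih,
      Finset.sum_range_succ, Finset.sum_range_succ]
    ring

theorem stronglyMeasurable_shortMemory (W : ℕ → Ω → ℝ) (q i : ℕ) :
    StronglyMeasurable[sigmaOn ε (Set.Icc (i - q + 1 : ℤ) i)] (shortMemory μ ε W q i) :=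
  stronglyMeasurable_condExp.sub stronglyMeasurable_const

/-- The part with short memory collects the projections onto innovations at distance less than `q`.
-/
theorem shortMemory_ae_eq [IsProbabilityMeasure μ] (hm : ∀ i, Measurable (ε i))
    (h : iIndepFun ε μ) {W : ℕ → Ω → ℝ} {M : ℝ} (hb : ∀ i ω, |W i ω| ≤ M)
    (hW : ∀ i : ℕ, StronglyMeasurable[sigmaOn ε (Set.Iic (i : ℤ))] (W i)) (q i : ℕ) :
    shortMemory μ ε W q i
      =ᵐ[μ] fun ω => ∑ j ∈ Finset.range q, projAt μ ε (W i) (i - j) ω := by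
  have hi : Integrable (W i) μ := Integrable.of_bound
    ((hW i).mono (sigmaOn_le hm _)).aestronglyMeasurable M (Filter.Eventually.of_forall (hb i))
  have h1 := sum_projAt_ae_eq hm h (hW i) q
  have h2 := condExp_sigmaOn_Ici hm h (i := i) (k := i - q + 1) (by omega) hi (hW i)
  have hS : Set.Ici (i - q + 1 : ℤ) = Set.Ioi (i - q : ℤ) := by
    ext x; simp only [Set.mem_Ici, Set.mem_Ioi]; omega
  rw [hS] at h2
  filter_upwards [h1, h2] with ω w1 w2
  rw [w1, w2]
  rfl

/-- The variance of the block sums: the projections onto innovations at a fixed distance are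
orthogonal, and different distances are combined by the Cauchy-Schwarz inequality. -/
theorem sum_integral_block_sq_le_of_pos [IsProbabilityMeasure μ] (hm : ∀ i, Measurable (ε i))
    (h : iIndepFun ε μ) {W : ℕ → Ω → ℝ} {M : ℝ} (hb : ∀ i ω, |W i ω| ≤ M)
    (hW : ∀ i : ℕ, StronglyMeasurable[sigmaOn ε (Set.Iic (i : ℤ))] (W i)) {n q : ℕ}
    {v : ℕ → ℝ} (hv : ∀ j, 0 < v j)
    (hd : ∀ j < q, ∑ i ∈ Finset.Icc 1 n, ∫ ω, projAt μ ε (W i) (i - j) ω ^ 2 ∂μ ≤ n * v j ^ 2) :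
    ∑ b ∈ Finset.range (2 * n), ∫ ω, (∑ i ∈ block n q b, shortMemory μ ε W q i ω) ^ 2 ∂μ
      ≤ n * (∑ j ∈ Finset.range q, v j) ^ 2 := by
  set V := ∑ j ∈ Finset.range q, v j with hV
  have hV0 : 0 ≤ V := Finset.sum_nonneg fun j _ => (hv j).le
  have hblock : ∀ b, ∫ ω, (∑ i ∈ block n q b, shortMemory μ ε W q i ω) ^ 2 ∂μ
      ≤ V * ∑ j ∈ Finset.range q,
        (∑ i ∈ block n q b, ∫ ω, projAt μ ε (W i) (i - j) ω ^ 2 ∂μ) / v j := by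
    intro b
    have hY : ∀ j, Integrable (fun ω =>
        (∑ i ∈ block n q b, projAt μ ε (W i) ((i : ℕ) - j : ℤ) ω) ^ 2) μ := fun j =>
      (memLp_finsetSum _ fun i _ => memLp_projAt (hb i) _).integrable_sq
    have hYd : ∀ j, Integrable (fun ω =>
        (∑ i ∈ block n q b, projAt μ ε (W i) ((i : ℕ) - (j : ℕ) : ℤ) ω) ^ 2 / v j) μ := fun j =>
      (hY j).div_const _
    calc ∫ ω, (∑ i ∈ block n q b, shortMemory μ ε W q i ω) ^ 2 ∂μ
        = ∫ ω, (∑ j ∈ Finset.range q, ∑ i ∈ block n q b, projAt μ ε (W i) (i - j) ω) ^ 2 ∂μ := by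
          refine integral_congr_ae ?_
          filter_upwards [ae_all_iff.2 fun i => shortMemory_ae_eq hm h hb hW q i] with ω hω
          simp only [hω]
          rw [Finset.sum_comm]
      _ ≤ ∫ ω, V * ∑ j ∈ Finset.range q,
            (∑ i ∈ block n q b, projAt μ ε (W i) (i - j) ω) ^ 2 / v j ∂μ := by
          refine integral_mono_of_nonneg (Filter.Eventually.of_forall fun ω => sq_nonneg _)
            ((integrable_finsetSum _ fun j _ => hYd j).const_mul V)
            (Filter.Eventually.of_forall fun ω => ?_)
          refine Finset.sum_sq_le_sum_mul_sum_of_sq_le_mul _ (fun j _ => (hv j).le)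
            (fun j _ => div_nonneg (sq_nonneg _) (hv j).le) fun j _ => ?_
          exact (mul_div_cancel₀ _ (hv j).ne').symm.le
      _ = _ := by
          rw [integral_const_mul, integral_finsetSum _ fun j _ => hYd j]
          congr 1
          refine Finset.sum_congr rfl fun j _ => ?_
          rw [integral_div, integral_sum_projAt_sq hm hb]
  calc _ ≤ ∑ b ∈ Finset.range (2 * n), V * ∑ j ∈ Finset.range q,
        (∑ i ∈ block n q b, ∫ ω, projAt μ ε (W i) (i - j) ω ^ 2 ∂μ) / v j :=
        Finset.sum_le_sum fun b _ => hblock b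
    _ = V * ∑ j ∈ Finset.range q,
        (∑ i ∈ Finset.Icc 1 n, ∫ ω, projAt μ ε (W i) (i - j) ω ^ 2 ∂μ) / v j := by
        rw [← Finset.mul_sum, Finset.sum_comm]
        congr 1
        refine Finset.sum_congr rfl fun j _ => ?_
        rw [← Finset.sum_div, sum_block fun i => ∫ ω, projAt μ ε (W i) (i - j) ω ^ 2 ∂μ]
    _ ≤ V * ∑ j ∈ Finset.range q, n * v j := by
        refine mul_le_mul_of_nonneg_left (Finset.sum_le_sum fun j hj => ?_) hV0
        rw [div_le_iff₀ (hv j)]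
        have := hd j (Finset.mem_range.1 hj)
        nlinarith
    _ = _ := by rw [← Finset.mul_sum]; ring

theorem sum_integral_block_sq_le [IsProbabilityMeasure μ] (hm : ∀ i, Measurable (ε i))
    (h : iIndepFun ε μ) {W : ℕ → Ω → ℝ} {M : ℝ} (hb : ∀ i ω, |W i ω| ≤ M)
    (hW : ∀ i : ℕ, StronglyMeasurable[sigmaOn ε (Set.Iic (i : ℤ))] (W i)) {n q : ℕ}
    {v : ℕ → ℝ} (hv : ∀ j, 0 ≤ v j)
    (hd : ∀ j < q, ∑ i ∈ Finset.Icc 1 n, ∫ ω, projAt μ ε (W i) (i - j) ω ^ 2 ∂μ ≤ n * v j ^ 2) :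
    ∑ b ∈ Finset.range (2 * n), ∫ ω, (∑ i ∈ block n q b, shortMemory μ ε W q i ω) ^ 2 ∂μ
      ≤ n * (∑ j ∈ Finset.range q, v j) ^ 2 := by
  -- Some `v j` may vanish; they are enlarged by `δ`, and `δ` tends to `0`.
  have hc : Continuous fun δ : ℝ => n * (∑ j ∈ Finset.range q, (v j + δ)) ^ 2 := by fun_prop
  have ht := (hc.tendsto' 0 (n * (∑ j ∈ Finset.range q, v j) ^ 2) (by simp)).mono_left
    (nhdsWithin_le_nhds (s := Set.Ioi 0))
  refine ge_of_tendsto ht ?_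
  filter_upwards [self_mem_nhdsWithin] with δ hδ
  have hδ' : 0 < δ := hδ
  refine sum_integral_block_sq_le_of_pos hm h hb hW (fun j => by linarith [hv j]) fun j hj => ?_
  refine (hd j hj).trans ?_
  gcongr
  · exact hv j
  · linarith

/-- Bernstein's inequality for blocks of length `q`: the sums over the even blocks are independent,
and so are those over the odd ones, since `shortMemory` depends on `q` innovations only. The
hypothesis `hd` bounds the projections in mean square at the distances which enter. -/
theorem measureReal_shortMemory_le [IsProbabilityMeasure μ] (hm : ∀ i, Measurable (ε i))
    (h : iIndepFun ε μ) {W : ℕ → Ω → ℝ} {M : ℝ} (hM : 0 ≤ M) (hb : ∀ i ω, |W i ω| ≤ M)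
    (hW : ∀ i : ℕ, StronglyMeasurable[sigmaOn ε (Set.Iic (i : ℤ))] (W i)) {n q : ℕ} (hq : 1 ≤ q)
    {v : ℕ → ℝ} (hv : ∀ j, 0 ≤ v j)
    (hd : ∀ j < q, ∑ i ∈ Finset.Icc 1 n, ∫ ω, projAt μ ε (W i) (i - j) ω ^ 2 ∂μ ≤ n * v j ^ 2)
    {a : ℝ} (ha : 0 < a) :
    μ.real {ω | a < |∑ i ∈ Finset.Icc 1 n, shortMemory μ ε W q i ω|}
      ≤ 4 * Real.exp (-(a ^ 2 /
        (16 * (n * (∑ j ∈ Finset.range q, v j) ^ 2) + 8 * (M * q) * a))) := by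
  set Var : ℝ := n * (∑ j ∈ Finset.range q, v j) ^ 2 with hVar
  set S : ℕ → Ω → ℝ := fun b ω => ∑ i ∈ block n q b, shortMemory μ ε W q i ω with hS
  have hsm : ∀ (b : ℕ) (A : Set ℤ), Set.Icc ((b - 1) * q + 1 : ℤ) ((b + 1) * q) ⊆ A →
      StronglyMeasurable[sigmaOn ε A] (S b) := by
    intro b A hA
    refine Finset.stronglyMeasurable_fun_sum _ fun i hi => ?_
    refine (stronglyMeasurable_shortMemory W q i).mono (sigmaOn_mono ?_)
    refine subset_trans (fun x hx => ?_) hA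
    have h1 := mem_block hq hi
    have h2 : ((b : ℤ) * q + 1 ≤ i) ∧ (i : ℤ) ≤ (b + 1) * q := by exact_mod_cast h1
    rw [Set.mem_Icc] at hx ⊢
    constructor
    · linarith
    · linarith
  have hSm : ∀ b, Measurable (S b) := fun b =>
    ((hsm b Set.univ (Set.subset_univ _)).mono (sigmaOn_le hm _)).measurable
  have hbd1 : ∀ i, ∀ᵐ ω ∂μ, |shortMemory μ ε W q i ω| ≤ 2 * M := by
    intro i
    have hE : |∫ ω, W i ω ∂μ| ≤ M := by
      simpa using norm_integral_le_of_norm_le_const (μ := μ) (f := W i) (C := M)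
        (Filter.Eventually.of_forall (hb i))
    filter_upwards [abs_condExp_le_const (μ := μ) (hb i)
      (sigmaOn ε (Set.Icc (i - q + 1 : ℤ) i))] with ω hω
    refine (abs_sub _ _).trans ?_
    linarith
  have hbd : ∀ b, ∀ᵐ ω ∂μ, |S b ω| ≤ 2 * M * q := by
    intro b
    filter_upwards [ae_all_iff.2 hbd1] with ω hω
    refine (Finset.abs_sum_le_sum_abs _ _).trans
      ((Finset.sum_le_card_nsmul _ _ _ fun i _ => hω i).trans ?_)
    rw [nsmul_eq_mul, mul_comm]
    have : ((block n q b).card : ℝ) ≤ q := by exact_mod_cast card_block_le hq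
    gcongr
  have hmean : ∀ b, ∫ ω, S b ω ∂μ = 0 := by
    intro b
    have hsi : ∀ i, Integrable (shortMemory μ ε W q i) μ := fun i =>
      integrable_condExp.sub (integrable_const _)
    simp only [hS]
    rw [integral_finsetSum _ fun i _ => hsi i]
    refine Finset.sum_eq_zero fun i _ => ?_
    unfold shortMemory
    rw [integral_sub integrable_condExp (integrable_const _), integral_condExp (sigmaOn_le hm _)]
    simp
  have hvar : ∑ k ∈ Finset.range n, ∫ ω, S (2 * k) ω ^ 2 ∂μ
      + ∑ k ∈ Finset.range n, ∫ ω, S (2 * k + 1) ω ^ 2 ∂μ ≤ Var := by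
    rw [← sum_range_two_mul fun b => ∫ ω, S b ω ^ 2 ∂μ]
    exact sum_integral_block_sq_le hm h hb hW hv hd
  have hnn : ∀ b, 0 ≤ ∫ ω, S b ω ^ 2 ∂μ := fun b => integral_nonneg fun ω => sq_nonneg _
  have hparity : ∀ r ≤ 1, ∑ k ∈ Finset.range n, ∫ ω, S (2 * k + r) ω ^ 2 ∂μ ≤ Var →
      μ.real {ω | a / 2 < |∑ k ∈ Finset.range n, S (2 * k + r) ω|}
        ≤ 2 * Real.exp (-(a ^ 2 / (16 * Var + 8 * (M * q) * a))) := by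
    intro r _ hr
    have hind : ∀ K, IndepFun (fun ω => ∑ k ∈ Finset.range K, S (2 * k + r) ω)
        (S (2 * K + r)) μ := by
      intro K
      rw [IndepFun_iff_Indep]
      have hqz : (1 : ℤ) ≤ q := by exact_mod_cast hq
      have hdis : Disjoint (Set.Iic ((2 * K + r - 1) * q : ℤ))
          (Set.Ioi ((2 * K + r - 1) * q : ℤ)) :=
        Set.disjoint_left.2 fun x hx hx' => not_lt.2 (Set.mem_Iic.1 hx) (Set.mem_Ioi.1 hx')
      refine indep_of_indep_of_le_left (indep_of_indep_of_le_right (indep_sigmaOn hm h hdis) ?_) ?_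
      · refine Measurable.comap_le (hsm _ _ fun x hx => ?_).measurable
        have := (Set.mem_Icc.1 hx).1
        push_cast at this
        rw [Set.mem_Ioi]
        linarith
      · refine Measurable.comap_le (StronglyMeasurable.measurable ?_)
        refine Finset.stronglyMeasurable_fun_sum _ fun k hk => hsm _ _ fun x hx => ?_
        have h1 := (Set.mem_Icc.1 hx).2
        have h2 : (k : ℤ) + 1 ≤ K := by exact_mod_cast Finset.mem_range.1 hk
        push_cast at h1
        rw [Set.mem_Iic]
        nlinarith
    have hTm : AEStronglyMeasurable (fun ω => ∑ k ∈ Finset.range n, S (2 * k + r) ω) μ :=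
      (Finset.measurable_fun_sum _ fun k _ => hSm _).aestronglyMeasurable
    have hTb : ∀ᵐ ω ∂μ, |∑ k ∈ Finset.range n, S (2 * k + r) ω| ≤ n * (2 * M * q) := by
      filter_upwards [ae_all_iff.2 hbd] with ω hω
      refine (Finset.abs_sum_le_sum_abs _ _).trans
        ((Finset.sum_le_card_nsmul _ _ _ fun k _ => hω (2 * k + r)).trans ?_)
      simp
    have hVar0 : 0 ≤ Var := by positivity
    have hmain := measureReal_lt_abs_le_of_mgf (c := 2 * M * q) (V := Var) (a := a / 2) hTm hTb
      (by positivity) hVar0 (fun t ht => (integral_exp_sum_le_of_indep (fun k => hSm _)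
        (fun k => hbd _) (fun k => hmean _) hind ht n).trans (Real.exp_le_exp.2 (by gcongr)))
      (by positivity)
    refine hmain.trans (le_of_eq ?_)
    congr 3
    rw [show (a / 2) ^ 2 = a ^ 2 / 4 by ring, div_div]
    congr 1
    ring
  have hsub : {ω | a < |∑ i ∈ Finset.Icc 1 n, shortMemory μ ε W q i ω|}
      ⊆ {ω | a / 2 < |∑ k ∈ Finset.range n, S (2 * k + 0) ω|}
        ∪ {ω | a / 2 < |∑ k ∈ Finset.range n, S (2 * k + 1) ω|} := by
    intro ω hω
    have hω' : a < |∑ i ∈ Finset.Icc 1 n, shortMemory μ ε W q i ω| := hω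
    rw [← sum_block (q := q), sum_range_two_mul] at hω'
    by_contra hcon
    simp only [Set.mem_union, Set.mem_ofPred_eq, not_or, not_lt] at hcon
    have := (hω'.trans_le (abs_add_le _ _))
    have h3 := hcon.1
    have h4 := hcon.2
    simp only [hS, add_zero] at h3 h4
    linarith
  have s0 : 0 ≤ ∑ k ∈ Finset.range n, ∫ ω, S (2 * k) ω ^ 2 ∂μ := Finset.sum_nonneg fun k _ => hnn _
  have s1 : 0 ≤ ∑ k ∈ Finset.range n, ∫ ω, S (2 * k + 1) ω ^ 2 ∂μ :=
    Finset.sum_nonneg fun k _ => hnn _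
  have p0 := hparity 0 (by norm_num) (by simp only [add_zero]; linarith)
  have p1 := hparity 1 le_rfl (by linarith)
  linarith [measureReal_mono (μ := μ) hsub, measureReal_union_le (μ := μ)
    {ω | a / 2 < |∑ k ∈ Finset.range n, S (2 * k + 0) ω|}
    {ω | a / 2 < |∑ k ∈ Finset.range n, S (2 * k + 1) ω|}]

end FunctionalDependence

namespace FunctionalDependence

/-! ### Exponential moments of the part with long memory -/

variable {Ω : Type*} {m0 : MeasurableSpace Ω} {μ : Measure Ω} {e : ℕ}
  {ε : ℤ → Ω → (Fin e → ℝ)}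

/-- The sum of the squares of `η_1, …, η_n` and of their conditional second moments given the
innovations after time `i - j`. -/
noncomputable def quadVar (μ : Measure Ω) (ε : ℤ → Ω → (Fin e → ℝ)) (η : ℕ → Ω → ℝ) (n j : ℕ)
    (ω : Ω) : ℝ :=
  ∑ i ∈ Finset.Icc 1 n,
    (η i ω ^ 2 + (μ[fun ω => η i ω ^ 2|sigmaOn ε (Set.Ioi (i - j : ℤ))]) ω)

theorem measurable_quadVar (hm : ∀ i, Measurable (ε i)) {η : ℕ → Ω → ℝ}
    (hη : ∀ i, Measurable (η i)) (n j : ℕ) : Measurable (quadVar μ ε η n j) :=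
  Finset.measurable_fun_sum _ fun i _ => ((hη i).pow_const 2).add
    (stronglyMeasurable_condExp.mono (sigmaOn_le hm _)).measurable

/-- The exponential supermartingale of the projections at distance `j`, where the parameter `t` is
any real number. -/
theorem integral_exp_sum_projAt_le [IsProbabilityMeasure μ] (hm : ∀ i, Measurable (ε i))
    {W : ℕ → Ω → ℝ} {M : ℝ} (hb : ∀ i ω, |W i ω| ≤ M) (n j : ℕ) (t : ℝ) :
    Integrable (fun ω => Real.exp (∑ i ∈ Finset.Icc 1 n, (t * projAt μ ε (W i) (i - j) ω
      - (t * projAt μ ε (W i) (i - j) ω) ^ 2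
      - (μ[fun ω => (t * projAt μ ε (W i) (i - j) ω) ^ 2|sigmaOn ε (Set.Ioi (i - j : ℤ))]) ω))) μ ∧
    ∫ ω, Real.exp (∑ i ∈ Finset.Icc 1 n, (t * projAt μ ε (W i) (i - j) ω
      - (t * projAt μ ε (W i) (i - j) ω) ^ 2
      - (μ[fun ω => (t * projAt μ ε (W i) (i - j) ω) ^ 2|sigmaOn ε (Set.Ioi (i - j : ℤ))]) ω)) ∂μ
      ≤ 1 := by
  -- Time is reversed, `i = n - r`, so that the σ-algebras increase.
  have hrev : ∀ g : ℕ → ℝ, ∑ i ∈ Finset.Icc 1 n, g i = ∑ r ∈ Finset.range n, g (n - r) := by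
    intro g
    refine (Finset.sum_nbij' (fun r => n - r) (fun i => n - i) ?_ ?_ ?_ ?_ ?_).symm
    · intro r hr; have := Finset.mem_range.1 hr; exact Finset.mem_Icc.2 (by omega)
    · intro i hi; have := Finset.mem_Icc.1 hi; exact Finset.mem_range.2 (by omega)
    · intro r hr; have := Finset.mem_range.1 hr; omega
    · intro i hi; have := Finset.mem_Icc.1 hi; omega
    · intro r _; rfl
  have key := integral_exp_compensated_le_one (μ := μ)
    (𝒢 := fun r : ℕ => sigmaOn ε (Set.Ioi (n - r - j : ℤ)))
    (y := fun r ω => t * projAt μ ε (W (n - r)) ((n - r : ℕ) - j) ω) (C := |t| * (2 * M))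
    (fun r r' hr => sigmaOn_mono (Set.Ioi_subset_Ioi (by omega)))
    (fun r => sigmaOn_le hm _) n ?_ ?_ ?_
  · have hcongr : ∀ ω, ∑ i ∈ Finset.Icc 1 n, (t * projAt μ ε (W i) (i - j) ω
      - (t * projAt μ ε (W i) (i - j) ω) ^ 2
      - (μ[fun ω => (t * projAt μ ε (W i) (i - j) ω) ^ 2|sigmaOn ε (Set.Ioi (i - j : ℤ))]) ω)
      = ∑ r ∈ Finset.range n, (t * projAt μ ε (W (n - r)) ((n - r : ℕ) - j) ω
      - (t * projAt μ ε (W (n - r)) ((n - r : ℕ) - j) ω) ^ 2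
      - (μ[fun ω => (t * projAt μ ε (W (n - r)) ((n - r : ℕ) - j) ω) ^ 2|
          sigmaOn ε (Set.Ioi (n - r - j : ℤ))]) ω) := by
      intro ω
      rw [hrev]
      refine Finset.sum_congr rfl fun r hr => ?_
      rw [Nat.cast_sub (Finset.mem_range.1 hr).le]
    simp_rw [hcongr]
    exact key
  · intro r hr
    have h1 := stronglyMeasurable_projAt (μ := μ) (ε := ε) (W (n - r)) ((n - r : ℕ) - j)
    have hS : Set.Ici (((n - r : ℕ) : ℤ) - j) ⊆ Set.Ioi (n - (r + 1 : ℕ) - j : ℤ) := by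
      intro x hx; simp only [Set.mem_Ici, Set.mem_Ioi] at hx ⊢; omega
    exact (h1.mono (sigmaOn_mono hS)).const_mul t
  · intro r _
    filter_upwards [abs_projAt_le_two_mul (μ := μ) (ε := ε) (hb (n - r)) ((n - r : ℕ) - j)]
      with ω hω
    rw [abs_mul]
    exact mul_le_mul_of_nonneg_left hω (abs_nonneg _)
  · intro r hr
    have h1 := condExp_projAt (μ := μ) hm (W (n - r)) ((n - r : ℕ) - j)
    have hS : Set.Ioi (((n - r : ℕ) : ℤ) - j) = Set.Ioi (n - r - j : ℤ) := by
      rw [Nat.cast_sub hr.le]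
    rw [hS] at h1
    have h2 := condExp_smul (μ := μ) t (projAt μ ε (W (n - r)) ((n - r : ℕ) - j))
      (sigmaOn ε (Set.Ioi (n - r - j : ℤ)))
    filter_upwards [h1, h2] with ω w1 w2
    refine Eq.trans w2 ?_
    rw [Pi.smul_apply, w1, Pi.zero_apply, smul_zero]

/-- On an event where the quadratic variation is at most `α²`, the exponential supermartingale
controls the exponential moment of the sum at the scale `α`. -/
theorem lintegral_exp_abs_sum_projAt_le [IsProbabilityMeasure μ] (hm : ∀ i, Measurable (ε i))
    {W η : ℕ → Ω → ℝ} {M : ℝ} (hb : ∀ i ω, |W i ω| ≤ M) {n j : ℕ}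
    (hη : ∀ i ∈ Finset.Icc 1 n, MemLp (η i) 2 μ)
    (hd : ∀ i ∈ Finset.Icc 1 n, ∀ᵐ ω ∂μ, |projAt μ ε (W i) (i - j) ω| ≤ η i ω) {α : ℝ}
    (hα : 0 < α) {B : Set Ω} (hB : MeasurableSet B)
    (hBα : ∀ ω ∈ B, quadVar μ ε η n j ω ≤ α ^ 2) :
    ∫⁻ ω in B, ENNReal.ofReal (Real.exp (|∑ i ∈ Finset.Icc 1 n, projAt μ ε (W i) (i - j) ω| / α)) ∂μ
      ≤ ENNReal.ofReal (2 * Real.exp 1) := by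
  set G : ℝ → Ω → ℝ := fun t ω => Real.exp (∑ i ∈ Finset.Icc 1 n, (t * projAt μ ε (W i) (i - j) ω
      - (t * projAt μ ε (W i) (i - j) ω) ^ 2
      - (μ[fun ω => (t * projAt μ ε (W i) (i - j) ω) ^ 2|sigmaOn ε (Set.Ioi (i - j : ℤ))]) ω))
    with hG
  have hGi : ∀ t, Integrable (G t) μ ∧ ∫ ω, G t ω ∂μ ≤ 1 := fun t =>
    integral_exp_sum_projAt_le hm hb n j t
  have hcond : ∀ t : ℝ, |t| = α⁻¹ → ∀ i ∈ Finset.Icc 1 n, ∀ᵐ ω ∂μ,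
      (t * projAt μ ε (W i) (i - j) ω) ^ 2
        + (μ[fun ω => (t * projAt μ ε (W i) (i - j) ω) ^ 2|sigmaOn ε (Set.Ioi (i - j : ℤ))]) ω
      ≤ (α ^ 2)⁻¹ * (η i ω ^ 2 + (μ[fun ω => η i ω ^ 2|sigmaOn ε (Set.Ioi (i - j : ℤ))]) ω) := by
    intro t ht i hi
    have hsq : ∀ᵐ ω ∂μ, (t * projAt μ ε (W i) (i - j) ω) ^ 2 ≤ (α ^ 2)⁻¹ * η i ω ^ 2 := by
      filter_upwards [hd i hi] with ω hω
      rw [mul_pow, ← sq_abs t, ht, ← inv_pow, ← sq_abs (projAt _ _ _ _ _)]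
      gcongr
    have h1 := condExp_mono (m := sigmaOn ε (Set.Ioi (i - j : ℤ)))
      (((memLp_projAt (μ := μ) (ε := ε) (hb i) (i - j)).const_mul t).integrable_sq)
      ((hη i hi).integrable_sq.const_mul (α ^ 2)⁻¹) hsq
    have h2 := condExp_smul (μ := μ) (α ^ 2)⁻¹ (fun ω => η i ω ^ 2)
      (sigmaOn ε (Set.Ioi (i - j : ℤ)))
    filter_upwards [hsq, h1, h2] with ω w1 w2 w3
    rw [mul_add]
    exact add_le_add w1 (w2.trans w3.le)
  have hexp : ∀ t : ℝ, |t| = α⁻¹ → ∀ᵐ ω ∂μ, ω ∈ B →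
      Real.exp (t * ∑ i ∈ Finset.Icc 1 n, projAt μ ε (W i) (i - j) ω) ≤ Real.exp 1 * G t ω := by
    intro t ht
    filter_upwards [(Finset.Icc 1 n).eventually_all.2 (hcond t ht)] with ω hω hωB
    rw [hG, ← Real.exp_add, Real.exp_le_exp, Finset.mul_sum]
    have h1 := Finset.sum_le_sum hω
    rw [← Finset.mul_sum] at h1
    have h2 : (α ^ 2)⁻¹ * quadVar μ ε η n j ω ≤ 1 := by
      rw [inv_mul_le_one₀ (by positivity)]
      exact hBα ω hωB
    have h3 := h1.trans h2
    rw [Finset.sum_add_distrib] at h3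
    simp only [Finset.sum_sub_distrib]
    linarith
  have hα1 : |α⁻¹| = α⁻¹ := abs_of_pos (by positivity)
  have hα2 : |-α⁻¹| = α⁻¹ := by rw [abs_neg, hα1]
  have hsum : Integrable (fun ω => Real.exp 1 * G α⁻¹ ω + Real.exp 1 * G (-α⁻¹) ω) μ :=
    ((hGi _).1.const_mul _).add ((hGi _).1.const_mul _)
  calc ∫⁻ ω in B, ENNReal.ofReal
        (Real.exp (|∑ i ∈ Finset.Icc 1 n, projAt μ ε (W i) (i - j) ω| / α)) ∂μ
      ≤ ∫⁻ ω in B, ENNReal.ofReal (Real.exp 1 * G α⁻¹ ω + Real.exp 1 * G (-α⁻¹) ω) ∂μ := by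
        refine setLIntegral_mono_ae' hB ?_
        filter_upwards [hexp _ hα1, hexp _ hα2] with ω w1 w2 hω
        refine ENNReal.ofReal_le_ofReal ?_
        have p1 : 0 < Real.exp 1 * G α⁻¹ ω := mul_pos (Real.exp_pos _) (Real.exp_pos _)
        have p2 : 0 < Real.exp 1 * G (-α⁻¹) ω := mul_pos (Real.exp_pos _) (Real.exp_pos _)
        have v1 := w1 hω
        have v2 := w2 hω
        rcases abs_cases (∑ i ∈ Finset.Icc 1 n, projAt μ ε (W i) (i - j) ω) with ⟨h, -⟩ | ⟨h, -⟩
        · rw [h, div_eq_inv_mul]; linarith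
        · rw [h, div_eq_inv_mul, mul_neg, ← neg_mul]; linarith
    _ ≤ ∫⁻ ω, ENNReal.ofReal (Real.exp 1 * G α⁻¹ ω + Real.exp 1 * G (-α⁻¹) ω) ∂μ :=
        setLIntegral_le_lintegral _ _
    _ = ENNReal.ofReal (∫ ω, (Real.exp 1 * G α⁻¹ ω + Real.exp 1 * G (-α⁻¹) ω) ∂μ) :=
        (ofReal_integral_eq_lintegral_ofReal hsum (Filter.Eventually.of_forall fun ω =>
          (add_pos (mul_pos (Real.exp_pos _) (Real.exp_pos _))
            (mul_pos (Real.exp_pos _) (Real.exp_pos _))).le)).symm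
    _ ≤ _ := by
        refine ENNReal.ofReal_le_ofReal ?_
        rw [integral_add ((hGi _).1.const_mul _) ((hGi _).1.const_mul _), integral_const_mul,
          integral_const_mul]
        have h1 := mul_le_mul_of_nonneg_left (hGi α⁻¹).2 (Real.exp_pos 1).le
        have h2 := mul_le_mul_of_nonneg_left (hGi (-α⁻¹)).2 (Real.exp_pos 1).le
        linarith

/-- The distances `j ≥ q` are combined by Jensen's inequality, with weights proportional to the
scales `α m` at which the single distances are controlled. No union bound is needed. -/
theorem lintegral_exp_abs_sum_sum_projAt_le [IsProbabilityMeasure μ] (hm : ∀ i, Measurable (ε i))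
    {W : ℕ → Ω → ℝ} {η : ℕ → ℕ → Ω → ℝ} {M : ℝ} (hb : ∀ i ω, |W i ω| ≤ M) {n q : ℕ}
    (hη : ∀ j, ∀ i ∈ Finset.Icc 1 n, MemLp (η j i) 2 μ)
    (hd : ∀ j : ℕ, ∀ i ∈ Finset.Icc 1 n, ∀ᵐ ω ∂μ, |projAt μ ε (W i) (i - j) ω| ≤ η j i ω)
    {α : ℕ → ℝ} {A : ℝ} (hα : ∀ m, 0 < α m) (hA : ∀ N, ∑ m ∈ Finset.range N, α m ≤ A)
    {B : Set Ω} (hB : MeasurableSet B)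
    (hBα : ∀ ω ∈ B, ∀ m, quadVar μ ε (η (q + m)) n (q + m) ω ≤ α m ^ 2) (N : ℕ) :
    ∫⁻ ω in B, ENNReal.ofReal (Real.exp (|∑ m ∈ Finset.range N, ∑ i ∈ Finset.Icc 1 n,
        projAt μ ε (W i) (i - (q + m : ℕ)) ω| / A)) ∂μ
      ≤ ENNReal.ofReal (1 + 2 * Real.exp 1) := by
  have hA0 : 0 < A := (hα 0).trans_le (by simpa using hA 1)
  set T : ℕ → Ω → ℝ := fun m ω => ∑ i ∈ Finset.Icc 1 n, projAt μ ε (W i) (i - (q + m : ℕ)) ω with hT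
  have hTm : ∀ m, Measurable (T m) := fun m => Finset.measurable_fun_sum _ fun i _ =>
    ((stronglyMeasurable_projAt (W i) _).mono (sigmaOn_le hm _)).measurable
  have hp : ∀ N, ∑ m ∈ Finset.range N, α m / A ≤ 1 := fun N => by
    rw [← Finset.sum_div, div_le_one hA0]; exact hA N
  have hexpm : ∀ m, Measurable fun ω =>
      ENNReal.ofReal (α m / A) * ENNReal.ofReal (Real.exp (|T m ω| / α m)) := fun m =>
    measurable_const.mul (Real.measurable_exp.comp ((hTm m).abs.div_const _)).ennreal_ofReal
  calc ∫⁻ ω in B, ENNReal.ofReal (Real.exp (|∑ m ∈ Finset.range N, T m ω| / A)) ∂μ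
      ≤ ∫⁻ ω in B, (1 + ∑ m ∈ Finset.range N,
          ENNReal.ofReal (α m / A) * ENNReal.ofReal (Real.exp (|T m ω| / α m))) ∂μ := by
        refine lintegral_mono fun ω => ?_
        have h1 := exp_sum_mul_le (Finset.range N) (p := fun m => α m / A)
          (y := fun m => |T m ω| / α m) (fun m _ => (div_pos (hα m) hA0).le) (hp N)
        have h2 : |∑ m ∈ Finset.range N, T m ω| / A
            ≤ ∑ m ∈ Finset.range N, α m / A * (|T m ω| / α m) := by
          refine (div_le_div_of_nonneg_right (Finset.abs_sum_le_sum_abs _ _) hA0.le).trans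
            (le_of_eq ?_)
          rw [Finset.sum_div]
          refine Finset.sum_congr rfl fun m _ => ?_
          have := (hα m).ne'
          field_simp
        refine (ENNReal.ofReal_le_ofReal ((Real.exp_le_exp.2 h2).trans h1)).trans (le_of_eq ?_)
        have hnn : ∀ m ∈ Finset.range N, 0 ≤ α m / A * Real.exp (|T m ω| / α m) := fun m _ =>
          mul_nonneg (div_pos (hα m) hA0).le (Real.exp_pos _).le
        rw [ENNReal.ofReal_add zero_le_one (Finset.sum_nonneg hnn), ENNReal.ofReal_one,
          ENNReal.ofReal_sum_of_nonneg hnn]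
        congr 1
        exact Finset.sum_congr rfl fun m _ => ENNReal.ofReal_mul (div_pos (hα m) hA0).le
    _ = μ B + ∑ m ∈ Finset.range N, ENNReal.ofReal (α m / A)
          * ∫⁻ ω in B, ENNReal.ofReal (Real.exp (|T m ω| / α m)) ∂μ := by
        rw [lintegral_add_left measurable_const, lintegral_finsetSum _ fun m _ => hexpm m,
          setLIntegral_const, one_mul]
        congr 1
        refine Finset.sum_congr rfl fun m _ => ?_
        exact lintegral_const_mul _
          (Real.measurable_exp.comp ((hTm m).abs.div_const _)).ennreal_ofReal
    _ ≤ 1 + ∑ m ∈ Finset.range N, ENNReal.ofReal (α m / A) * ENNReal.ofReal (2 * Real.exp 1) := by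
        refine add_le_add prob_le_one (Finset.sum_le_sum fun m _ => mul_le_mul_right ?_ _)
        exact lintegral_exp_abs_sum_projAt_le hm hb (hη (q + m)) (hd (q + m)) (hα m) hB
          fun ω hω => hBα ω hω m
    _ ≤ 1 + ENNReal.ofReal (2 * Real.exp 1) := by
        gcongr
        rw [← Finset.sum_mul, ← ENNReal.ofReal_sum_of_nonneg fun m _ => (div_pos (hα m) hA0).le]
        refine mul_le_of_le_one_left zero_le ?_
        exact ENNReal.ofReal_le_one.2 (hp N)
    _ = _ := by
        rw [ENNReal.ofReal_add zero_le_one (by positivity), ENNReal.ofReal_one]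

/-- The exponential Markov inequality for the projections at all distances `j ≥ q`. These are
infinitely many, and Fatou's lemma passes from finitely many to all of them. -/
theorem measure_longMemory_le [IsProbabilityMeasure μ] (hm : ∀ i, Measurable (ε i))
    (h : iIndepFun ε μ) {W : ℕ → Ω → ℝ} {η : ℕ → ℕ → Ω → ℝ} {M : ℝ} (hb : ∀ i ω, |W i ω| ≤ M)
    (hW : ∀ i : ℕ, StronglyMeasurable[sigmaOn ε (Set.Iic (i : ℤ))] (W i)) {n q : ℕ}
    (hη : ∀ j, ∀ i ∈ Finset.Icc 1 n, MemLp (η j i) 2 μ)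
    (hd : ∀ j : ℕ, ∀ i ∈ Finset.Icc 1 n, ∀ᵐ ω ∂μ, |projAt μ ε (W i) (i - j) ω| ≤ η j i ω)
    {α : ℕ → ℝ} {A : ℝ} (hα : ∀ m, 0 < α m) (hA : ∀ N, ∑ m ∈ Finset.range N, α m ≤ A)
    {B : Set Ω} (hB : MeasurableSet B)
    (hBα : ∀ ω ∈ B, ∀ m, quadVar μ ε (η (q + m)) n (q + m) ω ≤ α m ^ 2) {a : ℝ} :
    μ ({ω | a < |∑ i ∈ Finset.Icc 1 n, (W i ω - ∫ ω, W i ω ∂μ - shortMemory μ ε W q i ω)|} ∩ B)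
      ≤ ENNReal.ofReal ((1 + 2 * Real.exp 1) * Real.exp (-(a / A))) := by
  have hA0 : 0 < A := (hα 0).trans_le (by simpa using hA 1)
  have hWm : ∀ i, Measurable (W i) := fun i => ((hW i).mono (sigmaOn_le hm _)).measurable
  set T : Ω → ℝ := fun ω =>
    ∑ i ∈ Finset.Icc 1 n, (W i ω - ∫ ω, W i ω ∂μ - shortMemory μ ε W q i ω) with hT
  set P : ℕ → Ω → ℝ := fun N ω => ∑ m ∈ Finset.range N, ∑ i ∈ Finset.Icc 1 n,
        projAt μ ε (W i) (i - (q + m : ℕ)) ω with hP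
  have hPm : ∀ N, Measurable (P N) := fun N => Finset.measurable_fun_sum _ fun m _ =>
    Finset.measurable_fun_sum _ fun i _ =>
      ((stronglyMeasurable_projAt (W i) _).mono (sigmaOn_le hm _)).measurable
  have hTm : Measurable T := Finset.measurable_fun_sum _ fun i _ =>
    ((hWm i).sub measurable_const).sub
      ((stronglyMeasurable_shortMemory W q i).mono (sigmaOn_le hm _)).measurable
  have hlim : ∀ᵐ ω ∂μ, Filter.Tendsto (fun N => P N ω) Filter.atTop (nhds (T ω)) := by
    have h1 : ∀ i, ∀ᵐ ω ∂μ, Filter.Tendsto (fun q => ∑ j ∈ Finset.range q,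
        projAt μ ε (W i) ((i : ℕ) - j) ω) Filter.atTop (nhds (W i ω - ∫ ω, W i ω ∂μ)) := fun i =>
      tendsto_sum_projAt hm h (Integrable.of_bound (hWm i).aestronglyMeasurable M
        (Filter.Eventually.of_forall (hb i))) (hW i)
    filter_upwards [ae_all_iff.2 h1, ae_all_iff.2 fun i => shortMemory_ae_eq hm h hb hW q i]
      with ω w1 w2
    simp only [hP, hT]
    simp_rw [Finset.sum_comm (s := Finset.range _)]
    refine tendsto_finsetSum _ fun i _ => ?_
    rw [w2 i]
    have h3 := ((w1 i).comp (Filter.tendsto_add_atTop_nat q)).sub_const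
      (∑ j ∈ Finset.range q, projAt μ ε (W i) (i - j) ω)
    refine h3.congr fun N => ?_
    simp only [Function.comp_apply]
    rw [add_comm N q, Finset.sum_range_add, add_sub_cancel_left]
  have hF : ∫⁻ ω in B, ENNReal.ofReal (Real.exp (|T ω| / A)) ∂μ
      ≤ ENNReal.ofReal (1 + 2 * Real.exp 1) := by
    calc ∫⁻ ω in B, ENNReal.ofReal (Real.exp (|T ω| / A)) ∂μ
        = ∫⁻ ω in B, Filter.liminf
            (fun N => ENNReal.ofReal (Real.exp (|P N ω| / A))) Filter.atTop ∂μ := by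
          refine lintegral_congr_ae (ae_restrict_of_ae ?_)
          filter_upwards [hlim] with ω hω
          have hc : Continuous fun x : ℝ => ENNReal.ofReal (Real.exp (|x| / A)) :=
            ENNReal.continuous_ofReal.comp (by fun_prop)
          exact ((hc.tendsto _).comp hω).liminf_eq.symm
      _ ≤ Filter.liminf (fun N => ∫⁻ ω in B, ENNReal.ofReal (Real.exp (|P N ω| / A)) ∂μ)
            Filter.atTop := by
          refine lintegral_liminf_le fun N => ?_
          exact (Real.measurable_exp.comp ((hPm N).abs.div_const _)).ennreal_ofReal
      _ ≤ Filter.liminf (fun _ : ℕ => ENNReal.ofReal (1 + 2 * Real.exp 1)) Filter.atTop :=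
          Filter.liminf_le_liminf (Filter.Eventually.of_forall fun N =>
            lintegral_exp_abs_sum_sum_projAt_le hm hb hη hd hα hA hB hBα N)
      _ = _ := Filter.liminf_const _
  have hmk := mul_meas_ge_le_lintegral₀ (μ := μ.restrict B)
    (f := fun ω => ENNReal.ofReal (Real.exp (|T ω| / A)))
    (Real.measurable_exp.comp (hTm.abs.div_const _)).ennreal_ofReal.aemeasurable
    (ENNReal.ofReal (Real.exp (a / A)))
  have hsub : μ ({ω | a < |T ω|} ∩ B) ≤ μ.restrict B
      {ω | ENNReal.ofReal (Real.exp (a / A)) ≤ ENNReal.ofReal (Real.exp (|T ω| / A))} := by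
    rw [Measure.restrict_apply' hB]
    refine measure_mono (Set.inter_subset_inter_left _ fun ω hω => ?_)
    have hω' : a < |T ω| := hω
    exact ENNReal.ofReal_le_ofReal (Real.exp_le_exp.2 (by gcongr))
  have hpos : ENNReal.ofReal (Real.exp (a / A)) ≠ 0 := by
    simpa using Real.exp_pos (a / A)
  have hfin := (mul_le_mul_right hsub (ENNReal.ofReal (Real.exp (a / A)))).trans (hmk.trans hF)
  rw [Real.exp_neg, ← div_eq_mul_inv, ENNReal.ofReal_div_of_pos (Real.exp_pos _),
    ENNReal.le_div_iff_mul_le (Or.inl hpos) (Or.inl ENNReal.ofReal_ne_top), mul_comm]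
  exact hfin

end FunctionalDependence

namespace FunctionalDependence

/-! ### The scales at which the distances `j ≥ q` are controlled -/

/-- The summable weight `1 / ((m + 1) log(e (m + 1))^{3/2})`. -/
noncomputable def scaleWeight (m : ℕ) : ℝ :=
  1 / (((m + 1 : ℕ) : ℝ) * Real.log (Real.exp 1 * (m + 1 : ℕ)) ^ (3 / 2 : ℝ))

theorem one_le_log_exp_one_mul {k : ℕ} (hk : 1 ≤ k) : 1 ≤ Real.log (Real.exp 1 * k) := by
  have hk' : (1 : ℝ) ≤ k := by exact_mod_cast hk
  rw [Real.le_log_iff_exp_le (by positivity)]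
  exact le_mul_of_one_le_right (Real.exp_pos _).le hk'

theorem log_exp_one_mul_mono {k l : ℕ} (hk : 1 ≤ k) (hkl : k ≤ l) :
    Real.log (Real.exp 1 * k) ≤ Real.log (Real.exp 1 * l) := by
  have hk' : (1 : ℝ) ≤ k := by exact_mod_cast hk
  have hkl' : (k : ℝ) ≤ l := by exact_mod_cast hkl
  exact Real.log_le_log (by positivity) (by gcongr)

theorem scaleWeight_pos (m : ℕ) : 0 < scaleWeight m := by
  have := one_le_log_exp_one_mul (k := m + 1) (by omega)
  unfold scaleWeight
  positivity

/-- Cauchy condensation compares the weights with `k^{-3/2}`. -/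
theorem summable_scaleWeight : Summable scaleWeight := by
  set f : ℕ → ℝ := fun k => 1 / ((k : ℝ) * Real.log (Real.exp 1 * k) ^ (3 / 2 : ℝ)) with hf
  suffices h : Summable f from (summable_nat_add_iff 1).2 h
  have hnn : ∀ k, 0 ≤ f k := by
    intro k
    rcases Nat.eq_zero_or_pos k with rfl | hk
    · simp [hf]
    · have := one_le_log_exp_one_mul hk
      positivity
  refine (summable_condensed_iff_of_nonneg hnn ?_).1 ?_
  · intro m k hm hmk
    have h1 := one_le_log_exp_one_mul hm
    have h2 := log_exp_one_mul_mono hm hmk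
    have hm' : (0 : ℝ) < m := by exact_mod_cast hm
    simp only [hf]
    gcongr
  · have hs : Summable fun k : ℕ => (4 : ℝ) * (1 / ((k + 1 : ℕ) : ℝ) ^ (3 / 2 : ℝ)) :=
      ((summable_nat_add_iff 1).2
        ((Real.summable_one_div_nat_rpow (p := 3 / 2)).2 (by norm_num))).mul_left 4
    refine Summable.of_nonneg_of_le (fun k => mul_nonneg (by positivity) (hnn _)) (fun k => ?_) hs
    have hlog : ((k + 1 : ℕ) : ℝ) / 2 ≤ Real.log (Real.exp 1 * (2 ^ k : ℕ)) := by
      push_cast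
      rw [Real.log_mul (Real.exp_pos _).ne' (by positivity), Real.log_exp, Real.log_pow]
      have := Real.log_two_gt_d9
      nlinarith [Nat.cast_nonneg (α := ℝ) k]
    have h4 : (2 : ℝ) ^ (3 / 2 : ℝ) ≤ 4 := by
      calc (2 : ℝ) ^ (3 / 2 : ℝ) ≤ 2 ^ (2 : ℝ) :=
            Real.rpow_le_rpow_of_exponent_le (by norm_num) (by norm_num)
        _ = 4 := by norm_num
    have hk0 : (0 : ℝ) < (k + 1 : ℕ) := by positivity
    have hp : (((k + 1 : ℕ) : ℝ) / 2) ^ (3 / 2 : ℝ)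
        ≤ Real.log (Real.exp 1 * (2 ^ k : ℕ)) ^ (3 / 2 : ℝ) :=
      Real.rpow_le_rpow (by positivity) hlog (by norm_num)
    rw [Real.div_rpow hk0.le (by norm_num)] at hp
    have hK : 0 < ((k + 1 : ℕ) : ℝ) ^ (3 / 2 : ℝ) := by positivity
    simp only [hf]
    push_cast at hp ⊢
    push_cast at hK
    have h2k : (0 : ℝ) < 2 ^ k := by positivity
    have hlp : 0 < Real.log (Real.exp 1 * 2 ^ k) ^ (3 / 2 : ℝ) :=
      lt_of_lt_of_le (by positivity) hp
    rw [mul_one_div, mul_one_div, div_le_div_iff₀ (by positivity) hK, mul_comm]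
    rw [div_le_iff₀ (by positivity)] at hp
    calc _ ≤ Real.log (Real.exp 1 * 2 ^ k) ^ (3 / 2 : ℝ) * 2 ^ (3 / 2 : ℝ) * 2 ^ k := by gcongr
      _ ≤ Real.log (Real.exp 1 * 2 ^ k) ^ (3 / 2 : ℝ) * 4 * 2 ^ k := by gcongr
      _ = _ := by ring

/-- For a decreasing sequence, half of the terms up to `m` are comparable with the `m`-th one, so
that a single term is bounded by the sum with a gain of the factor `m`. -/
theorem antitone_div_scaleWeight_le {δ : ℕ → ℝ} (hδ : Antitone δ) (hδ0 : ∀ m, 0 ≤ δ m) {ν S : ℝ}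
    (hν : 2 ≤ ν) (hS : ∀ N, ∑ m ∈ Finset.range N, δ m * omegaWeight ν (m + 1) ≤ S) (m : ℕ) :
    δ m / scaleWeight m * ((m + 1 : ℕ) : ℝ) ^ (1 / ν) ≤ 16 * S := by
  have hlog1 := one_le_log_exp_one_mul (k := m + 1) (by omega)
  set K : ℝ := ((m + 1 : ℕ) : ℝ) with hK
  set l : ℝ := Real.log (Real.exp 1 * K) with hl
  have hK0 : 0 < K := by positivity
  have hterm : ∀ k ∈ Finset.Ico (m / 2) (m + 1),
      δ m * (K ^ (1 / ν) / 2 * (l ^ (3 / 2 : ℝ) / 4)) ≤ δ k * omegaWeight ν (k + 1) := by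
    intro k hk
    obtain ⟨hk1, hk2⟩ := Finset.mem_Ico.1 hk
    have hKk : K / 2 ≤ ((k + 1 : ℕ) : ℝ) := by
      rw [div_le_iff₀ two_pos, hK]
      exact_mod_cast (by omega : m + 1 ≤ (k + 1) * 2)
    have hk1' : (1 : ℝ) ≤ ((k + 1 : ℕ) : ℝ) := by exact_mod_cast (by omega : 1 ≤ k + 1)
    refine mul_le_mul (hδ (by omega)) ?_ (by positivity) (hδ0 k)
    unfold omegaWeight
    have e1 : K ^ (1 / ν) / 2 ≤ ((k + 1 : ℕ) : ℝ) ^ (1 / ν) := by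
      have h2 : (2 : ℝ) ^ (1 / ν) ≤ 2 := by
        calc (2 : ℝ) ^ (1 / ν) ≤ 2 ^ (1 : ℝ) := by
              refine Real.rpow_le_rpow_of_exponent_le (by norm_num) ?_
              rw [div_le_one (by linarith)]; linarith
          _ = 2 := Real.rpow_one 2
      calc K ^ (1 / ν) / 2 ≤ K ^ (1 / ν) / 2 ^ (1 / ν) := by gcongr
        _ = (K / 2) ^ (1 / ν) := (Real.div_rpow hK0.le (by norm_num) _).symm
        _ ≤ _ := Real.rpow_le_rpow (by positivity) hKk (by positivity)
    have e2 : l ^ (3 / 2 : ℝ) / 4 ≤ Real.log (Real.exp 1 * (k + 1 : ℕ)) ^ (3 / 2 : ℝ) := by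
      have hexp : (2 : ℝ) ≤ Real.exp 1 := by have := Real.exp_one_gt_d9; linarith
      have h1 : l / 2 ≤ Real.log (Real.exp 1 * (k + 1 : ℕ)) := by
        have h3 : l ≤ Real.log ((Real.exp 1 * (k + 1 : ℕ)) ^ 2) := by
          refine Real.log_le_log (by positivity) ?_
          have h4 : K ≤ Real.exp 1 * ((k + 1 : ℕ) : ℝ) ^ 2 := by
            nlinarith [sq_nonneg ((k + 1 : ℕ) : ℝ)]
          rw [mul_pow]
          nlinarith [Real.exp_pos 1]
        rw [Real.log_pow] at h3
        push_cast at h3 ⊢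
        linarith
      have h4 : (2 : ℝ) ^ (3 / 2 : ℝ) ≤ 4 := by
        calc (2 : ℝ) ^ (3 / 2 : ℝ) ≤ 2 ^ (2 : ℝ) :=
              Real.rpow_le_rpow_of_exponent_le (by norm_num) (by norm_num)
          _ = 4 := by norm_num
      calc l ^ (3 / 2 : ℝ) / 4 ≤ l ^ (3 / 2 : ℝ) / 2 ^ (3 / 2 : ℝ) := by gcongr
        _ = (l / 2) ^ (3 / 2 : ℝ) := (Real.div_rpow (by linarith) (by norm_num) _).symm
        _ ≤ _ := Real.rpow_le_rpow (by linarith) h1 (by norm_num)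
    exact mul_le_mul e1 e2 (by positivity) (by positivity)
  have hsum := Finset.card_nsmul_le_sum _ _ _ hterm
  have hsub : ∑ k ∈ Finset.Ico (m / 2) (m + 1), δ k * omegaWeight ν (k + 1) ≤ S := by
    refine le_trans (Finset.sum_le_sum_of_subset_of_nonneg (fun k hk => ?_) fun k _ _ => ?_)
      (hS (m + 1))
    · exact Finset.mem_range.2 (Finset.mem_Ico.1 hk).2
    · have := one_le_log_exp_one_mul (k := k + 1) (by omega)
      refine mul_nonneg (hδ0 k) (mul_nonneg (by positivity) (by positivity))
  rw [Nat.card_Ico, nsmul_eq_mul] at hsum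
  have hcard : K / 2 ≤ ((m + 1 - m / 2 : ℕ) : ℝ) := by
    rw [div_le_iff₀ two_pos, hK]
    exact_mod_cast (by omega : m + 1 ≤ (m + 1 - m / 2) * 2)
  have hnn : 0 ≤ δ m * (K ^ (1 / ν) / 2 * (l ^ (3 / 2 : ℝ) / 4)) :=
    mul_nonneg (hδ0 m) (by positivity)
  have h5 := (mul_le_mul_of_nonneg_right hcard hnn).trans (hsum.trans hsub)
  have h6 : δ m / scaleWeight m * K ^ (1 / ν)
      = 16 * (K / 2 * (δ m * (K ^ (1 / ν) / 2 * (l ^ (3 / 2 : ℝ) / 4)))) := by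
    unfold scaleWeight
    rw [div_div_eq_mul_div, div_one]
    ring
  rw [h6]
  linarith

/-- One factor `δ m / scaleWeight m` is kept to be summed, and the other `ν - 1` factors are
bounded by `antitone_div_scaleWeight_le`; the powers of `m + 1` combine to the weight
`m^{1/ν} log(e m)^{3/2}`. -/
theorem sum_div_scaleWeight_rpow_le {δ : ℕ → ℝ} (hδ : Antitone δ) (hδ0 : ∀ m, 0 ≤ δ m) {ν S : ℝ}
    (hν : 2 ≤ ν) (hS : ∀ N, ∑ m ∈ Finset.range N, δ m * omegaWeight ν (m + 1) ≤ S) (N : ℕ) :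
    ∑ m ∈ Finset.range N, (δ m / scaleWeight m) ^ ν ≤ (16 * S) ^ ν := by
  have hS0 : 0 ≤ S := by simpa using hS 0
  have hterm : ∀ m, (δ m / scaleWeight m) ^ ν
      ≤ (16 * S) ^ (ν - 1) * (δ m * omegaWeight ν (m + 1)) := by
    intro m
    have h := antitone_div_scaleWeight_le hδ hδ0 hν hS m
    set K : ℝ := ((m + 1 : ℕ) : ℝ) with hK
    have hK0 : 0 < K := by positivity
    set x : ℝ := δ m / scaleWeight m with hx
    have hx0 : 0 ≤ x := div_nonneg (hδ0 m) (scaleWeight_pos m).le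
    have hω : x * K ^ (1 / ν - 1) = δ m * omegaWeight ν (m + 1) := by
      rw [hx, scaleWeight, omegaWeight, div_div_eq_mul_div, div_one, ← hK,
        Real.rpow_sub_one hK0.ne']
      field_simp
    have h1 : x ^ (ν - 1) ≤ (16 * S) ^ (ν - 1) * K ^ (1 / ν - 1) := by
      have h2 : x ≤ 16 * S * K ^ (-(1 / ν)) := by
        rw [Real.rpow_neg hK0.le, ← div_eq_mul_inv, le_div_iff₀ (by positivity)]
        exact h
      calc x ^ (ν - 1) ≤ (16 * S * K ^ (-(1 / ν))) ^ (ν - 1) :=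
            Real.rpow_le_rpow hx0 h2 (by linarith)
        _ = _ := by
            rw [Real.mul_rpow (by positivity) (by positivity), ← Real.rpow_mul hK0.le]
            congr 2
            field_simp
            ring
    calc x ^ ν = x ^ (ν - 1) * x := by
          rw [← Real.rpow_add_one' hx0 (by linarith), sub_add_cancel]
      _ ≤ (16 * S) ^ (ν - 1) * K ^ (1 / ν - 1) * x := by gcongr
      _ = _ := by rw [← hω]; ring
  calc ∑ m ∈ Finset.range N, (δ m / scaleWeight m) ^ ν
      ≤ ∑ m ∈ Finset.range N, (16 * S) ^ (ν - 1) * (δ m * omegaWeight ν (m + 1)) :=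
        Finset.sum_le_sum fun m _ => hterm m
    _ ≤ (16 * S) ^ (ν - 1) * (16 * S) := by
        rw [← Finset.mul_sum]
        have := hS N
        gcongr
        linarith
    _ = _ := by rw [← Real.rpow_add_one' (by positivity) (by linarith), sub_add_cancel]

/-! ### The probability that the quadratic variation is large -/

variable {Ω : Type*} {m0 : MeasurableSpace Ω} {μ : Measure Ω} {e : ℕ}
  {ε : ℤ → Ω → (Fin e → ℝ)}

theorem eLpNorm_sq_eq {f : Ω → ℝ} {ν : ℝ} (hν : 0 ≤ ν) :
    eLpNorm (fun ω => f ω ^ 2) (ENNReal.ofReal (ν / 2)) μ = eLpNorm f (ENNReal.ofReal ν) μ ^ 2 := by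
  have h := eLpNorm_norm_rpow (μ := μ) (p := ENNReal.ofReal (ν / 2)) f (q := 2) two_pos
  rw [← ENNReal.ofReal_mul (by linarith), div_mul_cancel₀ ν two_ne_zero] at h
  simpa using h

/-- Markov's inequality for the moment of order `ν / 2` of the quadratic variation. -/
theorem measure_lt_quadVar_le [IsProbabilityMeasure μ] (hm : ∀ i, Measurable (ε i))
    {η : ℕ → Ω → ℝ} (hηm : ∀ i, Measurable (η i)) {n j : ℕ} {ν : ℝ} (hν : 2 ≤ ν) {c : ℕ → ℝ}
    (hc : ∀ i, 0 ≤ c i)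
    (hη : ∀ i ∈ Finset.Icc 1 n, eLpNorm (η i) (ENNReal.ofReal ν) μ ≤ ENNReal.ofReal (c i))
    {C : ℝ} (hC : ∑ i ∈ Finset.Icc 1 n, c i ^ 2 ≤ C) {α : ℝ} (hα : 0 < α) :
    μ {ω | α ^ 2 < quadVar μ ε η n j ω} ≤ ENNReal.ofReal ((2 * C / α ^ 2) ^ (ν / 2)) := by
  have hC0 : 0 ≤ C := (Finset.sum_nonneg fun i _ => sq_nonneg _).trans hC
  have hν1 : 1 ≤ ENNReal.ofReal (ν / 2) := by
    rw [← ENNReal.ofReal_one]; exact ENNReal.ofReal_le_ofReal (by linarith)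
  have hm1 : ∀ i, AEStronglyMeasurable (fun ω => η i ω ^ 2) μ := fun i =>
    ((hηm i).pow_const 2).aestronglyMeasurable
  have hm2 : ∀ i : ℕ, AEStronglyMeasurable
      (μ[fun ω => η i ω ^ 2|sigmaOn ε (Set.Ioi (i - j : ℤ))]) μ := fun i =>
    integrable_condExp.aestronglyMeasurable
  have hnorm : eLpNorm (quadVar μ ε η n j) (ENNReal.ofReal (ν / 2)) μ ≤ ENNReal.ofReal (2 * C) := by
    have hfun : quadVar μ ε η n j = ∑ i ∈ Finset.Icc 1 n, ((fun ω => η i ω ^ 2)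
        + μ[fun ω => η i ω ^ 2|sigmaOn ε (Set.Ioi (i - j : ℤ))]) := by
      funext ω; simp [quadVar, Finset.sum_apply]
    rw [hfun]
    refine (eLpNorm_sum_le (fun i _ => (hm1 i).add (hm2 i)) hν1).trans ?_
    calc _ ≤ ∑ i ∈ Finset.Icc 1 n, ENNReal.ofReal (2 * c i ^ 2) := by
          refine Finset.sum_le_sum fun i hi => ?_
          refine (eLpNorm_add_le (hm1 i) (hm2 i) hν1).trans ?_
          refine (add_le_add le_rfl (eLpNorm_condExp_le_eLpNorm _ hν1)).trans ?_
          rw [← two_mul, eLpNorm_sq_eq (by linarith), ENNReal.ofReal_mul two_pos.le,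
            ENNReal.ofReal_pow (hc i)]
          gcongr
          · simp
          · exact hη i hi
      _ = ENNReal.ofReal (2 * ∑ i ∈ Finset.Icc 1 n, c i ^ 2) := by
          rw [Finset.mul_sum, ENNReal.ofReal_sum_of_nonneg fun i _ => by positivity]
      _ ≤ _ := ENNReal.ofReal_le_ofReal (by linarith)
  have hα2 : ENNReal.ofReal (α ^ 2) ≠ 0 := by
    simpa using hα.ne'
  have hmk := meas_ge_le_mul_pow_eLpNorm_enorm μ (p := ENNReal.ofReal (ν / 2))
    (zero_lt_one.trans_le hν1).ne' ENNReal.ofReal_ne_top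
    (measurable_quadVar (μ := μ) hm hηm n j).aestronglyMeasurable hα2
    (fun h => absurd h ENNReal.ofReal_ne_top)
  rw [ENNReal.toReal_ofReal (by linarith)] at hmk
  refine le_trans (measure_mono fun ω hω => ?_) (hmk.trans ?_)
  · have hω' : α ^ 2 < quadVar μ ε η n j ω := hω
    change ENNReal.ofReal (α ^ 2) ≤ ‖quadVar μ ε η n j ω‖ₑ
    rw [Real.enorm_eq_ofReal_abs]
    exact ENNReal.ofReal_le_ofReal (hω'.le.trans (le_abs_self _))
  · rw [← ENNReal.mul_rpow_of_nonneg _ _ (by linarith), mul_comm, ← div_eq_mul_inv,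
      ← ENNReal.ofReal_rpow_of_nonneg (by positivity) (by linarith),
      ENNReal.ofReal_div_of_pos (x := 2 * C) (by positivity)]
    exact ENNReal.rpow_le_rpow (ENNReal.div_le_div_right hnorm _) (by linarith)

end FunctionalDependence

namespace FunctionalDependence

/-! ### The exceptional events -/

variable {Ω : Type*} {m0 : MeasurableSpace Ω} {μ : Measure Ω} {e d : ℕ}
  {ε ε' : ℤ → Ω → (Fin e → ℝ)} {J : ℤ → (ℕ → (Fin e → ℝ)) → (Fin d → ℝ)}
  {L : ℕ → ℝ} {s : ℝ} {R : PathFun d} {CR Cf CX ν : ℝ} {p : ℝ≥0∞} {Δ : ℕ → ℝ} {n : ℕ}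
  {F : Set (PathFun d)} {D : PathFun d → unitInterval → ℝ} {fbar : PathFun d → PathFun d}
  {Dn Dinf M : ℝ}

/-- The envelope `D_n^∞(i/n) = sup_{f ∈ F} |D_f(i/n)|` as a real number. -/
noncomputable def envelopeAt (n : ℕ) (F : Set (PathFun d)) (D : PathFun d → unitInterval → ℝ)
    (i : ℕ) : ℝ :=
  (⨆ f ∈ F, ‖D f (gridPoint n i)‖ₑ).toReal

/-- A bound on the projections of `f(Z_i, i/n)` onto the innovation at time `i - j`, valid for
all `f ∈ F`. -/
noncomputable def uniformBound (μ : Measure Ω) (J : ℤ → (ℕ → (Fin e → ℝ)) → (Fin d → ℝ))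
    (ε ε' : ℤ → Ω → (Fin e → ℝ)) (L : ℕ → ℝ) (s : ℝ) (R : PathFun d) (n : ℕ)
    (F : Set (PathFun d)) (D : PathFun d → unitInterval → ℝ) (j i : ℕ) (ω : Ω) : ℝ :=
  envelopeAt n F D i *
    (μ[couplingBound J ε ε' L s R i j (gridPoint n i)|sigmaOn ε (Set.Ici (i - j : ℤ))]) ω

/-- The event on which, for every distance `j ≥ q`, the quadratic variation of the uniform bound
is at most the square of its scale. The scales add up to a multiple of `M Φ(q)`; the factor `32`
compensates the constant `16` in `sum_div_scaleWeight_rpow_le` and the factor `2` in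
`measure_lt_quadVar_le`. No member of `F` enters alone, only the envelope of the class. -/
def goodEvent (μ : Measure Ω) (J : ℤ → (ℕ → (Fin e → ℝ)) → (Fin d → ℝ))
    (ε ε' : ℤ → Ω → (Fin e → ℝ)) (L : ℕ → ℝ) (s : ℝ) (R : PathFun d) (n : ℕ)
    (F : Set (PathFun d)) (D : PathFun d → unitInterval → ℝ) (M : ℝ) (q : ℕ) : Set Ω :=
  ⋂ m : ℕ, {ω | quadVar μ ε (uniformBound μ J ε ε' L s R n F D (q + m)) n (q + m) ω
    ≤ (32 * (M * Phi q) * scaleWeight m) ^ 2}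

theorem Phi_pos {q : ℕ} (hq : 1 ≤ q) : 0 < Phi q :=
  mul_pos (by exact_mod_cast hq) (zero_lt_one.trans_le (one_le_iterLog hq))

theorem one_le_omegaWeight (hν : 0 ≤ ν) {q : ℕ} (hq : 1 ≤ q) : 1 ≤ omegaWeight ν q :=
  one_le_mul_of_one_le_of_one_le
    (Real.one_le_rpow (by exact_mod_cast hq) (by positivity))
    (Real.one_le_rpow (one_le_log_exp_one_mul hq) (by norm_num))

theorem omegaWeight_mono (hν : 0 ≤ ν) {k l : ℕ} (hk : 1 ≤ k) (hkl : k ≤ l) :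
    omegaWeight ν k ≤ omegaWeight ν l := by
  have h1 := one_le_log_exp_one_mul hk
  have h2 := log_exp_one_mul_mono hk hkl
  unfold omegaWeight
  gcongr

theorem sum_envelopeAt_sq_le (hn : 1 ≤ n) (hDinf : 0 ≤ Dinf)
    (h : envelopeNorm n F D ≤ ENNReal.ofReal Dinf) :
    (∀ i ∈ Finset.Icc 1 n, ∀ f ∈ F, |D f (gridPoint n i)| ≤ envelopeAt n F D i) ∧
      ∑ i ∈ Finset.Icc 1 n, envelopeAt n F D i ^ 2 ≤ n * Dinf ^ 2 := by
  have hn0 : (n : ℝ≥0∞) ≠ 0 := by exact_mod_cast (by omega : n ≠ 0)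
  have h1 : ∑ i ∈ Finset.Icc 1 n, (⨆ f ∈ F, ‖D f (gridPoint n i)‖ₑ) ^ 2
      ≤ ENNReal.ofReal (n * Dinf ^ 2) := by
    have h2 := ENNReal.rpow_le_rpow h (z := 2) zero_le_two
    unfold envelopeNorm at h2
    rw [← ENNReal.rpow_mul, ENNReal.ofReal_rpow_of_nonneg hDinf zero_le_two] at h2
    norm_num at h2
    rw [ENNReal.inv_mul_le_iff hn0 (ENNReal.natCast_ne_top n)] at h2
    rwa [ENNReal.ofReal_mul (Nat.cast_nonneg n), ENNReal.ofReal_natCast]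
  have hfin : ∀ i ∈ Finset.Icc 1 n, (⨆ f ∈ F, ‖D f (gridPoint n i)‖ₑ) ≠ ∞ := by
    intro i hi htop
    have h3 := (Finset.single_le_sum (f := fun i => (⨆ f ∈ F, ‖D f (gridPoint n i)‖ₑ) ^ 2)
      (fun _ _ => zero_le) hi).trans h1
    rw [htop, ENNReal.top_pow two_ne_zero, top_le_iff] at h3
    exact ENNReal.ofReal_ne_top h3
  constructor
  · intro i hi f hf
    have h4 : ‖D f (gridPoint n i)‖ₑ ≤ ⨆ f ∈ F, ‖D f (gridPoint n i)‖ₑ :=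
      le_iSup₂ (f := fun f (_ : f ∈ F) => ‖D f (gridPoint n i)‖ₑ) f hf
    have h5 := ENNReal.toReal_mono (hfin i hi) h4
    rwa [Real.enorm_eq_ofReal_abs, ENNReal.toReal_ofReal (abs_nonneg _)] at h5
  · rw [← ENNReal.ofReal_le_ofReal_iff (by positivity),
      ENNReal.ofReal_sum_of_nonneg fun i _ => sq_nonneg _]
    refine le_trans (le_of_eq (Finset.sum_congr rfl fun i hi => ?_)) h1
    rw [envelopeAt, ENNReal.ofReal_pow ENNReal.toReal_nonneg, ENNReal.ofReal_toReal (hfin i hi)]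

theorem measurable_uniformBound (hε : IsInnovation μ ε ε') (j i : ℕ) :
    Measurable (uniformBound μ J ε ε' L s R n F D j i) :=
  measurable_const.mul (stronglyMeasurable_condExp.mono (sigmaOn_le hε.measurable _)).measurable

theorem measurableSet_goodEvent (hε : IsInnovation μ ε ε') (q : ℕ) :
    MeasurableSet (goodEvent μ J ε ε' L s R n F D M q) :=
  MeasurableSet.iInter fun _ => measurableSet_le
    (measurable_quadVar hε.measurable (fun i => measurable_uniformBound hε _ i) _ _)
    measurable_const

theorem eLpNorm_uniformBound_le [IsProbabilityMeasure μ]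
    (h : CompatibilityCondition μ n J ε ε' F D fbar L s R CR Cf CX ν p Δ Dn)
    (hε : IsInnovation μ ε ε') (hJ : ∀ i, Measurable (J i)) {i : ℕ} (hi : i ∈ Finset.Icc 1 n)
    (j : ℕ) :
    eLpNorm (uniformBound μ J ε ε' L s R n F D j i) (ENNReal.ofReal ν) μ
      ≤ ENNReal.ofReal (envelopeAt n F D i * Δ j) := by
  have hν1 : 1 ≤ ENNReal.ofReal ν := by
    rw [← ENNReal.ofReal_one]; exact ENNReal.ofReal_le_ofReal (by linarith [h.two_le_ν])
  have he : 0 ≤ envelopeAt n F D i := ENNReal.toReal_nonneg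
  have h1 := eLpNorm_const_smul (envelopeAt n F D i)
    (μ[couplingBound J ε ε' L s R i j (gridPoint n i)|sigmaOn ε (Set.Ici (i - j : ℤ))])
    (ENNReal.ofReal ν) μ
  rw [Real.enorm_of_nonneg he] at h1
  rw [ENNReal.ofReal_mul he]
  refine h1.le.trans (mul_le_mul_right ?_ _)
  exact (eLpNorm_condExp_le_eLpNorm _ hν1).trans (h.eLpNorm_couplingBound_le hε hJ hi j _)

theorem memLp_uniformBound [IsProbabilityMeasure μ]
    (h : CompatibilityCondition μ n J ε ε' F D fbar L s R CR Cf CX ν p Δ Dn)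
    (hε : IsInnovation μ ε ε') (hJ : ∀ i, Measurable (J i)) {i : ℕ} (hi : i ∈ Finset.Icc 1 n)
    (j : ℕ) : MemLp (uniformBound μ J ε ε' L s R n F D j i) 2 μ := by
  have hν2 : (2 : ℝ≥0∞) ≤ ENNReal.ofReal ν := by
    rw [← ENNReal.ofReal_ofNat]; exact ENNReal.ofReal_le_ofReal h.two_le_ν
  exact MemLp.mono_exponent ⟨(measurable_uniformBound hε j i).aestronglyMeasurable,
    (eLpNorm_uniformBound_le h hε hJ hi j).trans_lt ENNReal.ofReal_lt_top⟩ hν2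

/-- The weights at `j = q + m` dominate those at `m + 1`, where `m` is the index of the scales. -/
theorem tildeBeta_sum_le (hν : 2 ≤ ν) (hΔ0 : ∀ k, 0 ≤ Δ k) {q : ℕ} (hq : 1 ≤ q)
    (hβ : tildeBeta ν Δ q ≠ ∞) (N : ℕ) :
    ∑ m ∈ Finset.range N, Δ (q + m) * omegaWeight ν (m + 1) ≤ (tildeBeta ν Δ q).toReal := by
  have hω : ∀ m, 0 ≤ omegaWeight ν (m + 1) := fun m =>
    zero_le_one.trans (one_le_omegaWeight (by linarith) (by omega))
  rw [← ENNReal.ofReal_le_iff_le_toReal hβ,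
    ENNReal.ofReal_sum_of_nonneg fun m _ => mul_nonneg (hΔ0 _) (hω m)]
  refine le_trans (Finset.sum_le_sum fun m _ => ENNReal.ofReal_le_ofReal ?_)
    (ENNReal.sum_le_tsum (f := fun m : ℕ =>
      ENNReal.ofReal (Δ (q + m) * omegaWeight ν (q + m) * iterLog (q + m))) (Finset.range N))
  have h1 := omegaWeight_mono (ν := ν) (by linarith) (k := m + 1) (l := q + m) (by omega) (by omega)
  have h2 := one_le_iterLog (q := q + m) (by omega)
  have h3 : 0 ≤ Δ (q + m) * omegaWeight ν (q + m) := mul_nonneg (hΔ0 _) ((hω m).trans h1)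
  exact (mul_le_mul_of_nonneg_left h1 (hΔ0 _)).trans (le_mul_of_one_le_right h3 h2)

/-- With `X = 𝔻^∞ √n / (M Φ(q))`, the union bound over the distances gives `(X β̃(q))^ν`. Since
`ν ≥ 2` this is at most `(X β̃(q))²` if `X β̃(q) ≤ 1`, and otherwise the claim is trivial. -/
theorem measure_compl_goodEvent_le [IsProbabilityMeasure μ]
    (h : CompatibilityCondition μ n J ε ε' F D fbar L s R CR Cf CX ν p Δ Dn)
    (hε : IsInnovation μ ε ε') (hJ : ∀ i, Measurable (J i)) (hn : 1 ≤ n) (hΔ : Antitone Δ)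
    (hΔ0 : ∀ k, 0 ≤ Δ k) (hDinf : 0 ≤ Dinf) (hD : envelopeNorm n F D ≤ ENNReal.ofReal Dinf)
    (hM : 0 < M) {q : ℕ} (hq : 1 ≤ q) :
    μ (goodEvent μ J ε ε' L s R n F D M q)ᶜ
      ≤ 4 * (ENNReal.ofReal Dinf * tildeBeta ν Δ q * ENNReal.ofReal (Real.sqrt n) /
        ENNReal.ofReal (M * Phi q)) ^ 2 := by
  have hν := h.two_le_ν
  have hMP : 0 < M * Phi q := mul_pos hM (Phi_pos hq)
  have hn0 : (0 : ℝ) < n := by exact_mod_cast hn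
  set X : ℝ := Dinf * Real.sqrt n / (M * Phi q) with hX
  have hX0 : 0 ≤ X := by positivity
  have hterm : ∀ m, μ {ω | (32 * (M * Phi q) * scaleWeight m) ^ 2
        < quadVar μ ε (uniformBound μ J ε ε' L s R n F D (q + m)) n (q + m) ω}
      ≤ ENNReal.ofReal ((X / 16) ^ ν * (Δ (q + m) / scaleWeight m) ^ ν) := by
    intro m
    have hg := scaleWeight_pos m
    have hb := measure_lt_quadVar_le (μ := μ) hε.measurable
      (η := uniformBound μ J ε ε' L s R n F D (q + m)) (n := n) (j := q + m)
      (fun i => measurable_uniformBound hε _ i) hν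
      (c := fun i => envelopeAt n F D i * Δ (q + m))
      (fun i => mul_nonneg ENNReal.toReal_nonneg (hΔ0 _))
      (fun i hi => eLpNorm_uniformBound_le h hε hJ hi (q + m))
      (C := n * Dinf ^ 2 * Δ (q + m) ^ 2) (by
        simp_rw [mul_pow]
        rw [← Finset.sum_mul]
        exact mul_le_mul_of_nonneg_right (sum_envelopeAt_sq_le hn hDinf hD).2 (sq_nonneg _))
      (α := 32 * (M * Phi q) * scaleWeight m) (by positivity)
    refine hb.trans (ENNReal.ofReal_le_ofReal ?_)
    have hY : 0 ≤ X / 16 * (Δ (q + m) / scaleWeight m) :=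
      mul_nonneg (by positivity) (div_nonneg (hΔ0 _) hg.le)
    rw [← Real.mul_rpow (by positivity) (div_nonneg (hΔ0 _) hg.le)]
    have hsq : 2 * (n * Dinf ^ 2 * Δ (q + m) ^ 2) / (32 * (M * Phi q) * scaleWeight m) ^ 2
        ≤ (X / 16 * (Δ (q + m) / scaleWeight m)) ^ 2 := by
      have : (X / 16 * (Δ (q + m) / scaleWeight m)) ^ 2
          = 4 * (n * Dinf ^ 2 * Δ (q + m) ^ 2) / (32 * (M * Phi q) * scaleWeight m) ^ 2 := by
        rw [hX]
        field_simp
        rw [Real.sq_sqrt hn0.le]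
        ring
      rw [this]
      gcongr
      norm_num
    calc _ ≤ ((X / 16 * (Δ (q + m) / scaleWeight m)) ^ 2) ^ (ν / 2) :=
          Real.rpow_le_rpow (by positivity) hsq (by linarith)
      _ = _ := by
          rw [← Real.rpow_natCast, ← Real.rpow_mul hY]
          congr 1
          push_cast
          ring
  have hunion : μ (goodEvent μ J ε ε' L s R n F D M q)ᶜ
      ≤ ∑' m, ENNReal.ofReal ((X / 16) ^ ν * (Δ (q + m) / scaleWeight m) ^ ν) := by
    unfold goodEvent
    rw [Set.compl_iInter]
    refine (measure_iUnion_le _).trans (ENNReal.tsum_le_tsum fun m => ?_)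
    refine le_trans (measure_mono fun ω hω => ?_) (hterm m)
    simpa using hω
  rcases eq_or_lt_of_le hDinf with hD0 | hDpos
  · refine hunion.trans ?_
    have : X = 0 := by rw [hX, ← hD0]; simp
    rw [this, zero_div, Real.zero_rpow (by linarith)]
    simp
  have hs : ENNReal.ofReal (Real.sqrt n) ≠ 0 := by
    simpa using (by omega : 0 < n)
  have hDne : ENNReal.ofReal Dinf ≠ 0 := by simpa using hDpos
  by_cases hβ : tildeBeta ν Δ q = ∞
  · rw [hβ, ENNReal.mul_top hDne, ENNReal.top_mul hs, ENNReal.top_div_of_ne_top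
      ENNReal.ofReal_ne_top]
    simp
  set S : ℝ := (tildeBeta ν Δ q).toReal with hS
  have hS0 : 0 ≤ S := ENNReal.toReal_nonneg
  have hRHS : ENNReal.ofReal Dinf * tildeBeta ν Δ q * ENNReal.ofReal (Real.sqrt n) /
        ENNReal.ofReal (M * Phi q) = ENNReal.ofReal (X * S) := by
    rw [← ENNReal.ofReal_toReal hβ, ← hS, ← ENNReal.ofReal_mul hDinf,
      ← ENNReal.ofReal_mul (by positivity), ← ENNReal.ofReal_div_of_pos hMP, hX]
    congr 1
    ring
  rw [hRHS]
  rcases le_or_gt 1 (X * S) with h1 | h1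
  · have h2 : (1 : ℝ≥0∞) ≤ ENNReal.ofReal (X * S) := ENNReal.one_le_ofReal.2 h1
    exact prob_le_one.trans (one_le_mul (by norm_num) (one_le_pow₀ h2))
  · have h2 : ∑' m, ENNReal.ofReal ((X / 16) ^ ν * (Δ (q + m) / scaleWeight m) ^ ν)
        ≤ ENNReal.ofReal ((X * S) ^ ν) := by
      refine ENNReal.tsum_le_of_sum_range_le fun N => ?_
      rw [← ENNReal.ofReal_sum_of_nonneg fun m _ => mul_nonneg (by positivity)
        (Real.rpow_nonneg (div_nonneg (hΔ0 _) (scaleWeight_pos m).le) _), ← Finset.mul_sum]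
      refine ENNReal.ofReal_le_ofReal ?_
      have h4 := sum_div_scaleWeight_rpow_le (δ := fun m => Δ (q + m))
        (fun a b hab => hΔ (by omega)) (fun m => hΔ0 _) hν (tildeBeta_sum_le hν hΔ0 hq hβ) N
      calc _ ≤ (X / 16) ^ ν * (16 * S) ^ ν := by gcongr
        _ = _ := by
          rw [← Real.mul_rpow (by positivity) (by positivity)]
          congr 1
          ring
    refine (hunion.trans h2).trans ?_
    have hXS : 0 ≤ X * S := mul_nonneg hX0 hS0
    rw [← ENNReal.ofReal_pow hXS]
    calc ENNReal.ofReal ((X * S) ^ ν) ≤ ENNReal.ofReal ((X * S) ^ 2) := by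
          refine ENNReal.ofReal_le_ofReal ?_
          rcases eq_or_lt_of_le hXS with h0 | h0
          · rw [← h0, Real.zero_rpow (by linarith)]; norm_num
          · have := Real.rpow_le_rpow_of_exponent_ge h0 h1.le hν
            simpa using this
      _ ≤ _ := le_mul_of_one_le_left zero_le (by norm_num)

end FunctionalDependence

namespace FunctionalDependence

/-! ### The deviation inequality -/

variable {Ω : Type*} {m0 : MeasurableSpace Ω} {μ : Measure Ω} {e d : ℕ}
  {ε ε' : ℤ → Ω → (Fin e → ℝ)} {J : ℤ → (ℕ → (Fin e → ℝ)) → (Fin d → ℝ)}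
  {L : ℕ → ℝ} {s : ℝ} {R : PathFun d} {CR Cf CX ν : ℝ} {p : ℝ≥0∞} {Δ : ℕ → ℝ} {n : ℕ}
  {F : Set (PathFun d)} {D : PathFun d → unitInterval → ℝ} {fbar : PathFun d → PathFun d}
  {Dn Dinf M : ℝ} {f : PathFun d}

/-- The observation `f(Z_i, i/n)`. -/
noncomputable def obs (J : ℤ → (ℕ → (Fin e → ℝ)) → (Fin d → ℝ)) (ε : ℤ → Ω → (Fin e → ℝ)) (n : ℕ)
    (f : PathFun d) (i : ℕ) (ω : Ω) : ℝ :=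
  f (past (shiftSeq J ε) (i : ℤ) ω) (gridPoint n i)

theorem stronglyMeasurable_obs (hJ : ∀ i, Measurable (J i)) (hfm : Measurable (Function.uncurry f))
    (i : ℕ) : StronglyMeasurable[sigmaOn ε (Set.Iic (i : ℤ))] (obs J ε n f i) := by
  have h1 : Measurable fun z => f z (gridPoint n i) :=
    hfm.comp (measurable_id.prodMk measurable_const)
  exact (h1.comp (measurable_past_sigmaOn hJ i)).stronglyMeasurable

theorem memLp_obs [IsProbabilityMeasure μ] (hε : IsInnovation μ ε ε') (hJ : ∀ i, Measurable (J i))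
    (hfm : Measurable (Function.uncurry f)) (hfM : ∀ z u, |f z u| ≤ M) (i : ℕ) :
    MemLp (obs J ε n f i) 2 μ :=
  MemLp.of_bound ((stronglyMeasurable_obs hJ hfm i).mono
    (sigmaOn_le hε.measurable _)).aestronglyMeasurable M
    (Filter.Eventually.of_forall fun _ => hfM _ _)

theorem norm2n_ne_top_and_sq [IsProbabilityMeasure μ] (hn : 1 ≤ n) (hε : IsInnovation μ ε ε')
    (hJ : ∀ i, Measurable (J i)) (hfm : Measurable (Function.uncurry f))
    (hfM : ∀ z u, |f z u| ≤ M) :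
    norm2n μ n J ε f ≠ ∞ ∧
      ∑ i ∈ Finset.Icc 1 n, ∫ ω, obs J ε n f i ω ^ 2 ∂μ = n * (norm2n μ n J ε f).toReal ^ 2 := by
  have hn0 : (0 : ℝ) < n := by exact_mod_cast hn
  set T : ℝ := ∑ i ∈ Finset.Icc 1 n, ∫ ω, obs J ε n f i ω ^ 2 ∂μ with hT
  have hi : ∀ i, 0 ≤ ∫ ω, obs J ε n f i ω ^ 2 ∂μ := fun i => integral_nonneg fun _ => sq_nonneg _
  have hT0 : 0 ≤ T := Finset.sum_nonneg fun i _ => hi i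
  have h1 : norm2n μ n J ε f = ENNReal.ofReal ((T / n) ^ (1 / 2 : ℝ)) := by
    unfold norm2n
    rw [← ENNReal.ofReal_rpow_of_nonneg (by positivity) (by norm_num)]
    congr 1
    rw [ENNReal.ofReal_div_of_pos hn0, ENNReal.ofReal_natCast, div_eq_mul_inv, mul_comm, hT,
      ENNReal.ofReal_sum_of_nonneg fun i _ => hi i]
    congr 1
    exact Finset.sum_congr rfl fun i _ => (ofReal_integral_sq (memLp_obs hε hJ hfm hfM i)).symm
  refine ⟨by rw [h1]; exact ENNReal.ofReal_ne_top, ?_⟩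
  rw [h1, ENNReal.toReal_ofReal (by positivity), ← Real.sqrt_eq_rpow, Real.sq_sqrt (by positivity)]
  field_simp

/-- Each projection is bounded in mean square both trivially and through the coupling; the smaller
bound leads to the minimum in `Ṽ(f)`. -/
theorem sum_integral_projAt_obs_sq_le [IsProbabilityMeasure μ]
    (h : CompatibilityCondition μ n J ε ε' F D fbar L s R CR Cf CX ν p Δ Dn)
    (hn : 1 ≤ n) (hε : IsInnovation μ ε ε') (hJ : ∀ i, Measurable (J i)) (hΔ0 : ∀ k, 0 ≤ Δ k)
    (hDn : 0 ≤ Dn) (hf : f ∈ F) (hfm : Measurable (Function.uncurry f))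
    (hfM : ∀ z u, |f z u| ≤ M) (j : ℕ) :
    ∑ i ∈ Finset.Icc 1 n, ∫ ω, projAt μ ε (obs J ε n f i) (i - j) ω ^ 2 ∂μ
      ≤ n * min (2 * (norm2n μ n J ε f).toReal) (Dn * Δ j) ^ 2 := by
  have hn0 : (0 : ℝ) < n := by exact_mod_cast hn
  rcases min_choice (2 * (norm2n μ n J ε f).toReal) (Dn * Δ j) with hmin | hmin <;> rw [hmin]
  · calc _ ≤ ∑ i ∈ Finset.Icc 1 n, 4 * ∫ ω, obs J ε n f i ω ^ 2 ∂μ :=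
          Finset.sum_le_sum fun i _ => integral_projAt_sq_le
            (memLp_obs hε hJ hfm hfM i).aestronglyMeasurable (fun _ => hfM _ _) _
      _ = _ := by
          rw [← Finset.mul_sum, (norm2n_ne_top_and_sq hn hε hJ hfm hfM).2]; ring
  · have hi : ∀ i ∈ Finset.Icc 1 n, ∫ ω, projAt μ ε (obs J ε n f i) (i - j) ω ^ 2 ∂μ
        ≤ (|D f (gridPoint n i)| * Δ j) ^ 2 := by
      intro i hi
      refine integral_sq_le_of_eLpNorm_le (memLp_projAt (fun _ => hfM _ _) _)
        (mul_nonneg (abs_nonneg _) (hΔ0 j)) ?_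
      have hb := h.abs_projAt_le hε hJ hf hfm hfM hi j (gridPoint n i)
      have hν2 : (2 : ℝ≥0∞) ≤ ENNReal.ofReal ν := by
        rw [← ENNReal.ofReal_ofNat]; exact ENNReal.ofReal_le_ofReal h.two_le_ν
      have h1 := eLpNorm_const_smul |D f (gridPoint n i)|
        (μ[couplingBound J ε ε' L s R i j (gridPoint n i)|sigmaOn ε (Set.Ici (i - j : ℤ))]) 2 μ
      rw [Real.enorm_of_nonneg (abs_nonneg _)] at h1
      calc _ ≤ _ := eLpNorm_mono_ae_real hb
        _ = _ := h1
        _ ≤ _ := by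
          rw [ENNReal.ofReal_mul (abs_nonneg _)]
          refine mul_le_mul_right ?_ _
          refine (eLpNorm_condExp_le_eLpNorm _ one_le_two).trans ?_
          exact (eLpNorm_le_eLpNorm_of_exponent_le hν2
            (measurable_couplingBound hε hJ
              h.smoothClass.R_measurable i j _).aestronglyMeasurable).trans
            (h.eLpNorm_couplingBound_le hε hJ hi j _)
    refine (Finset.sum_le_sum hi).trans ?_
    have hD := h.D_bound f hf
    rw [Real.sqrt_le_left hDn, one_div, inv_mul_le_iff₀ hn0] at hD
    simp_rw [mul_pow]
    rw [← Finset.sum_mul, ← mul_assoc]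
    exact mul_le_mul_of_nonneg_right hD (sq_nonneg _)

theorem sum_min_le_tildeV (hν : 0 ≤ ν) (hΔ0 : ∀ k, 0 ≤ Δ k) (hDn : 0 ≤ Dn)
    (hN : norm2n μ n J ε f ≠ ∞) (hV : tildeV μ n J ε ν Δ Dn f ≠ ∞) (q : ℕ) :
    ∑ j ∈ Finset.range q, min (2 * (norm2n μ n J ε f).toReal) (Dn * Δ j)
      ≤ 2 * (tildeV μ n J ε ν Δ Dn f).toReal := by
  set N : ℝ := (norm2n μ n J ε f).toReal with hNdef
  have hN0 : 0 ≤ N := ENNReal.toReal_nonneg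
  have hv0 : ∀ j, 0 ≤ min (2 * N) (Dn * Δ j) := fun j =>
    le_min (by positivity) (mul_nonneg hDn (hΔ0 j))
  have hterm : ∀ j : ℕ, min (2 * N) (Dn * Δ (j + 1))
      ≤ 2 * (min N (Dn * Δ (j + 1) * omegaWeight ν (j + 1)) * iterLog (j + 1)) := by
    intro j
    have h1 := one_le_omegaWeight (ν := ν) hν (q := j + 1) (by omega)
    have h2 := one_le_iterLog (q := j + 1) (by omega)
    have h3 : 0 ≤ Dn * Δ (j + 1) := mul_nonneg hDn (hΔ0 _)
    have h4 : Dn * Δ (j + 1) ≤ Dn * Δ (j + 1) * omegaWeight ν (j + 1) :=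
      le_mul_of_one_le_right h3 h1
    have h5 : 0 ≤ min N (Dn * Δ (j + 1) * omegaWeight ν (j + 1)) := le_min hN0 (h3.trans h4)
    have h6 : min (2 * N) (Dn * Δ (j + 1))
        ≤ 2 * min N (Dn * Δ (j + 1) * omegaWeight ν (j + 1)) := by
      rw [mul_min_of_nonneg _ _ two_pos.le]
      exact min_le_min le_rfl (by linarith)
    linarith [le_mul_of_one_le_right h5 h2]
  have hsum : N + ∑ j ∈ Finset.range q,
      min N (Dn * Δ (j + 1) * omegaWeight ν (j + 1)) * iterLog (j + 1)
      ≤ (tildeV μ n J ε ν Δ Dn f).toReal := by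
    have hnn : ∀ j ∈ Finset.range q,
        0 ≤ min N (Dn * Δ (j + 1) * omegaWeight ν (j + 1)) * iterLog (j + 1) := by
      intro j _
      linarith [hterm j, hv0 (j + 1)]
    rw [← ENNReal.ofReal_le_iff_le_toReal hV, ENNReal.ofReal_add hN0 (Finset.sum_nonneg hnn),
      ENNReal.ofReal_toReal hN, ENNReal.ofReal_sum_of_nonneg hnn]
    refine add_le_add le_rfl (le_trans (le_of_eq ?_) (ENNReal.sum_le_tsum (Finset.range q)))
    refine Finset.sum_congr rfl fun j _ => ?_
    have h1 := one_le_omegaWeight (ν := ν) hν (q := j + 1) (by omega)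
    have h3 : 0 ≤ Dn * Δ (j + 1) := mul_nonneg hDn (hΔ0 _)
    rw [ENNReal.ofReal_mul (le_min hN0 (mul_nonneg h3 (by linarith))), ENNReal.ofReal_min,
      ENNReal.ofReal_toReal hN]
  calc ∑ j ∈ Finset.range q, min (2 * N) (Dn * Δ j)
      ≤ ∑ j ∈ Finset.range (q + 1), min (2 * N) (Dn * Δ j) :=
        Finset.sum_le_sum_of_subset_of_nonneg (Finset.range_mono (Nat.le_succ q))
          fun j _ _ => hv0 j
    _ ≤ 2 * (N + ∑ j ∈ Finset.range q,
          min N (Dn * Δ (j + 1) * omegaWeight ν (j + 1)) * iterLog (j + 1)) := by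
        rw [Finset.sum_range_succ', mul_add, Finset.mul_sum, add_comm]
        exact add_le_add (min_le_left _ _) (Finset.sum_le_sum fun j _ => hterm j)
    _ ≤ _ := by linarith

/-- The constant `c₁` in the exponent. The summand `256` serves the short memory, the multiple of
the total scale weight the long memory. -/
noncomputable def expConst : ℝ := 256 + 64 * ∑' m, scaleWeight m

theorem tsum_scaleWeight_pos : 0 < ∑' m, scaleWeight m :=
  summable_scaleWeight.tsum_pos (fun m => (scaleWeight_pos m).le) 0 (scaleWeight_pos 0)

/-- Comparison of the exponent for the short memory at `√n x / 2` with the one in the theorem. -/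
theorem exponent_shortMemory_le {V₀ V M P x : ℝ} {q n : ℕ} (hn : 1 ≤ n) (hq : 1 ≤ q)
    (hV₀ : 0 ≤ V₀) (hV : V₀ ≤ 2 * V) (hM : 0 < M) (hP : 0 < P) (hqP : q ≤ P) (hx : 0 < x) :
    1 / expConst * (x ^ 2 / (V ^ 2 + M * P / Real.sqrt n * x))
      ≤ (Real.sqrt n * x / 2) ^ 2
        / (16 * (n * V₀ ^ 2) + 8 * (M * q) * (Real.sqrt n * x / 2)) := by
  have hn0 : (0 : ℝ) < n := by exact_mod_cast hn
  have hq0 : (0 : ℝ) < q := by exact_mod_cast hq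
  have hr : 0 < Real.sqrt n := Real.sqrt_pos.2 hn0
  set r : ℝ := Real.sqrt n with hrdef
  have hr2 : (n : ℝ) = r ^ 2 := (Real.sq_sqrt hn0.le).symm
  rw [hr2]
  have hden : 0 < V ^ 2 + M * P / r * x := by positivity
  have hc : 1 / expConst ≤ 1 / 256 := by
    unfold expConst
    have := tsum_scaleWeight_pos
    gcongr
    linarith
  refine (mul_le_mul_of_nonneg_right hc (by positivity)).trans ?_
  rw [div_mul_div_comm, one_mul, div_le_div_iff₀ (by positivity) (by positivity)]
  have h1 : r ^ 2 * (V ^ 2 + M * P / r * x) = r ^ 2 * V ^ 2 + M * P * r * x := by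
    field_simp
  have h2 : V₀ ^ 2 ≤ 4 * V ^ 2 := by
    have := pow_le_pow_left₀ hV₀ hV 2
    linarith
  have h3 : M * q * (r * x) ≤ M * P * (r * x) := by gcongr
  have h5 : r ^ 2 * V₀ ^ 2 ≤ r ^ 2 * (4 * V ^ 2) := by gcongr
  have h6 : 0 ≤ M * P * (r * x) := by positivity
  have h4 : 16 * (r ^ 2 * V₀ ^ 2) + 8 * (M * q) * (r * x / 2)
      ≤ 64 * (r ^ 2 * (V ^ 2 + M * P / r * x)) := by
    rw [h1]
    linarith
  calc _ ≤ x ^ 2 * (64 * (r ^ 2 * (V ^ 2 + M * P / r * x))) := by gcongr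
    _ = _ := by ring

/-- Comparison of the exponent for the long memory at `√n x / 2` with the one in the theorem: it is
linear in `x`, and the second term of the denominator alone suffices. -/
theorem exponent_longMemory_le {V M P x : ℝ} {n : ℕ} (hn : 1 ≤ n) (hM : 0 < M) (hP : 0 < P)
    (hx : 0 < x) :
    1 / expConst * (x ^ 2 / (V ^ 2 + M * P / Real.sqrt n * x))
      ≤ Real.sqrt n * x / 2 / (32 * (M * P) * ∑' m, scaleWeight m) := by
  have hn0 : (0 : ℝ) < n := by exact_mod_cast hn
  have hr : 0 < Real.sqrt n := Real.sqrt_pos.2 hn0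
  set r : ℝ := Real.sqrt n with hrdef
  have hK := tsum_scaleWeight_pos
  have hc : 1 / expConst ≤ 1 / (64 * ∑' m, scaleWeight m) := by
    unfold expConst
    gcongr
    linarith
  calc 1 / expConst * (x ^ 2 / (V ^ 2 + M * P / r * x))
      ≤ 1 / (64 * ∑' m, scaleWeight m) * (x ^ 2 / (M * P / r * x)) := by
        gcongr
        linarith [sq_nonneg V]
    _ = _ := by field_simp; norm_num

/-- The centred sum is split into short and long memory, which are both compared with `√n x / 2`. -/
theorem measure_empProc_inter_goodEvent_le [IsProbabilityMeasure μ]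
    (h : CompatibilityCondition μ n J ε ε' F D fbar L s R CR Cf CX ν p Δ Dn)
    (hn : 1 ≤ n) (hε : IsInnovation μ ε ε') (hJ : ∀ i, Measurable (J i)) (hΔ0 : ∀ k, 0 ≤ Δ k)
    (hDn : 0 ≤ Dn) (hDinf : 0 ≤ Dinf) (hD : envelopeNorm n F D ≤ ENNReal.ofReal Dinf)
    (hM : 0 < M) (hf : f ∈ F) (hfm : Measurable (Function.uncurry f))
    (hfM : ∀ z u, |f z u| ≤ M) {q : ℕ} (hq : 1 ≤ q) {x : ℝ} (hx : 0 < x) :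
    μ ({ω | x < |empProc μ n J ε f ω|} ∩ goodEvent μ J ε ε' L s R n F D M q)
      ≤ bernsteinBound (5 + 2 * Real.exp 1) expConst (tildeV μ n J ε ν Δ Dn f)
        (M * Phi q / Real.sqrt n) x := by
  have hn0 : (0 : ℝ) < n := by exact_mod_cast hn
  have hr : 0 < Real.sqrt n := Real.sqrt_pos.2 hn0
  have hP := Phi_pos hq
  have hν := h.two_le_ν
  by_cases hV : tildeV μ n J ε ν Δ Dn f = ∞
  · refine prob_le_one.trans ?_
    unfold bernsteinBound
    rw [hV, ENNReal.top_pow two_ne_zero, top_add, ENNReal.div_top, ENNReal.toReal_zero, mul_zero,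
      Real.exp_zero, mul_one, ENNReal.one_le_ofReal]
    linarith [Real.exp_pos 1]
  obtain ⟨hN, -⟩ := norm2n_ne_top_and_sq (f := f) hn hε hJ hfm hfM
  set v : ℕ → ℝ := fun j => min (2 * (norm2n μ n J ε f).toReal) (Dn * Δ j) with hv
  have hv0 : ∀ j, 0 ≤ v j := fun j =>
    le_min (mul_nonneg two_pos.le ENNReal.toReal_nonneg) (mul_nonneg hDn (hΔ0 j))
  have hvV := sum_min_le_tildeV (f := f) (by linarith) hΔ0 hDn hN hV q
  set W : ℕ → Ω → ℝ := obs J ε n f with hW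
  have hWb : ∀ i ω, |W i ω| ≤ M := fun i ω => hfM _ _
  have hWm : ∀ i : ℕ, StronglyMeasurable[sigmaOn ε (Set.Iic (i : ℤ))] (W i) := fun i =>
    stronglyMeasurable_obs hJ hfm i
  set a : ℝ := Real.sqrt n * x / 2 with ha
  have ha0 : 0 < a := by positivity
  have hshort := measureReal_shortMemory_le hε.measurable hε.indep hM.le hWb hWm hq hv0
    (fun j _ => sum_integral_projAt_obs_sq_le h hn hε hJ hΔ0 hDn hf hfm hfM j) ha0
  obtain ⟨hDi, -⟩ := sum_envelopeAt_sq_le (F := F) (D := D) hn hDinf hD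
  have hproj : ∀ j : ℕ, ∀ i ∈ Finset.Icc 1 n, ∀ᵐ ω ∂μ,
      |projAt μ ε (W i) (i - j) ω| ≤ uniformBound μ J ε ε' L s R n F D j i ω := by
    intro j i hi
    have hnn : 0 ≤ᵐ[μ] μ[couplingBound J ε ε' L s R i j (gridPoint n i)|
        sigmaOn ε (Set.Ici (i - j : ℤ))] := condExp_nonneg (Filter.Eventually.of_forall fun ω =>
      couplingBound_nonneg h.smoothClass.L_nonneg h.smoothClass.R_nonneg _ _ _ ω)
    filter_upwards [h.abs_projAt_le hε hJ hf hfm hfM hi j (gridPoint n i), hnn] with ω h1 h2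
    exact h1.trans (mul_le_mul_of_nonneg_right (hDi i hi f hf) h2)
  have hlong := measure_longMemory_le (q := q) (a := a) hε.measurable hε.indep hWb hWm
    (fun j i hi => memLp_uniformBound h hε hJ hi j) hproj
    (α := fun m => 32 * (M * Phi q) * scaleWeight m)
    (A := 32 * (M * Phi q) * ∑' m, scaleWeight m)
    (fun m => mul_pos (by positivity) (scaleWeight_pos m))
    (fun N => by
      rw [← Finset.mul_sum]
      exact mul_le_mul_of_nonneg_left
        (summable_scaleWeight.sum_le_tsum _ fun m _ => (scaleWeight_pos m).le) (by positivity))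
    (measurableSet_goodEvent (M := M) hε q)
    (fun ω hω m => Set.mem_iInter.1 hω m)
  set V : ℝ := (tildeV μ n J ε ν Δ Dn f).toReal with hVdef
  set r : ℝ := x ^ 2 / (V ^ 2 + M * Phi q / Real.sqrt n * x) with hrdef
  have hqP : (q : ℝ) ≤ Phi q := le_mul_of_one_le_right (Nat.cast_nonneg q) (one_le_iterLog hq)
  have e1 := exponent_shortMemory_le hn hq (Finset.sum_nonneg fun j _ => hv0 j) hvV hM hP hqP hx
  have e2 := exponent_longMemory_le (V := V) hn hM hP hx
  have hbound : bernsteinBound (5 + 2 * Real.exp 1) expConst (tildeV μ n J ε ν Δ Dn f)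
      (M * Phi q / Real.sqrt n) x
      = ENNReal.ofReal ((5 + 2 * Real.exp 1) * Real.exp (-(1 / expConst * r))) := by
    unfold bernsteinBound
    have hden : 0 < V ^ 2 + M * Phi q / Real.sqrt n * x := by positivity
    rw [← ENNReal.ofReal_toReal hV, ← hVdef, ← ENNReal.ofReal_pow ENNReal.toReal_nonneg,
      ← ENNReal.ofReal_add (sq_nonneg _) (by positivity), ← ENNReal.ofReal_div_of_pos hden,
      ENNReal.toReal_ofReal (by positivity), neg_mul]
  have hsub : {ω | x < |empProc μ n J ε f ω|} ∩ goodEvent μ J ε ε' L s R n F D M q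
      ⊆ {ω | a < |∑ i ∈ Finset.Icc 1 n, shortMemory μ ε W q i ω|}
        ∪ ({ω | a < |∑ i ∈ Finset.Icc 1 n, (W i ω - ∫ ω, W i ω ∂μ - shortMemory μ ε W q i ω)|}
          ∩ goodEvent μ J ε ε' L s R n F D M q) := by
    rintro ω ⟨hω, hG⟩
    by_contra hcon
    simp only [Set.mem_union, Set.mem_inter_iff, Set.mem_ofPred_eq, not_or, not_and, not_lt] at hcon
    have h1 : ¬ a < |∑ i ∈ Finset.Icc 1 n, (W i ω - ∫ ω, W i ω ∂μ - shortMemory μ ε W q i ω)| :=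
      fun hlt => hcon.2 hlt hG
    have hω' : x < |empProc μ n J ε f ω| := hω
    have hemp : empProc μ n J ε f ω = 1 / Real.sqrt n * (∑ i ∈ Finset.Icc 1 n,
        shortMemory μ ε W q i ω + ∑ i ∈ Finset.Icc 1 n,
          (W i ω - ∫ ω, W i ω ∂μ - shortMemory μ ε W q i ω)) := by
      rw [← Finset.sum_add_distrib]
      unfold empProc
      congr 1
      refine Finset.sum_congr rfl fun i _ => ?_
      simp only [hW, obs]
      ring
    rw [hemp, abs_mul, abs_of_pos (by positivity), one_div, ← div_eq_inv_mul,
      lt_div_iff₀ hr] at hω'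
    have h2 := hω'.trans_le (abs_add_le _ _)
    linarith [hcon.1, not_lt.1 h1]
  rw [hbound]
  calc _ ≤ _ := (measure_mono hsub).trans (measure_union_le _ _)
    _ ≤ ENNReal.ofReal (4 * Real.exp (-(1 / expConst * r)))
        + ENNReal.ofReal ((1 + 2 * Real.exp 1) * Real.exp (-(1 / expConst * r))) := by
        refine add_le_add ?_ (hlong.trans (ENNReal.ofReal_le_ofReal ?_))
        · rw [← ofReal_measureReal]
          refine ENNReal.ofReal_le_ofReal (hshort.trans ?_)
          gcongr
        · gcongr
    _ = _ := by
        rw [← ENNReal.ofReal_add (by positivity) (by positivity)]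
        congr 1
        ring

end FunctionalDependence

theorem mainTheorem9 :
    ∃ c₀ c₁ : ℝ, 0 < c₀ ∧ 0 < c₁ ∧
      ∀ (Ω : Type*) [MeasurableSpace Ω] (μ : MeasureTheory.Measure Ω)
        [MeasureTheory.IsProbabilityMeasure μ]
        (e d n : ℕ) (_hn : 1 ≤ n)
        (ε ε' : ℤ → Ω → (Fin e → ℝ)) (_hε : FunctionalDependence.IsInnovation μ ε ε')
        (J : ℤ → (ℕ → (Fin e → ℝ)) → (Fin d → ℝ)) (_hJ : ∀ i, Measurable (J i))
        (F : Set (FunctionalDependence.PathFun d))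
        (_hF : ∀ f ∈ F, Measurable (Function.uncurry f))
        (D : FunctionalDependence.PathFun d → unitInterval → ℝ)
        (fbar : FunctionalDependence.PathFun d → FunctionalDependence.PathFun d)
        (L : ℕ → ℝ) (s : ℝ) (R : FunctionalDependence.PathFun d) (CR Cf CX ν : ℝ) (p : ℝ≥0∞)
        (Δ : ℕ → ℝ) (_hΔ : Antitone Δ) (_hΔ_nonneg : ∀ k, 0 ≤ Δ k) (_hΔ_summable : Summable Δ)
        (Dn : ℝ) (_hDn : 0 ≤ Dn)
        (_hcompat : FunctionalDependence.CompatibilityCondition μ n J ε ε' F D fbar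
          L s R CR Cf CX ν p Δ Dn)
        (Dinf : ℝ) (_hDinf : 0 ≤ Dinf)
        (_hDinf_bound : FunctionalDependence.envelopeNorm n F D ≤ ENNReal.ofReal Dinf)
        (M : ℝ) (_hM : 0 < M) (_hM_bound : ∀ f ∈ F, ∀ z u, |f z u| ≤ M),
        ∃ B : ℕ → Set Ω,
          (∀ q, MeasurableSet (B q)) ∧
          (∀ q ∈ Finset.Icc 1 n,
            (∀ f ∈ F, ∀ x : ℝ, 0 < x →
              μ ({ω | x < |FunctionalDependence.empProc μ n J ε f ω|} ∩ B q)
                ≤ FunctionalDependence.bernsteinBound c₀ c₁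
                    (FunctionalDependence.tildeV μ n J ε ν Δ Dn f)
                    (M * FunctionalDependence.Phi q / Real.sqrt n) x) ∧
            μ (B q)ᶜ ≤ 4 * (ENNReal.ofReal Dinf * FunctionalDependence.tildeBeta ν Δ q *
                ENNReal.ofReal (Real.sqrt n) /
                  ENNReal.ofReal (M * FunctionalDependence.Phi q)) ^ 2) ∧
          (FunctionalDependence.tildeBeta ν Δ 1 ≠ ∞ → 0 < Dinf → ∀ y : ℝ, 0 < y →
            (∀ f ∈ F, ∀ x : ℝ, 0 < x →
              μ ({ω | x < |FunctionalDependence.empProc μ n J ε f ω|} ∩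
                  B (FunctionalDependence.tildeQStar ν Δ (M / (Real.sqrt n * Dinf * y))))
                ≤ FunctionalDependence.bernsteinBound c₀ c₁
                    (FunctionalDependence.tildeV μ n J ε ν Δ Dn f)
                    (FunctionalDependence.Phi
                      (FunctionalDependence.tildeQStar ν Δ (M / (Real.sqrt n * Dinf * y)))
                      * M / Real.sqrt n) x) ∧
            μ (B (FunctionalDependence.tildeQStar ν Δ (M / (Real.sqrt n * Dinf * y))))ᶜ
              ≤ ENNReal.ofReal (4 / y ^ 2)) := by
  have hc := FunctionalDependence.tsum_scaleWeight_pos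
  refine ⟨5 + 2 * Real.exp 1, FunctionalDependence.expConst, by positivity, by
    unfold FunctionalDependence.expConst; positivity, ?_⟩
  intro Ω _ μ _ e d n hn ε ε' hε J hJ F hF D fbar L s R CR Cf CX ν p Δ hΔ hΔ0 _ Dn hDn h Dinf hDinf
    hD M hM hfM
  have hdev : ∀ q, 1 ≤ q → ∀ f ∈ F, ∀ x : ℝ, 0 < x → _ := fun q hq f hf x hx =>
    FunctionalDependence.measure_empProc_inter_goodEvent_le h hn hε hJ hΔ0 hDn hDinf hD hM hf
      (hF f hf) (hfM f hf) hq hx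
  have hprob : ∀ q, 1 ≤ q → _ := fun q hq =>
    FunctionalDependence.measure_compl_goodEvent_le h hε hJ hn hΔ hΔ0 hDinf hD hM hq
  refine ⟨FunctionalDependence.goodEvent μ J ε ε' L s R n F D M,
    FunctionalDependence.measurableSet_goodEvent hε, fun q hq =>
      ⟨hdev q (Finset.mem_Icc.1 hq).1, hprob q (Finset.mem_Icc.1 hq).1⟩, ?_⟩
  intro hβ hDpos y hy
  have hn0 : (0 : ℝ) < n := by exact_mod_cast hn
  have hr : 0 < Real.sqrt n := Real.sqrt_pos.2 hn0
  have hz : 0 < M / (Real.sqrt n * Dinf * y) := by positivity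
  obtain ⟨hq, hle⟩ := (FunctionalDependence.tildeQStar_isLeast hβ hz).1
  set q := FunctionalDependence.tildeQStar ν Δ (M / (Real.sqrt n * Dinf * y)) with hqdef
  have hP := FunctionalDependence.Phi_pos hq
  refine ⟨fun f hf x hx => ?_, (hprob q hq).trans ?_⟩
  · rw [mul_comm (FunctionalDependence.Phi q) M]
    exact hdev q hq f hf x hx
  · calc _ ≤ 4 * (ENNReal.ofReal Dinf
          * ENNReal.ofReal (FunctionalDependence.Phi q * (M / (Real.sqrt n * Dinf * y)))
          * ENNReal.ofReal (Real.sqrt n)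
            / ENNReal.ofReal (M * FunctionalDependence.Phi q)) ^ 2 := by gcongr
      _ = ENNReal.ofReal (4 * (1 / y) ^ 2) := by
          have e : Dinf * (FunctionalDependence.Phi q * (M / (Real.sqrt n * Dinf * y)))
              * Real.sqrt n / (M * FunctionalDependence.Phi q) = 1 / y := by
            field_simp
          rw [← ENNReal.ofReal_mul hDinf, ← ENNReal.ofReal_mul (by positivity),
            ← ENNReal.ofReal_div_of_pos (by positivity), e, ENNReal.ofReal_mul (by norm_num),
            ENNReal.ofReal_pow (by positivity), ENNReal.ofReal_ofNat]
      _ = _ := by congr 1; ring
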